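/- Let $K=\mathbb C((\hbar_1))((\hbar_2))$ and let $$\mathcal R=K\langle x,y,\gamma\rangle\big/\big(\gamma^2=1,\ \gamma x=-x\gamma,\ \gamma y=-y\gamma,\ [y,x]=\tfrac{\hbar_1(1+2\hbar_2\gamma)}{2}\big),\qquad \mathbf e=\tfrac{1+\gamma}{2}.$$ Identify a polynomial in $K[x,y]$ with the element of $\mathcal R$ obtained by replacing each commutative monomial $x^ay^b$ by the product $x^ay^b\in\mathcal R$; then $f\mapsto f\mathbf e$ induces a star product on the even polynomials from the product of the spherical subalgebra $\mathbf e\mathcal R\mathbf e$. The Dunkl–Weyl algebra $\mathcal D((\hbar_1))((\hbar_2))$ is $C^\infty(\mathbb R^2)^{\mathbb Z_2}((\hbar_1))((\hbar_2))$ (complex-valued smooth functions on $\mathbb R^2$ that are invariant under $p\mapsto -p$) with the product given on functions by the following formula and extended $K$-bilinearly and coefficientwise to Laurent series: $$f\star g=\sum_{k\ge 0}\Big(\frac{\hbar_1}{2}\Big)^k\Big[\big((\partial_{x_2}+\hbar_2 D)\,\delta\big)^k (f\otimes g)\Big]_{(x_1,y_1)=(x_2,y_2)=(x,y)},$$ where,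 for $F\in C^\infty(\mathbb R^2\times\mathbb R^2)$, $$(DF)(x_1,y_1,x_2,y_2)=\frac{F(x_1,y_1,x_2,-y_2)-F(x_1,y_1,-x_2,-y_2)}{x_2},\qquad (\delta F)(x_1,y_1,x_2,y_2)=\frac{F(x_1,y_1,x_2,y_2)-F(x_1,y_2,x_2,y_2)}{y_1-y_2}$$ (extended smoothly across the zeros of the denominators). Let $HH_0$ be its zeroth Hochschild homology, formed with completed tensor powers: the quotient of $\mathcal D((\hbar_1))((\hbar_2))$ by the image of $b(f\otimes g)=f\star g-g\star f$ on $C^\infty(\mathbb R^2\times\mathbb R^2)^{\mathbb Z_2\times\mathbb Z_2}((\hbar_1))((\hbar_2))$. Put $z=x+iy$ and $\bar z=x-iy$, both as functions on $\mathbb R^2$ and as elements of $\mathcal R$. For $f\in C^\infty(\mathbb R^2)^{\mathbb Z_2}$, a *normal ordering* of $f(z,\bar z)$ is an element $\hat f$ of $\mathcal D((\hbar_1))((\hbar_2))$ whose Taylor expansion at the origin arises from that of $f$ by replacing each commutative monomial $z^p\bar z^q$ by the polynomial in $K[x,y]$ that represents $z^p\bar z^q\,\mathbf e\in\mathcal R\mathbf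 e$, the products being taken in $\mathcal R$. **Theorem.** 1. The product $\star$ extends the star product on even polynomials induced from $\mathbf e\mathcal R\mathbf e$. 2. $[1]\neq 0$ in $HH_0$. 3. There is a unique $K$-linear functional $\phi$ on $\mathcal D((\hbar_1))((\hbar_2))$ with $\phi(a\star b)=\phi(b\star a)$ for all $a,b$ and $\phi(1)=1$. 4. Every $f\in C^\infty(\mathbb R^2)^{\mathbb Z_2}$ has a normal ordering $\hat f$, and for every normal ordering $\hat f$ of $f$ $$\phi(\hat f)=\sum_{k=0}^{\infty}\frac{(i\hbar_1)^k}{(k!)^2}\ \prod_{l=1}^k\Big\{\frac l2+(-1)^{l+1}\frac{2\lfloor\frac{l+1}{2}\rfloor\hbar_2}{l+1}\Big\}\ \frac{\partial^{2k}f}{\partial z^k\partial\bar z^k}(0,0).$$ -/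

import Mathlib

open scoped ContDiff

noncomputable section

namespace DunklWeyl

/-! ### The base field `ℂ((ħ₁))((ħ₂))` -/

/-- `ℂ((ħ₁))((ħ₂))`: Laurent series in `ħ₂` over the field of Laurent series in `ħ₁`. -/
def K : Type := LaurentSeries (LaurentSeries ℂ)

instance : Field K := inferInstanceAs (Field (LaurentSeries (LaurentSeries ℂ)))

/-- The coefficient of `ħ₂ⁿ ħ₁ᵐ` in a scalar. -/
def K.coeff (c : K) (n m : ℤ) : ℂ :=
  HahnSeries.coeff (HahnSeries.coeff (show LaurentSeries (LaurentSeries ℂ) from c) n) m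

/-- The constants `ℂ ⊆ ℂ((ħ₁))((ħ₂))`. -/
def const (c : ℂ) : K :=
  (HahnSeries.C (HahnSeries.C c) : LaurentSeries (LaurentSeries ℂ))

/-- The formal parameter `ħ₁`. -/
def hbar₁ : K := (HahnSeries.C (HahnSeries.single 1 1) : LaurentSeries (LaurentSeries ℂ))

/-- The formal parameter `ħ₂`. -/
def hbar₂ : K := (HahnSeries.single 1 1 : LaurentSeries (LaurentSeries ℂ))

/-- Convergence of a formal sum in `ℂ((ħ₁))((ħ₂))`: every monomial `ħ₂ⁿ ħ₁ᵐ` occurs in only finitely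
many terms, and its coefficients add up to its coefficient in `s`. -/
def HasFormalSum {ι : Type} (t : ι → K) (s : K) : Prop :=
  ∀ n m : ℤ, {k | (t k).coeff n m ≠ 0}.Finite ∧ ∑ᶠ k, (t k).coeff n m = s.coeff n m

/-! ### The formal symplectic reflection algebra of `ℤ₂` -/

/-- Generators: the two coordinates and the generator `γ` of `ℤ₂`. -/
inductive Gen
  | x | y | γ

/-- The relations of `ℂ⟨x, y⟩ ⋊ ℤ₂`, that is `γ² = 1`, `γ x = -x γ`, `γ y = -y γ`, and the relation
`[y, x] = ħ₁ (1 + 2 ħ₂ γ) / 2`. -/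
inductive SRARel : FreeAlgebra K Gen → FreeAlgebra K Gen → Prop
  | γ_γ : SRARel (FreeAlgebra.ι K Gen.γ * FreeAlgebra.ι K Gen.γ) 1
  | γ_x : SRARel (FreeAlgebra.ι K Gen.γ * FreeAlgebra.ι K Gen.x +
      FreeAlgebra.ι K Gen.x * FreeAlgebra.ι K Gen.γ) 0
  | γ_y : SRARel (FreeAlgebra.ι K Gen.γ * FreeAlgebra.ι K Gen.y +
      FreeAlgebra.ι K Gen.y * FreeAlgebra.ι K Gen.γ) 0
  | y_x : SRARel (FreeAlgebra.ι K Gen.y * FreeAlgebra.ι K Gen.x)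
      (FreeAlgebra.ι K Gen.x * FreeAlgebra.ι K Gen.y +
        (hbar₁ / 2) • (1 + (2 * hbar₂) • FreeAlgebra.ι K Gen.γ))

/-- The symplectic reflection algebra `𝓡`. -/
abbrev SRA : Type := RingQuot SRARel

/-- The image of a generator in `𝓡`. -/
def gen (g : Gen) : SRA := RingQuot.mkAlgHom K SRARel (FreeAlgebra.ι K g)

/-- The idempotent `e = (1 + γ) / 2`. -/
def e : SRA := (1 / 2 : K) • (1 + gen .γ)

/-- `z = x + i y` in `𝓡`. -/
def zElt : SRA := gen .x + const Complex.I • gen .y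

/-- `z̄ = x - i y` in `𝓡`. -/
def zbarElt : SRA := gen .x + const (-Complex.I) • gen .y

/-- The linear map sending the commutative monomial `xᵃ yᵇ` to the monomial `xᵃ yᵇ` of `𝓡`. -/
def ordered : MvPolynomial (Fin 2) K →ₗ[K] SRA :=
  (MvPolynomial.basisMonomials (Fin 2) K).constr K
    (fun s => gen .x ^ s 0 * gen .y ^ s 1)

/-! ### Smoothness of integrals depending on a parameter -/

theorem contDiff_nat_integral {E : Type} [NormedAddCommGroup E] [NormedSpace ℝ E]
    [FiniteDimensional ℝ E] (a b : ℝ) (n : ℕ) :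
    ∀ {F : Type} [NormedAddCommGroup F] [NormedSpace ℝ F] [CompleteSpace F]
      (G : E × ℝ → F), ContDiff ℝ ∞ G → ContDiff ℝ n (fun p => ∫ t in a..b, G (p, t)) := by
  induction n with
  | zero =>
    intro F _ _ _ G hG
    have : Continuous (fun p : E => ∫ t in a..b, G (p, t)) :=
      intervalIntegral.continuous_parametric_intervalIntegral_of_continuous'
        (f := fun p t => G (p, t)) (by simpa [Function.uncurry_def] using hG.continuous) a b
    exact_mod_cast contDiff_zero.2 this
  | succ n ih =>
    intro F _ _ _ G hG
    have hG' : ContDiff ℝ ∞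
        (fun q : E × ℝ => (fderiv ℝ G q).comp (ContinuousLinearMap.inl ℝ E ℝ)) :=
      (hG.fderiv_right (m := ∞) (by simp)).clm_comp contDiff_const
    have key : ∀ p : E, HasFDerivAt (fun p => ∫ t in a..b, G (p, t))
        (∫ t in a..b, (fderiv ℝ G (p, t)).comp (ContinuousLinearMap.inl ℝ E ℝ)) p := by
      intro p
      have hc : Continuous (fun q : E × ℝ =>
          ‖(fderiv ℝ G q).comp (ContinuousLinearMap.inl ℝ E ℝ)‖) := hG'.continuous.norm
      obtain ⟨C, hC⟩ := ((isCompact_closedBall p 1).prod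
        (isCompact_uIcc (a := a) (b := b))).bddAbove_image hc.continuousOn
      refine (intervalIntegral.hasFDerivAt_integral_of_dominated_of_fderiv_le
        (F := fun p t => G (p, t))
        (F' := fun p t => (fderiv ℝ G (p, t)).comp (ContinuousLinearMap.inl ℝ E ℝ))
        (bound := fun _ => C) (Metric.ball_mem_nhds p one_pos) ?_ ?_ ?_ ?_ ?_ ?_)
      · refine Filter.Eventually.of_forall fun x => ?_
        exact (hG.continuous.comp (by fun_prop : Continuous fun t : ℝ => (x, t))).aestronglyMeasurable
      · exact (hG.continuous.comp (by fun_prop : Continuous fun t : ℝ => (p, t))).intervalIntegrable a b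
      · exact (hG'.continuous.comp (by fun_prop : Continuous fun t : ℝ => (p, t))).aestronglyMeasurable
      · refine Filter.Eventually.of_forall fun t ht x hx => ?_
        exact hC ⟨(x, t), ⟨Metric.ball_subset_closedBall hx, Set.uIoc_subset_uIcc ht⟩, rfl⟩
      · exact intervalIntegrable_const
      · refine Filter.Eventually.of_forall fun t _ x _ => ?_
        have h1 : HasFDerivAt G (fderiv ℝ G (x, t)) (x, t) :=
          (hG.differentiable (by simp) (x, t)).hasFDerivAt
        exact h1.comp x (hasFDerivAt_prodMk_left x t)
    have : ContDiff ℝ ((n : ℕ∞ω) + 1) (fun p => ∫ t in a..b, G (p, t)) :=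
      contDiff_succ_iff_hasFDerivAt.2 ⟨_, ih _ hG', key⟩
    exact_mod_cast this

theorem contDiff_integral {E F : Type} [NormedAddCommGroup E] [NormedSpace ℝ E]
    [FiniteDimensional ℝ E] [NormedAddCommGroup F] [NormedSpace ℝ F] [CompleteSpace F]
    (a b : ℝ) (G : E × ℝ → F) (hG : ContDiff ℝ ∞ G) :
    ContDiff ℝ ∞ (fun p => ∫ t in a..b, G (p, t)) :=
  contDiff_infty.2 fun n => contDiff_nat_integral a b n G hG

/-! ### Smooth functions -/

/-- The plane `ℝ²` with coordinates `(x, y)`. -/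
abbrev Plane : Type := ℝ × ℝ

/-- `C^∞(ℝ² × ℝ²)`; the coordinates of a point are `((x₁, y₁), (x₂, y₂))`. -/
def Smooth₂ : Submodule ℂ (Plane × Plane → ℂ) where
  carrier := {F | ContDiff ℝ ∞ F}
  add_mem' {F G} (hF : ContDiff ℝ ∞ F) (hG : ContDiff ℝ ∞ G) := hF.add hG
  zero_mem' := (contDiff_const : ContDiff ℝ ∞ fun _ : Plane × Plane => (0 : ℂ))
  smul_mem' c F (hF : ContDiff ℝ ∞ F) := (contDiff_const (c := c)).smul hF

/-- `C^∞(ℝ²)^{ℤ₂}`: smooth complex-valued functions that are invariant under `p ↦ -p`. -/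
def EvenFun : Subalgebra ℂ (Plane → ℂ) where
  carrier := {f | ContDiff ℝ ∞ f ∧ ∀ p, f (-p) = f p}
  add_mem' hf hg := ⟨hf.1.add hg.1, fun p => by simp [hf.2 p, hg.2 p]⟩
  mul_mem' hf hg := ⟨hf.1.mul hg.1, fun p => by simp [hf.2 p, hg.2 p]⟩
  algebraMap_mem' c := ⟨contDiff_const, fun _ => rfl⟩

/-- `C^∞(ℝ² × ℝ²)^{ℤ₂ × ℤ₂}`, the completed tensor square of `C^∞(ℝ²)^{ℤ₂}`. -/
def EvenFun₂ : Subalgebra ℂ (Plane × Plane → ℂ) where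
  carrier := {F | ContDiff ℝ ∞ F ∧ ∀ p q, F (-p, q) = F (p, q) ∧ F (p, -q) = F (p, q)}
  add_mem' hf hg := ⟨hf.1.add hg.1, fun p q => by simp [hf.2 p q, hg.2 p q]⟩
  mul_mem' hf hg := ⟨hf.1.mul hg.1, fun p q => by simp [hf.2 p q, hg.2 p q]⟩
  algebraMap_mem' c := ⟨contDiff_const, fun _ _ => ⟨rfl, rfl⟩⟩

instance : CommRing EvenFun := inferInstance
instance : CommRing EvenFun₂ := inferInstance
instance : AddCommGroup EvenFun := inferInstance
instance : AddCommGroup EvenFun₂ := inferInstance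
instance : CommRing (LaurentSeries EvenFun) := inferInstance
instance : CommRing (LaurentSeries EvenFun₂) := inferInstance
instance : AddCommGroup (LaurentSeries EvenFun) := HahnSeries.instAddCommGroup
instance : AddCommGroup (LaurentSeries EvenFun₂) := HahnSeries.instAddCommGroup

/-- `f ↦ f ⊗ 1`. -/
def inFst : EvenFun →+* EvenFun₂ where
  toFun f := ⟨fun r => f.1 r.1, f.2.1.comp contDiff_fst, fun p _ => ⟨f.2.2 p, rfl⟩⟩
  map_one' := rfl
  map_mul' _ _ := rfl
  map_zero' := rfl
  map_add' _ _ := rfl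

/-- `g ↦ 1 ⊗ g`. -/
def inSnd : EvenFun →+* EvenFun₂ where
  toFun g := ⟨fun r => g.1 r.2, g.2.1.comp contDiff_snd, fun _ q => ⟨rfl, g.2.2 q⟩⟩
  map_one' := rfl
  map_mul' _ _ := rfl
  map_zero' := rfl
  map_add' _ _ := rfl

/-- The flip `f ⊗ g ↦ g ⊗ f`. -/
def swapFactors : EvenFun₂ →+* EvenFun₂ where
  toFun F := ⟨fun r => F.1 (r.2, r.1), F.2.1.comp (contDiff_snd.prodMk contDiff_fst),
    fun p q => ⟨(F.2.2 q p).2, (F.2.2 q p).1⟩⟩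
  map_one' := rfl
  map_mul' _ _ := rfl
  map_zero' := rfl
  map_add' _ _ := rfl

/-! ### The Moyal-type formula

In `𝓡 e ≅ ℂ[x, y]((ħ₁))((ħ₂))` (with `xᵃ yᵇ` standing for `xᵃ yᵇ e`), the element `x` acts by
multiplication and `y` acts by
`g ↦ y g + (ħ₁ / 2) (∂ₓ g + ħ₂ D g)`, `(D g)(x, y) = (g(x, -y) - g(-x, -y)) / x`.
Hence the product of `f e` and `g e` is the restriction to the diagonal of
`∑ₖ (ħ₁ / 2)ᵏ ((∂ + ħ₂ D) ∘ δ)ᵏ (f ⊗ g)`, where `∂` and `D` act on the variables `(x₂, y₂)` and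
`(δ F)(x₁, y₁, x₂, y₂) = (F(x₁, y₁, x₂, y₂) - F(x₁, y₂, x₂, y₂)) / (y₁ - y₂)`.
This formula makes sense on smooth functions; the two difference quotients are written as integrals
of derivatives, which gives their smooth extension across the zeros of the denominators. -/

theorem contDiff_fderiv_apply {F : Plane × Plane → ℂ} (hF : ContDiff ℝ ∞ F)
    (v : Plane × Plane) : ContDiff ℝ ∞ (fun r => fderiv ℝ F r v) :=
  (hF.fderiv_right (m := ∞) (by simp)).clm_apply contDiff_const

theorem fderiv_apply_add {F G : Plane × Plane → ℂ} (hF : ContDiff ℝ ∞ F) (hG : ContDiff ℝ ∞ G)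
    (r v : Plane × Plane) :
    fderiv ℝ (F + G) r v = fderiv ℝ F r v + fderiv ℝ G r v := by
  rw [fderiv_add (hF.differentiable (by simp) r) (hG.differentiable (by simp) r)]
  rfl

theorem fderiv_apply_smul {F : Plane × Plane → ℂ} (hF : ContDiff ℝ ∞ F) (c : ℂ)
    (r v : Plane × Plane) :
    fderiv ℝ (c • F) r v = c * fderiv ℝ F r v := by
  rw [fderiv_const_smul (hF.differentiable (by simp) r)]
  rfl

/-- The operator `∂ = ∂/∂x₂`. -/
def opPartial : Smooth₂ →ₗ[ℂ] Smooth₂ where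
  toFun F := ⟨fun r => fderiv ℝ F.1 r ((0, 0), (1, 0)), contDiff_fderiv_apply F.2 _⟩
  map_add' F G := Subtype.ext <| funext fun r => fderiv_apply_add F.2 G.2 r _
  map_smul' c F := Subtype.ext <| funext fun r => fderiv_apply_smul F.2 c r _

/-- The integral of a directional derivative along a smooth family of paths. -/
def pathIntegral (a b : ℝ) (v : Plane × Plane) (P : (Plane × Plane) × ℝ → Plane × Plane)
    (hP : ContDiff ℝ ∞ P) : Smooth₂ →ₗ[ℂ] Smooth₂ where
  toFun F := ⟨fun r => ∫ t in a..b, fderiv ℝ F.1 (P (r, t)) v,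
    contDiff_integral a b (fun s => fderiv ℝ F.1 (P s) v) ((contDiff_fderiv_apply F.2 v).comp hP)⟩
  map_add' F G := Subtype.ext <| funext fun r => by
    have hc : ∀ H : Smooth₂, Continuous fun t => fderiv ℝ H.1 (P (r, t)) v := fun H =>
      ((contDiff_fderiv_apply H.2 v).comp hP).continuous.comp
        (by fun_prop : Continuous fun t : ℝ => (r, t))
    change (∫ t in a..b, fderiv ℝ (F.1 + G.1) (P (r, t)) v) =
      (∫ t in a..b, fderiv ℝ F.1 (P (r, t)) v) + ∫ t in a..b, fderiv ℝ G.1 (P (r, t)) v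
    simp_rw [fderiv_apply_add F.2 G.2]
    exact intervalIntegral.integral_add ((hc F).intervalIntegrable a b)
      ((hc G).intervalIntegrable a b)
  map_smul' c F := Subtype.ext <| funext fun r => by
    change (∫ t in a..b, fderiv ℝ (c • F.1) (P (r, t)) v) =
      c * ∫ t in a..b, fderiv ℝ F.1 (P (r, t)) v
    simp_rw [fderiv_apply_smul F.2 c]
    exact intervalIntegral.integral_const_mul c _

/-- The Dunkl difference operator
`(D F)(x₁, y₁, x₂, y₂) = (F(x₁, y₁, x₂, -y₂) - F(x₁, y₁, -x₂, -y₂)) / x₂`. -/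
def opDunkl : Smooth₂ →ₗ[ℂ] Smooth₂ :=
  pathIntegral (-1) 1 ((0, 0), (1, 0)) (fun s => (s.1.1, (s.2 * s.1.2.1, -s.1.2.2)))
    (by fun_prop)

/-- The divided difference
`(δ F)(x₁, y₁, x₂, y₂) = (F(x₁, y₁, x₂, y₂) - F(x₁, y₂, x₂, y₂)) / (y₁ - y₂)`. -/
def opDelta : Smooth₂ →ₗ[ℂ] Smooth₂ :=
  pathIntegral 0 1 ((0, 1), (0, 0))
    (fun s => ((s.1.1.1, s.1.2.2 + s.2 * (s.1.1.2 - s.1.2.2)), s.1.2)) (by fun_prop)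

/-- `opPow k l` is the coefficient of `ħ₂ˡ` in `((∂ + ħ₂ D) ∘ δ)ᵏ`. -/
def opPow : ℕ → ℕ → (Smooth₂ →ₗ[ℂ] Smooth₂)
  | 0, 0 => LinearMap.id
  | 0, _ + 1 => 0
  | k + 1, 0 => opPartial ∘ₗ opDelta ∘ₗ opPow k 0
  | k + 1, l + 1 => opPartial ∘ₗ opDelta ∘ₗ opPow k (l + 1) + opDunkl ∘ₗ opDelta ∘ₗ opPow k l

theorem fderiv_neg_arg {F : Plane × Plane → ℂ} (hF : ContDiff ℝ ∞ F) {c : ℂ}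
    (h : ∀ r, F (-r) = c * F r) (r v : Plane × Plane) :
    fderiv ℝ F (-r) v = -c * fderiv ℝ F r v := by
  have h1 : (fun r => F (-r)) = c • F := funext h
  have h2 := fderiv_apply_smul hF c r v
  rw [← h1] at h2
  have h4 : HasFDerivAt (fun r => F (-r)) ((fderiv ℝ F (-r)).comp
      (-ContinuousLinearMap.id ℝ (Plane × Plane))) r :=
    (hF.differentiable (by simp) (-r)).hasFDerivAt.comp r (hasFDerivAt_id r).neg
  rw [h4.fderiv] at h2
  have h3 : -(fderiv ℝ F (-r) v) = c * fderiv ℝ F r v := by simpa using h2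
  rw [neg_mul, ← h3, neg_neg]

theorem pathIntegral_neg {a b : ℝ} {v : Plane × Plane}
    {P : (Plane × Plane) × ℝ → Plane × Plane} {hP : ContDiff ℝ ∞ P}
    (hodd : ∀ r t, P (-r, t) = -P (r, t)) (F : Smooth₂) {c : ℂ} (h : ∀ r, F.1 (-r) = c * F.1 r)
    (r : Plane × Plane) :
    (pathIntegral a b v P hP F).1 (-r) = -c * (pathIntegral a b v P hP F).1 r := by
  change (∫ t in a..b, fderiv ℝ F.1 (P (-r, t)) v) = -c * ∫ t in a..b, fderiv ℝ F.1 (P (r, t)) v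
  simp_rw [hodd, fderiv_neg_arg F.2 h]
  exact intervalIntegral.integral_const_mul _ _

theorem opPow_neg (F : Smooth₂) (h : ∀ r, F.1 (-r) = F.1 r) :
    ∀ (k l : ℕ) (r : Plane × Plane), (opPow k l F).1 (-r) = (opPow k l F).1 r := by
  have hδ : ∀ G : Smooth₂, (∀ r, G.1 (-r) = G.1 r) → ∀ r, (opDelta G).1 (-r) = -1 * (opDelta G).1 r :=
    fun G hG r => pathIntegral_neg (c := 1)
      (fun r t => by ext <;> simp <;> ring) G (fun r => by rw [hG r, one_mul]) r
  have hP : ∀ G : Smooth₂, (∀ r, G.1 (-r) = G.1 r) →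
      ∀ r, (opPartial (opDelta G)).1 (-r) = (opPartial (opDelta G)).1 r := fun G hG r => by
    have := fderiv_neg_arg (opDelta G).2 (hδ G hG) r ((0, 0), (1, 0))
    rwa [neg_neg, one_mul] at this
  have hD : ∀ G : Smooth₂, (∀ r, G.1 (-r) = G.1 r) →
      ∀ r, (opDunkl (opDelta G)).1 (-r) = (opDunkl (opDelta G)).1 r := fun G hG r => by
    have := pathIntegral_neg (a := -1) (b := 1) (v := ((0, 0), (1, 0)))
      (P := fun s : (Plane × Plane) × ℝ => (s.1.1, (s.2 * s.1.2.1, -s.1.2.2))) (hP := by fun_prop)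
      (fun r t => by ext <;> simp) (opDelta G) (hδ G hG) r
    rwa [neg_neg, one_mul] at this
  intro k
  induction k with
  | zero =>
    intro l r
    cases l with
    | zero => exact h r
    | succ l => rfl
  | succ k ih =>
    intro l r
    cases l with
    | zero => exact hP _ (ih 0) r
    | succ l =>
      exact congrArg₂ (· + ·) (hP _ (ih (l + 1)) r) (hD _ (ih l) r)

/-- The coefficient of `ħ₁ᵏ ħ₂ˡ` in the product, as a map on the completed tensor square. -/
def mulCoeff (k l : ℕ) : EvenFun₂ →+ EvenFun where
  toFun F := ⟨fun p => (1 / 2 : ℂ) ^ k * (opPow k l ⟨F.1, F.2.1⟩).1 (p, p),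
    contDiff_const.mul (ContDiff.comp (g := (opPow k l ⟨F.1, F.2.1⟩).1) (opPow k l ⟨F.1, F.2.1⟩).2
      (contDiff_id.prodMk contDiff_id)),
    fun p => by
      have := opPow_neg ⟨F.1, F.2.1⟩
        (fun r => ((F.2.2 r.1 (-r.2)).1).trans (F.2.2 r.1 r.2).2) k l (p, p)
      exact congrArg _ this⟩
  map_zero' := by
    ext p
    have : (⟨(0 : EvenFun₂).1, (0 : EvenFun₂).2.1⟩ : Smooth₂) = 0 := rfl
    change (1 / 2 : ℂ) ^ k * (opPow k l ⟨(0 : EvenFun₂).1, (0 : EvenFun₂).2.1⟩).1 (p, p) = 0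
    rw [this, map_zero]
    exact mul_zero _
  map_add' F G := by
    ext p
    have : (⟨(F + G).1, (F + G).2.1⟩ : Smooth₂) = ⟨F.1, F.2.1⟩ + ⟨G.1, G.2.1⟩ := rfl
    change (1 / 2 : ℂ) ^ k * (opPow k l ⟨(F + G).1, (F + G).2.1⟩).1 (p, p) =
      (1 / 2 : ℂ) ^ k * (opPow k l ⟨F.1, F.2.1⟩).1 (p, p) +
        (1 / 2 : ℂ) ^ k * (opPow k l ⟨G.1, G.2.1⟩).1 (p, p)
    rw [this, map_add, ← mul_add]
    rfl

/-! ### Extension to Laurent series -/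

section Series

variable {M N : Type} [AddCommGroup M] [AddCommGroup N]

theorem finite_support_coeff (T : ℕ → M →+ N) (a : LaurentSeries M) (n : ℤ) :
    (Function.support fun k : ℕ => T k (HahnSeries.coeff a (n - k))).Finite := by
  refine (Set.finite_Iic (n - a.order).toNat).subset fun k hk => ?_
  by_contra hlt
  refine hk ?_
  have : HahnSeries.coeff a (n - k) = 0 := HahnSeries.coeff_eq_zero_of_lt_order (by
    simp only [Set.mem_Iic, not_le] at hlt
    omega)
  simp only [this, map_zero]

/-- The map `∑ₖ ħᵏ Tₖ` on Laurent series in `ħ`. -/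
def seriesMap (T : ℕ → M →+ N) : LaurentSeries M →+ LaurentSeries N where
  toFun a := HahnSeries.ofSuppBddBelow
    (fun n => ∑ᶠ k : ℕ, T k (HahnSeries.coeff a (n - k))) ⟨a.order, fun n hn => by
      by_contra hlt
      refine hn ?_
      have : ∀ k : ℕ, T k (HahnSeries.coeff a (n - k)) = 0 := fun k => by
        rw [HahnSeries.coeff_eq_zero_of_lt_order (by omega), map_zero]
      simp only [this, finsum_zero]⟩
  map_zero' := by
    ext n
    simp
  map_add' a b := by
    ext n
    simp only [HahnSeries.coeff_ofSuppBddBelow, HahnSeries.coeff_add, map_add]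
    exact finsum_add_distrib (finite_support_coeff T a n) (finite_support_coeff T b n)

/-- The ring homomorphism on Laurent series induced by a ring homomorphism of the coefficients. -/
def laurentMap {R S : Type} [CommRing R] [CommRing S] (f : R →+* S) :
    LaurentSeries R →+* LaurentSeries S where
  toFun a := HahnSeries.map a f
  map_one' := by
    ext n
    by_cases h : n = 0 <;> simp [HahnSeries.coeff_one, h]
  map_zero' := by
    ext n
    simp
  map_add' a b := by
    ext n
    simp
  map_mul' a b := HahnSeries.map_mul (f : R →ₙ+* S)

end Series

/-! ### The Dunkl-Weyl algebra -/

/-- The commutative ring `C^∞(ℝ²)^{ℤ₂}((ħ₁))((ħ₂))` with the undeformed product. -/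
abbrev Undeformed : Type := LaurentSeries (LaurentSeries EvenFun)

/-- The space `C^∞(ℝ²)^{ℤ₂}((ħ₁))((ħ₂))` underlying the Dunkl-Weyl algebra. -/
def Dunkl : Type := Undeformed

instance : AddCommGroup Dunkl := inferInstanceAs (AddCommGroup Undeformed)

/-- The inclusion of the scalars as constant functions. -/
def scalars : K →+* Undeformed := laurentMap (laurentMap (algebraMap ℂ EvenFun))

instance : Module K Dunkl := Module.compHom Undeformed scalars

/-- The unit of the Dunkl-Weyl algebra, the constant function `1`. -/
instance : One Dunkl := inferInstanceAs (One Undeformed)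

/-- The coefficient of `ħ₂ⁿ ħ₁ᵐ`, an invariant smooth function. -/
def Dunkl.coeff (a : Dunkl) (n m : ℤ) : EvenFun :=
  HahnSeries.coeff (HahnSeries.coeff (show Undeformed from a) n) m

/-- The completed tensor square of the Dunkl-Weyl algebra over `ℂ((ħ₁))((ħ₂))`, that is
`C^∞(ℝ² × ℝ²)^{ℤ₂ × ℤ₂}((ħ₁))((ħ₂))`: the space of Hochschild `1`-chains. -/
abbrev Chains₁ : Type := LaurentSeries (LaurentSeries EvenFun₂)

/-- The elementary tensor `a ⊗ b`. -/
def tensor (a b : Dunkl) : Chains₁ :=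
  laurentMap (laurentMap inFst) (show Undeformed from a) *
    laurentMap (laurentMap inSnd) (show Undeformed from b)

/-- The multiplication `a ⊗ b ↦ a ⋆ b` on the completed tensor square. -/
def mulMap : Chains₁ →+ Dunkl :=
  (seriesMap fun l => seriesMap fun k => mulCoeff k l : Chains₁ →+ Undeformed)

/-- The star product. -/
def starMul (a b : Dunkl) : Dunkl := mulMap (tensor a b)

infixl:70 " ⋆ " => starMul

/-- The Hochschild boundary `b(a ⊗ b) = a ⋆ b - b ⋆ a` on `1`-chains. -/
def boundary : Chains₁ →+ Dunkl :=
  mulMap - mulMap.comp (laurentMap (laurentMap swapFactors)).toAddMonoidHom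

/-- The zeroth Hochschild homology. -/
abbrev HH₀ : Type := Dunkl ⧸ boundary.range

/-- The class of an element in the zeroth Hochschild homology. -/
def HH₀.mk (a : Dunkl) : HH₀ := QuotientAddGroup.mk a

/-- Traces: linear functionals with `φ(a ⋆ b) = φ(b ⋆ a)`. -/
def IsTrace (φ : Dunkl →ₗ[K] K) : Prop := ∀ a b : Dunkl, φ (a ⋆ b) = φ (b ⋆ a)

/-! ### Polynomials and normal ordering -/

/-- The element `a` is the polynomial function `f ∈ K[x, y]`. -/
def IsPolynomial (a : Dunkl) (f : MvPolynomial (Fin 2) K) : Prop :=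
  ∀ (p : Plane) (n m : ℤ), (a.coeff n m).1 p =
    (MvPolynomial.eval ![const (p.1 : ℂ), const (p.2 : ℂ)] f).coeff n m

/-- `∂/∂x`. -/
def dx (f : Plane → ℂ) : Plane → ℂ := fun p => fderiv ℝ f p (1, 0)

/-- `∂/∂y`. -/
def dy (f : Plane → ℂ) : Plane → ℂ := fun p => fderiv ℝ f p (0, 1)

/-- `∂/∂z = (∂/∂x - i ∂/∂y) / 2`. -/
def dz (f : Plane → ℂ) : Plane → ℂ := fun p => (dx f p - Complex.I * dy f p) / 2

/-- `∂/∂z̄ = (∂/∂x + i ∂/∂y) / 2`. -/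
def dzbar (f : Plane → ℂ) : Plane → ℂ := fun p => (dx f p + Complex.I * dy f p) / 2

/-- The coefficient of `xⁱ yʲ` in the Taylor series at the origin. -/
def taylor (f : Plane → ℂ) (i j : ℕ) : ℂ := (dx^[i] (dy^[j] f)) 0 / (i.factorial * j.factorial)

/-- The coefficient of `zᵖ z̄^q` in the Taylor series at the origin. -/
def taylorZ (f : Plane → ℂ) (p q : ℕ) : ℂ :=
  (dz^[p] (dzbar^[q] f)) 0 / (p.factorial * q.factorial)

/-- The element `a` of the Dunkl-Weyl algebra is a normal ordering of the function `f(z, z̄)`: at the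
origin, `a` has the Taylor expansion obtained from that of `f` on replacing each commutative monomial
`zᵖ z̄^q` by the product `zᵖ z̄^q` in `𝓡`, the latter being written as a combination of the ordered
monomials `xⁱ yʲ`. -/
def IsNormalOrdering (f : EvenFun) (a : Dunkl) : Prop :=
  ∃ N : ℕ → ℕ → MvPolynomial (Fin 2) K,
    (∀ p q, ordered (N p q) * e = zElt ^ p * zbarElt ^ q * e) ∧
    ∀ i j : ℕ, ∀ n m : ℤ,
      let t := fun pq : ℕ × ℕ =>
        (const (taylorZ f.1 pq.1 pq.2) *
          (N pq.1 pq.2).coeff (Finsupp.single 0 i + Finsupp.single 1 j)).coeff n m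
      (Function.support t).Finite ∧ ∑ᶠ pq, t pq = taylor (a.coeff n m).1 i j

/-- The `k`-th term of the trace formula. -/
def traceTerm (f : EvenFun) (k : ℕ) : K :=
  (const Complex.I * hbar₁) ^ k / (k.factorial : K) ^ 2 *
    (∏ l ∈ Finset.Icc 1 k,
      ((l : K) / 2 + (-1) ^ (l + 1) * (2 * ((⌊((l : ℝ) + 1) / 2⌋ : ℤ) : K) * hbar₂ / (l + 1)))) *
    const ((dz^[k] (dzbar^[k] f.1)) 0)

end DunklWeyl

end

/-!
The proof rests on the polynomial representation of the symplectic reflection algebra `𝓡` on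
`𝓡 e ≅ K[x, y]` (`rep`): `x` acts by multiplication, and `y` by
`g ↦ y g + (ħ₁ / 2) (∂ₓ + ħ₂ D) g`. A polynomial `f` is recovered from `f e` by letting `f e` act on
`1` (`eq_rep_of_ordered_mul_e_eq`), and the bidifferential operators of the star product, applied to
`xᵃ yᵇ ⊗ xᶜ yᵈ`, satisfy the recursion in `b` that the action of `xᵃ yᵇ` on `xᶜ yᵈ` satisfies
(`diagCoeff_mon₂`). Hence the star product extends the product of `e 𝓡 e` (`IsPolynomial.star`).

*Existence of the trace.* On polynomials put `polyTrace (xⁱ yʲ) = 0` for `i ≠ j` and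
`polyTrace (xⁿ yⁿ) = (-ħ₁ / 2)ⁿ ∏ₗ (factor l)`. The factors are such that `x²` and `y²` commute with
everything under the resulting functional `sraTrace` on `𝓡`; since `xy` is, up to a scalar and an
element of `K[ℤ₂]`, the commutator of `y²` and `x²`, so do all even monomials
(`pow_mul_pow_mem_traceCommuting`). The value on a polynomial only involves the coefficients of
`xⁿ yⁿ`, which are Taylor coefficients at the origin, and in each degree in `ħ₁` and `ħ₂` only finitely
many of them. So the functional extends to all of `C^∞(ℝ²)^{ℤ₂}((ħ₁))((ħ₂))` (`dunklTrace`). The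
composite of this functional with the Hochschild boundary is a series of functionals on
`C^∞(ℝ² × ℝ²)` of finite order at the origin that vanish on even monomials, hence on all functions by
Taylor's theorem (`apply_eq_zero_of_even_mon₂`, `dunklTrace_boundary`). As `dunklTrace 1 = 1`, the
class of `1` in `HH₀` is nonzero.

*Uniqueness.* To lowest order, the commutators with `x²` and `y²` are `-ħ₁ x ∂/∂y` and
`ħ₁ y ∂/∂x`. By Hadamard's lemma, every even function is a constant plus a sum of images of even
functions under these two vector fields (`exists_eq_add_dx_add_dy`). Solving degree by degree, every
element of the algebra is a scalar multiple of `1` plus two commutators (`exists_eq_smul_one_add`),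
so that a trace is determined by its value on `1`.

*Normal orderings.* Give `x` and `y` degree `1`, `ħ₁` degree `2` and `ħ₂` degree `0`. Then
`zᵖ z̄^q` is homogeneous of degree `p + q`, so the replacement of commutative monomials involves
finite sums in each degree in `ħ₁`, `ħ₂`, `x` and `y`, and Borel's theorem
(`exists_evenFun_taylor_eq`) provides a normal ordering. For the value of the trace, commuting with
`z z̄` shows that the trace of `zᵖ z̄^q` is zero for `p ≠ q`, and commuting with `z̄²` gives a recursion
for the trace of `zⁿ z̄ⁿ`, because `z, z̄` satisfy the relations of `x, y` with `ħ₁` replaced by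
`-2 i ħ₁` (`sraTrace_z_pow_mul_zbar_pow_of_ne`, `sraTrace_z_pow_mul_zbar_pow`).
-/

noncomputable section

namespace DunklWeyl

/-! ### Series of operators on Laurent series -/

section SeriesOperators

variable {M N P : Type} [AddCommGroup M] [AddCommGroup N] [AddCommGroup P]

theorem coeff_seriesMap (T : ℕ → M →+ N) (a : LaurentSeries M) (n : ℤ) :
    HahnSeries.coeff (seriesMap T a) n = ∑ᶠ k : ℕ, T k (HahnSeries.coeff a (n - k)) := rfl

theorem coeff_seriesMap_eq_sum (T : ℕ → M →+ N) {a : LaurentSeries M} {s : ℤ}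
    (hs : ∀ j < s, HahnSeries.coeff a j = 0) {n : ℤ} {r : ℕ} (hr : n - s < r) :
    HahnSeries.coeff (seriesMap T a) n =
      ∑ k ∈ Finset.range r, T k (HahnSeries.coeff a (n - k)) := by
  rw [coeff_seriesMap]
  refine finsum_eq_sum_of_support_subset _ fun k hk => ?_
  by_contra hlt
  simp only [Finset.coe_range, Set.mem_Iio, not_lt] at hlt
  exact hk (by simp only [hs (n - k) (by omega), map_zero])

theorem exists_coeff_eq_zero_of_lt (a : LaurentSeries M) :
    ∃ s : ℤ, ∀ j < s, HahnSeries.coeff a j = 0 :=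
  ⟨a.order, fun _ hj => HahnSeries.coeff_eq_zero_of_lt_order hj⟩

theorem coeff_seriesMap_eq_zero (T : ℕ → M →+ N) {a : LaurentSeries M} {s : ℤ}
    (hs : ∀ j < s, HahnSeries.coeff a j = 0) {n : ℤ} (hn : n < s) :
    HahnSeries.coeff (seriesMap T a) n = 0 := by
  rw [coeff_seriesMap_eq_sum T hs (r := 0) (by push_cast; omega)]
  simp

theorem seriesMap_add (S T : ℕ → M →+ N) : seriesMap (S + T) = seriesMap S + seriesMap T := by
  ext a n
  exact finsum_add_distrib (finite_support_coeff S a n) (finite_support_coeff T a n)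

theorem seriesMap_neg (T : ℕ → M →+ N) : seriesMap (-T) = -seriesMap T := by
  ext a n
  exact finsum_neg_distrib fun k : ℕ => T k (HahnSeries.coeff a (n - k))

theorem seriesMap_sub (S T : ℕ → M →+ N) : seriesMap (S - T) = seriesMap S - seriesMap T := by
  rw [sub_eq_add_neg, seriesMap_add, seriesMap_neg, sub_eq_add_neg]

theorem seriesMap_sum {ι : Type} (s : Finset ι) (T : ι → ℕ → M →+ N) :
    seriesMap (fun k => ∑ i ∈ s, T i k) = ∑ i ∈ s, seriesMap (T i) := by
  classical
  induction s using Finset.induction_on with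
  | empty =>
    ext a n
    simp [coeff_seriesMap]
  | insert i s hi ih =>
    rw [Finset.sum_insert hi, ← ih, ← seriesMap_add]
    congr 1
    ext k : 1
    rw [Finset.sum_insert hi]
    rfl

/-- The coefficientwise extension of an additive map to Laurent series. -/
def coeffMap (f : M →+ N) : LaurentSeries M →+ LaurentSeries N where
  toFun a := HahnSeries.map a f
  map_zero' := by
    ext n
    simp
  map_add' a b := by
    ext n
    simp



/-- The product of two operator-valued power series is the Cauchy product. -/
theorem seriesMap_comp_seriesMap (S : ℕ → N →+ P) (T : ℕ → M →+ N) :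
    (seriesMap S).comp (seriesMap T) =
      seriesMap fun k => ∑ ij ∈ Finset.HasAntidiagonal.antidiagonal k, (S ij.1).comp (T ij.2) := by
  ext a n
  obtain ⟨s, hs⟩ := exists_coeff_eq_zero_of_lt a
  set r : ℕ := (n - s).toNat + 1
  rw [AddMonoidHom.comp_apply,
    coeff_seriesMap_eq_sum S (fun j hj => coeff_seriesMap_eq_zero T hs hj) (r := r) (by omega),
    coeff_seriesMap_eq_sum _ hs (r := r) (by omega)]
  have h1 : ∀ i ∈ Finset.range r, S i (HahnSeries.coeff (seriesMap T a) (n - i)) =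
      ∑ j ∈ Finset.range (r - i), S i (T j (HahnSeries.coeff a (n - (i + j : ℕ)))) := by
    intro i hi
    rw [Finset.mem_range] at hi
    rw [coeff_seriesMap_eq_sum T hs (r := r - i) (by omega), map_sum]
    refine Finset.sum_congr rfl fun j _ => ?_
    rw [show n - (i : ℤ) - (j : ℤ) = n - (i + j : ℕ) by push_cast; ring]
  rw [Finset.sum_congr rfl h1]
  have h2 : ∀ k ∈ Finset.range r, (∑ ij ∈ Finset.HasAntidiagonal.antidiagonal k, (S ij.1).comp (T ij.2))
      (HahnSeries.coeff a (n - k)) = ∑ i ∈ Finset.range (k + 1),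
        S i (T (k - i) (HahnSeries.coeff a (n - (i + (k - i) : ℕ)))) := by
    intro k _
    rw [AddMonoidHom.finsetSum_apply, Finset.Nat.sum_antidiagonal_eq_sum_range_succ_mk]
    refine Finset.sum_congr rfl fun i hi => ?_
    rw [Nat.add_sub_of_le (by simpa [Nat.lt_succ_iff] using hi)]
    rfl
  rw [Finset.sum_congr rfl h2,
    Finset.sum_range_diag_flip r fun i j => S i (T j (HahnSeries.coeff a (n - (i + j : ℕ))))]

/-- Multiplication by a Laurent series is an operator-valued power series, up to a shift. -/
theorem coeff_mul_eq_coeff_seriesMap {A : Type} [CommRing A] {c : LaurentSeries A} {s : ℤ}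
    (hs : ∀ j < s, HahnSeries.coeff c j = 0) (a : LaurentSeries A) (n : ℤ) :
    HahnSeries.coeff (c * a) n =
      HahnSeries.coeff (seriesMap (fun k => AddMonoidHom.mulLeft (HahnSeries.coeff c (s + k))) a)
        (n - s) := by
  obtain ⟨s', hs'⟩ := exists_coeff_eq_zero_of_lt a
  rw [coeff_seriesMap_eq_sum _ hs' (r := (n - s - s').toNat + 1) (by omega), HahnSeries.coeff_mul]
  refine Finset.sum_bij_ne_zero (fun ij _ _ => (ij.1 - s).toNat) ?_ ?_ ?_ ?_
  · intro ij h1 h2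
    rw [Finset.mem_antidiagonal] at h1
    have : ¬ ij.1 < s := fun h => h1.1 (hs _ h)
    have : ¬ ij.2 < s' := fun h => h1.2.1 (hs' _ h)
    rw [Finset.mem_range]
    omega
  · intro ij h1 h2 kl h3 h4 h
    rw [Finset.mem_antidiagonal] at h1 h3
    have : ¬ ij.1 < s := fun h => h1.1 (hs _ h)
    have : ¬ kl.1 < s := fun h => h3.1 (hs _ h)
    exact Prod.ext (by omega) (by omega)
  · intro k _ hk
    have h1 : HahnSeries.coeff c (s + k) ≠ 0 := fun h => hk (by simp [h])
    have h2 : HahnSeries.coeff a (n - s - k) ≠ 0 := fun h => hk (by simp [h])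
    refine ⟨(s + k, n - s - k), ?_, ?_, ?_⟩
    · rw [Finset.mem_antidiagonal]
      exact ⟨h1, h2, by ring⟩
    · simpa using hk
    · simp
  · intro ij h1 h2
    rw [Finset.mem_antidiagonal] at h1
    have : ¬ ij.1 < s := fun h => h1.1 (hs _ h)
    have e1 : s + ((ij.1 - s).toNat : ℤ) = ij.1 := by omega
    have e2 : n - s - ((ij.1 - s).toNat : ℤ) = ij.2 := by omega
    simp only [AddMonoidHom.coe_mulLeft]
    rw [e1, e2]

/-- Series of linear operators are linear over the Laurent series in the same variable; the linear
structures are given by ring homomorphisms into the coefficient rings. -/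
theorem seriesMap_laurentMap_mul {R A B : Type} [CommRing R] [CommRing A] [CommRing B]
    (i : R →+* A) (j : R →+* B) (T : ℕ → A →+ B) (hT : ∀ k r a, T k (i r * a) = j r * T k a)
    (c : LaurentSeries R) (a : LaurentSeries A) :
    seriesMap T (laurentMap i c * a) = laurentMap j c * seriesMap T a := by
  obtain ⟨s, hs⟩ := exists_coeff_eq_zero_of_lt c
  have hi : ∀ u < s, HahnSeries.coeff (laurentMap i c) u = 0 := fun u hu =>
    (congrArg i (hs u hu)).trans (map_zero i)
  have hj : ∀ u < s, HahnSeries.coeff (laurentMap j c) u = 0 := fun u hu =>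
    (congrArg j (hs u hu)).trans (map_zero j)
  ext n
  rw [coeff_mul_eq_coeff_seriesMap hj, coeff_seriesMap]
  have h1 : ∀ k : ℕ, T k (HahnSeries.coeff (laurentMap i c * a) (n - k)) =
      T k (HahnSeries.coeff (seriesMap (fun k => AddMonoidHom.mulLeft
        (HahnSeries.coeff (laurentMap i c) (s + k))) a) (n - s - k)) := fun k => by
    rw [coeff_mul_eq_coeff_seriesMap hi, sub_right_comm]
  simp_rw [h1]
  rw [← coeff_seriesMap, ← AddMonoidHom.comp_apply, ← AddMonoidHom.comp_apply,
    seriesMap_comp_seriesMap, seriesMap_comp_seriesMap]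
  congr 3
  ext k a
  rw [← Finset.Nat.sum_antidiagonal_swap]
  simp only [AddMonoidHom.finsetSum_apply, AddMonoidHom.comp_apply, AddMonoidHom.coe_mulLeft,
    Prod.fst_swap, Prod.snd_swap]
  exact Finset.sum_congr rfl fun ij _ => hT _ _ _

/-- The Laurent series with the given coefficients, which vanish below some degree. -/
def laurentOf (f : ℤ → M) (s : ℤ) (hf : ∀ n < s, f n = 0) : LaurentSeries M :=
  HahnSeries.ofSuppBddBelow f ⟨s, fun n hn => not_lt.1 fun h => hn (hf n h)⟩

theorem coeff_laurentOf (f : ℤ → M) (s : ℤ) (hf : ∀ n < s, f n = 0) (n : ℤ) :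
    HahnSeries.coeff (laurentOf f s hf) n = f n := rfl

/-- An operator-valued power series with surjective leading coefficient is surjective. -/
theorem seriesMap_surjective {T : ℕ → M →+ N} (hT : Function.Surjective (T 0)) :
    Function.Surjective (seriesMap T) := by
  intro b
  obtain ⟨s, hs⟩ := exists_coeff_eq_zero_of_lt b
  choose g hg using hT
  -- the coefficients of a preimage, solved for one after the other
  obtain ⟨u, hu⟩ : ∃ u : ℕ → M, ∀ n, T 0 (u n) = HahnSeries.coeff b (s + n) -
      ∑ k ∈ Finset.range n, T (k + 1) (u (n - (k + 1))) := by
    let v : ℕ → M := fun n => Nat.strongRec (motive := fun _ => M) (fun n ih =>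
      g (HahnSeries.coeff b (s + n) - ∑ k ∈ (Finset.range n).attach,
        T (k.1 + 1) (ih (n - (k.1 + 1)) (by have := Finset.mem_range.1 k.2; omega)))) n
    refine ⟨v, fun n => ?_⟩
    have hv : v n = g (HahnSeries.coeff b (s + n) - ∑ k ∈ (Finset.range n).attach,
        T (k.1 + 1) (v (n - (k.1 + 1)))) := by
      simp only [v]
      rw [Nat.strongRec]
    rw [hv, hg, Finset.sum_attach (Finset.range n) fun k => T (k + 1) (v (n - (k + 1)))]
  have hlt : ∀ n < s, (if s ≤ n then u (n - s).toNat else 0) = 0 := fun n hn => if_neg (by omega)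
  refine ⟨laurentOf (fun n => if s ≤ n then u (n - s).toNat else 0) s hlt, ?_⟩
  ext n
  rw [coeff_seriesMap_eq_sum T (s := s) (r := (n - s).toNat + 1) hlt (by omega)]
  simp only [coeff_laurentOf]
  rcases lt_or_ge n s with h | h
  · rw [hs n h]
    refine Finset.sum_eq_zero fun k _ => ?_
    rw [if_neg (by omega), map_zero]
  · obtain ⟨m, rfl⟩ : ∃ m : ℕ, n = s + m := ⟨(n - s).toNat, by omega⟩
    rw [show (s + (m : ℤ) - s).toNat = m by omega, Finset.sum_range_succ']
    simp only [Nat.cast_zero, sub_zero]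
    rw [if_pos h, show (s + (m : ℤ) - s).toNat = m by omega, hu, add_comm, sub_add_eq_add_sub,
      sub_eq_iff_eq_add]
    congr 1
    refine Finset.sum_congr rfl fun k hk => ?_
    have := Finset.mem_range.1 hk
    rw [if_pos (by omega), show (s + (m : ℤ) - (k + 1 : ℕ) - s).toNat = m - (k + 1) by omega]

theorem coeff_seriesMap_shift {T : ℕ → M →+ N} (hT : T 0 = 0) (a : LaurentSeries M) (n : ℤ) :
    HahnSeries.coeff (seriesMap T a) n =
      HahnSeries.coeff (seriesMap (fun k => T (k + 1)) a) (n - 1) := by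
  obtain ⟨s, hs⟩ := exists_coeff_eq_zero_of_lt a
  set r : ℕ := (n - s).toNat + 1
  rw [coeff_seriesMap_eq_sum T hs (r := r + 1) (by omega),
    coeff_seriesMap_eq_sum _ hs (r := r) (by omega), Finset.sum_range_succ', hT]
  simp only [AddMonoidHom.zero_apply, add_zero]
  refine Finset.sum_congr rfl fun k _ => ?_
  rw [show n - ((k + 1 : ℕ) : ℤ) = n - 1 - k by push_cast; ring]

/-- If the constant term is zero, it suffices that the linear term is surjective. -/
theorem seriesMap_surjective_of_one {T : ℕ → M →+ N} (h0 : T 0 = 0)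
    (h1 : Function.Surjective (T 1)) : Function.Surjective (seriesMap T) := by
  intro b
  obtain ⟨s, hs⟩ := exists_coeff_eq_zero_of_lt b
  obtain ⟨a, ha⟩ := seriesMap_surjective (T := fun k => T (k + 1)) h1
    (laurentOf (fun n => HahnSeries.coeff b (n + 1)) (s - 1) fun n hn => hs _ (by omega))
  refine ⟨a, ?_⟩
  ext n
  rw [coeff_seriesMap_shift h0, ha, coeff_laurentOf, sub_add_cancel]

theorem coeff_seriesMap_C (T : ℕ → M →+ N) (m : M) (n : ℤ) :
    HahnSeries.coeff (seriesMap T (HahnSeries.single 0 m)) n =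
      if 0 ≤ n then T n.toNat m else 0 := by
  have h0 : ∀ j < (0 : ℤ), HahnSeries.coeff (HahnSeries.single 0 m) j = 0 := fun j hj =>
    HahnSeries.coeff_single_of_ne hj.ne
  split_ifs with h
  · rw [coeff_seriesMap_eq_sum T h0 (r := n.toNat + 1) (by omega), Finset.sum_range_succ,
      Finset.sum_eq_zero, zero_add, show n - (n.toNat : ℤ) = 0 by omega,
      HahnSeries.coeff_single_same]
    intro k hk
    rw [HahnSeries.coeff_single_of_ne (by have := Finset.mem_range.1 hk; omega), map_zero]
  · exact coeff_seriesMap_eq_zero T h0 (by omega)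

/-- The operator `∑ₗₖ ħ₂ˡ ħ₁ᵏ Tₗₖ` on iterated Laurent series. -/
def seriesMap₂ (T : ℕ → ℕ → M →+ N) :
    LaurentSeries (LaurentSeries M) →+ LaurentSeries (LaurentSeries N) :=
  seriesMap fun l => seriesMap (T l)

theorem seriesMap₂_add (S T : ℕ → ℕ → M →+ N) :
    seriesMap₂ (S + T) = seriesMap₂ S + seriesMap₂ T := by
  rw [seriesMap₂, seriesMap₂, seriesMap₂, ← seriesMap_add]
  exact congrArg _ (funext fun l => seriesMap_add (S l) (T l))

theorem seriesMap₂_sub (S T : ℕ → ℕ → M →+ N) :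
    seriesMap₂ (S - T) = seriesMap₂ S - seriesMap₂ T := by
  rw [seriesMap₂, seriesMap₂, seriesMap₂, ← seriesMap_sub]
  exact congrArg _ (funext fun l => seriesMap_sub (S l) (T l))

theorem seriesMap₂_comp_seriesMap₂ (S : ℕ → ℕ → N →+ P) (T : ℕ → ℕ → M →+ N) :
    (seriesMap₂ S).comp (seriesMap₂ T) = seriesMap₂ fun l k =>
      ∑ u ∈ Finset.HasAntidiagonal.antidiagonal l, ∑ v ∈ Finset.HasAntidiagonal.antidiagonal k,
        (S u.1 v.1).comp (T u.2 v.2) := by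
  rw [seriesMap₂, seriesMap₂, seriesMap_comp_seriesMap, seriesMap₂]
  congr 1
  ext l : 1
  simp_rw [seriesMap_comp_seriesMap]
  rw [seriesMap_sum]

theorem seriesMap₂_comp_coeffMap (T : ℕ → ℕ → N →+ P) (f : M →+ N) :
    (seriesMap₂ T).comp (coeffMap (coeffMap f)) = seriesMap₂ fun l k => (T l k).comp f := rfl

theorem seriesMap₂_laurentMap_mul {R A B : Type} [CommRing R] [CommRing A] [CommRing B]
    (i : R →+* A) (j : R →+* B) (T : ℕ → ℕ → A →+ B)
    (hT : ∀ l k r a, T l k (i r * a) = j r * T l k a)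
    (c : LaurentSeries (LaurentSeries R)) (a : LaurentSeries (LaurentSeries A)) :
    seriesMap₂ T (laurentMap (laurentMap i) c * a) =
      laurentMap (laurentMap j) c * seriesMap₂ T a :=
  seriesMap_laurentMap_mul _ _ _ (fun l => seriesMap_laurentMap_mul i j (T l) (hT l)) c a

theorem coeff_seriesMap₂_C (T : ℕ → ℕ → M →+ N) (x : M) (n m : ℤ) :
    HahnSeries.coeff (HahnSeries.coeff (seriesMap₂ T
      (HahnSeries.single 0 (HahnSeries.single 0 x))) n) m =
      if 0 ≤ n ∧ 0 ≤ m then T n.toNat m.toNat x else 0 := by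
  rw [seriesMap₂, coeff_seriesMap_C, ite_and]
  split_ifs with h h'
  · rw [coeff_seriesMap_C, if_pos h']
  · rw [coeff_seriesMap_C, if_neg h']
  · rfl

theorem coeff_seriesMap₂ (T : ℕ → ℕ → M →+ N) (a : LaurentSeries (LaurentSeries M)) (n m : ℤ) :
    HahnSeries.coeff (HahnSeries.coeff (seriesMap₂ T a) n) m =
      ∑ᶠ l : ℕ, ∑ᶠ k : ℕ, T l k (HahnSeries.coeff (HahnSeries.coeff a (n - l)) (m - k)) := by
  let c : LaurentSeries N →+ N :=
    { toFun := fun x => HahnSeries.coeff x m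
      map_zero' := rfl
      map_add' := fun _ _ => rfl }
  rw [seriesMap₂, coeff_seriesMap]
  exact AddMonoidHom.map_finsum c (finite_support_coeff (fun l => seriesMap (T l)) a n)

theorem seriesMap₂_surjective_of_one {T : ℕ → ℕ → M →+ N} (h0 : T 0 0 = 0)
    (h1 : Function.Surjective (T 0 1)) : Function.Surjective (seriesMap₂ T) :=
  seriesMap_surjective (seriesMap_surjective_of_one h0 h1)

end SeriesOperators

/-! ### Coefficients of scalars -/

namespace K

theorem ext {c d : K} (h : ∀ n m, c.coeff n m = d.coeff n m) : c = d :=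
  HahnSeries.ext (funext fun n => HahnSeries.ext (funext fun m => h n m))

@[simp] theorem coeff_zero (n m : ℤ) : (0 : K).coeff n m = 0 := rfl

@[simp] theorem coeff_add (c d : K) (n m : ℤ) :
    (c + d).coeff n m = c.coeff n m + d.coeff n m := rfl

@[simp] theorem coeff_neg (c : K) (n m : ℤ) : (-c).coeff n m = -c.coeff n m := rfl


/-- The coefficient of a monomial, as an additive map. -/
def coeffHom (n m : ℤ) : K →+ ℂ where
  toFun c := c.coeff n m
  map_zero' := rfl
  map_add' _ _ := rfl

theorem coeff_sum {ι : Type*} (s : Finset ι) (c : ι → K) (n m : ℤ) :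
    (∑ i ∈ s, c i).coeff n m = ∑ i ∈ s, (c i).coeff n m :=
  map_sum (coeffHom n m) c s

@[simp] theorem coeff_const_mul (z : ℂ) (c : K) (n m : ℤ) :
    (const z * c).coeff n m = z * c.coeff n m := by
  have h : ∀ d : LaurentSeries (LaurentSeries ℂ), HahnSeries.coeff (HahnSeries.coeff
      (HahnSeries.C (HahnSeries.C z) * d) n) m = z * HahnSeries.coeff (HahnSeries.coeff d n) m :=
    fun d => by
      rw [HahnSeries.C_mul_eq_smul, HahnSeries.coeff_smul, smul_eq_mul, HahnSeries.C_mul_eq_smul,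
        HahnSeries.coeff_smul, smul_eq_mul]
  exact h c

@[simp] theorem coeff_hbar₁_mul (c : K) (n m : ℤ) :
    (hbar₁ * c).coeff n m = c.coeff n (m - 1) := by
  have h : ∀ d : LaurentSeries (LaurentSeries ℂ), HahnSeries.coeff (HahnSeries.coeff
      (HahnSeries.C (HahnSeries.single (1 : ℤ) (1 : ℂ)) * d) n) m =
        HahnSeries.coeff (HahnSeries.coeff d n) (m - 1) := fun d => by
    rw [HahnSeries.C_mul_eq_smul, HahnSeries.coeff_smul, smul_eq_mul, HahnSeries.coeff_single_mul,
      one_mul]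
  exact h c

@[simp] theorem coeff_hbar₂_mul (c : K) (n m : ℤ) :
    (hbar₂ * c).coeff n m = c.coeff (n - 1) m := by
  have h : ∀ d : LaurentSeries (LaurentSeries ℂ), HahnSeries.coeff (HahnSeries.coeff
      (HahnSeries.single (1 : ℤ) (1 : LaurentSeries ℂ) * d) n) m =
        HahnSeries.coeff (HahnSeries.coeff d (n - 1)) m := fun d => by
    rw [HahnSeries.coeff_single_mul, one_mul]
  exact h c

theorem coeff_hbar₁_pow_mul (k : ℕ) (c : K) (n m : ℤ) :
    (hbar₁ ^ k * c).coeff n m = c.coeff n (m - k) := by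
  induction k generalizing m with
  | zero => simp
  | succ k ih =>
    rw [pow_succ', mul_assoc, coeff_hbar₁_mul, ih]
    congr 1
    push_cast
    ring

theorem coeff_hbar₂_pow_mul (k : ℕ) (c : K) (n m : ℤ) :
    (hbar₂ ^ k * c).coeff n m = c.coeff (n - k) m := by
  induction k generalizing n with
  | zero => simp
  | succ k ih =>
    rw [pow_succ', mul_assoc, coeff_hbar₂_mul, ih]
    congr 1
    push_cast
    ring

end K

/-- The inclusion of the constants as a ring homomorphism. -/
def constHom : ℂ →+* K :=
  (HahnSeries.C : LaurentSeries ℂ →+* LaurentSeries (LaurentSeries ℂ)).comp HahnSeries.C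

theorem constHom_apply (z : ℂ) : constHom z = const z := rfl

theorem const_mul (z w : ℂ) : const (z * w) = const z * const w := map_mul constHom z w
theorem const_neg (z : ℂ) : const (-z) = -const z := map_neg constHom z
@[simp] theorem const_one : const 1 = 1 := map_one constHom
@[simp] theorem const_zero : const 0 = 0 := map_zero constHom
theorem const_injective : Function.Injective const := constHom.injective
theorem const_pow (z : ℂ) (n : ℕ) : const (z ^ n) = const z ^ n := map_pow constHom z n
theorem const_natCast (n : ℕ) : const (n : ℂ) = n := map_natCast constHom n
theorem const_I_mul_I : const Complex.I * const Complex.I = -1 := by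
  rw [← const_mul, Complex.I_mul_I, const_neg, const_one]

instance : CharZero K := charZero_of_injective_ringHom constHom.injective

theorem K.coeff_const (z : ℂ) (n m : ℤ) :
    (const z).coeff n m = if n = 0 ∧ m = 0 then z else 0 := by
  change HahnSeries.coeff (HahnSeries.coeff (HahnSeries.single 0 (HahnSeries.single 0 z)) n) m = _
  by_cases hn : n = 0 <;> by_cases hm : m = 0 <;> simp [hn, hm, HahnSeries.coeff_single_of_ne]

theorem hbar₁_ne_zero : hbar₁ ≠ 0 := by
  intro h
  have := K.coeff_hbar₁_mul 1 0 1
  rw [h, zero_mul, ← const_one, K.coeff_const] at this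
  simp at this

open MvPolynomial (monomial basisMonomials)

/-! ### The polynomial representation -/

/-- The monomial `xᵃ yᵇ`. -/
def mon (a b : ℕ) : MvPolynomial (Fin 2) K :=
  monomial (Finsupp.single 0 a + Finsupp.single 1 b) 1

/-- The linear map with prescribed values on the monomials `xᵃ yᵇ`. -/
def ofMon {V : Type} [AddCommGroup V] [Module K V] (f : ℕ → ℕ → V) :
    MvPolynomial (Fin 2) K →ₗ[K] V :=
  (basisMonomials (Fin 2) K).constr K fun s => f (s 0) (s 1)

theorem mon_eq (s : Fin 2 →₀ ℕ) : monomial s (1 : K) = mon (s 0) (s 1) := by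
  have h : s = Finsupp.single 0 (s 0) + Finsupp.single 1 (s 1) := by
    ext i
    fin_cases i <;> simp
  rw [mon, ← h]

@[simp] theorem ofMon_mon {V : Type} [AddCommGroup V] [Module K V] (f : ℕ → ℕ → V) (a b : ℕ) :
    ofMon f (mon a b) = f a b := by
  have := (basisMonomials (Fin 2) K).constr_basis K (fun s => f (s 0) (s 1))
    (Finsupp.single 0 a + Finsupp.single 1 b)
  rw [MvPolynomial.coe_basisMonomials] at this
  exact this.trans (by simp)

theorem linearMap_ext_mon {V : Type} [AddCommGroup V] [Module K V]
    {f g : MvPolynomial (Fin 2) K →ₗ[K] V} (h : ∀ a b, f (mon a b) = g (mon a b)) : f = g := by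
  refine (basisMonomials (Fin 2) K).ext fun s => ?_
  rw [MvPolynomial.coe_basisMonomials]
  simpa only [mon_eq] using h (s 0) (s 1)

theorem coeff_mon (a b : ℕ) (i j : ℕ) :
    (mon a b).coeff (Finsupp.single 0 i + Finsupp.single 1 j) =
      if a = i ∧ b = j then 1 else 0 := by
  rw [mon, MvPolynomial.coeff_monomial]
  refine if_congr ⟨fun h => ?_, fun h => by rw [h.1, h.2]⟩ rfl rfl
  have h0 := DFunLike.congr_fun h 0
  have h1 := DFunLike.congr_fun h 1
  simpa using And.intro h0 h1

theorem sum_coeff_mon (f : MvPolynomial (Fin 2) K) :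
    f = ∑ s ∈ f.support, f.coeff s • mon (s 0) (s 1) := by
  conv_lhs => rw [f.as_sum]
  refine Finset.sum_congr rfl fun s _ => ?_
  rw [← mon_eq, MvPolynomial.smul_monomial, smul_eq_mul, mul_one]

@[simp] theorem ordered_mon (a b : ℕ) : ordered (mon a b) = gen .x ^ a * gen .y ^ b :=
  ofMon_mon (fun a b => gen .x ^ a * gen .y ^ b) a b

/-- `1 - (-1)ⁿ`, which is `0` for even `n` and `2` for odd `n`. -/
def parityFactor (n : ℕ) : K := 1 - (-1) ^ n

@[simp] theorem parityFactor_zero : parityFactor 0 = 0 := by simp [parityFactor]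

theorem parityFactor_succ (n : ℕ) : parityFactor (n + 1) = 2 - parityFactor n := by
  simp only [parityFactor, pow_succ]; ring

theorem parityFactor_succ_mul (n : ℕ) : parityFactor (n + 1) * parityFactor n = 0 := by
  rcases neg_one_pow_eq_or K n with h | h <;> simp [parityFactor, pow_succ, h]

/-- Multiplication by `x`. -/
def mulX : Module.End K (MvPolynomial (Fin 2) K) := ofMon fun a b => mon (a + 1) b

/-- Multiplication by `y`. -/
def mulY : Module.End K (MvPolynomial (Fin 2) K) := ofMon fun a b => mon a (b + 1)

/-- The Dunkl operator `∂ₓ + ħ₂ D` on polynomials. -/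
def dunklOp : Module.End K (MvPolynomial (Fin 2) K) :=
  ofMon fun a b => (a + hbar₂ * ((-1) ^ b * parityFactor a)) • mon (a - 1) b

/-- The action of `γ`, that is `(x, y) ↦ (-x, -y)`. -/
def actγ : Module.End K (MvPolynomial (Fin 2) K) :=
  ofMon fun a b => (-1 : K) ^ (a + b) • mon a b

/-- The action of `y` in the representation of `𝓡` on `𝓡 e ≅ K[x, y]`. -/
def actY : Module.End K (MvPolynomial (Fin 2) K) := mulY + (hbar₁ / 2) • dunklOp

@[simp] theorem mulX_mon (a b : ℕ) : mulX (mon a b) = mon (a + 1) b := ofMon_mon _ a b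
@[simp] theorem mulY_mon (a b : ℕ) : mulY (mon a b) = mon a (b + 1) := ofMon_mon _ a b
@[simp] theorem actγ_mon (a b : ℕ) : actγ (mon a b) = (-1 : K) ^ (a + b) • mon a b :=
  ofMon_mon _ a b
theorem dunklOp_mon (a b : ℕ) : dunklOp (mon a b) =
    (a + hbar₂ * ((-1) ^ b * parityFactor a)) • mon (a - 1) b := ofMon_mon _ a b
theorem actY_apply (g : MvPolynomial (Fin 2) K) :
    actY g = mulY g + (hbar₁ / 2) • dunklOp g := rfl
@[simp] theorem dunklOp_mon_zero (b : ℕ) : dunklOp (mon 0 b) = 0 := by simp [dunklOp_mon]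
@[simp] theorem dunklOp_mon_succ (a b : ℕ) : dunklOp (mon (a + 1) b) =
    (a + 1 + hbar₂ * ((-1) ^ b * parityFactor (a + 1))) • mon a b := by simp [dunklOp_mon]

theorem actγ_actγ : actγ * actγ = 1 := by
  refine linearMap_ext_mon fun a b => ?_
  simp [smul_smul, ← mul_pow]

theorem actγ_mulX : actγ * mulX + mulX * actγ = 0 := by
  refine linearMap_ext_mon fun a b => ?_
  simp only [LinearMap.add_apply, Module.End.mul_apply, mulX_mon, actγ_mon, map_smul,
    ← add_smul, LinearMap.zero_apply]
  rw [show a + 1 + b = (a + b) + 1 by ring, pow_succ, mul_neg_one, neg_add_cancel, zero_smul]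

theorem actγ_actY : actγ * actY + actY * actγ = 0 := by
  refine linearMap_ext_mon fun a b => ?_
  cases a with
  | zero =>
    simp [actY_apply, pow_succ]
  | succ a =>
    simp only [LinearMap.add_apply, Module.End.mul_apply, actY_apply, mulY_mon, actγ_mon, map_smul,
      map_add, dunklOp_mon_succ, LinearMap.zero_apply, smul_smul, smul_add]
    rw [show a + 1 + (b + 1) = a + b + 1 + 1 by ring, show a + 1 + b = a + b + 1 by ring]
    simp only [pow_succ]
    module

theorem actY_mulX : actY * mulX =
    mulX * actY + (hbar₁ / 2) • (1 + (2 * hbar₂) • actγ) := by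
  refine linearMap_ext_mon fun a b => ?_
  cases a with
  | zero =>
    simp only [LinearMap.add_apply, Module.End.mul_apply, actY_apply, mulY_mon, actγ_mon,
      dunklOp_mon_succ, dunklOp_mon_zero, smul_smul, smul_add, mulX_mon,
      LinearMap.smul_apply, Module.End.one_apply, parityFactor_succ, parityFactor_zero, smul_zero,
      add_zero, Nat.cast_zero]
    rw [zero_add, zero_add]
    module
  | succ a =>
    simp only [LinearMap.add_apply, Module.End.mul_apply, actY_apply, mulY_mon, actγ_mon, map_smul,
      map_add, dunklOp_mon_succ, smul_smul, smul_add, mulX_mon,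
      LinearMap.smul_apply, Module.End.one_apply]
    simp only [parityFactor, pow_succ, pow_add]
    push_cast
    module

/-- The generators of `𝓡` as operators on `K[x, y]`. -/
def actGen : Gen → Module.End K (MvPolynomial (Fin 2) K)
  | .x => mulX
  | .y => actY
  | .γ => actγ

/-- The representation of `𝓡` on `K[x, y] ≅ 𝓡 e`. -/
def rep : SRA →ₐ[K] Module.End K (MvPolynomial (Fin 2) K) :=
  RingQuot.liftAlgHom K ⟨FreeAlgebra.lift K actGen, by
    intro r s h
    induction h with
    | γ_γ => simpa [actGen] using actγ_actγ
    | γ_x => simpa [actGen] using actγ_mulX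
    | γ_y => simpa [actGen] using actγ_actY
    | y_x => simpa [actGen] using actY_mulX⟩

@[simp] theorem rep_gen (g : Gen) : rep (gen g) = actGen g := by
  simp [rep, gen]

theorem gen_γ_mul_γ : gen .γ * gen .γ = 1 := by
  have := RingQuot.mkAlgHom_rel K SRARel.γ_γ
  rw [map_mul, map_one] at this
  exact this

theorem gen_γ_mul_x : gen .γ * gen .x = -(gen .x * gen .γ) := by
  have := RingQuot.mkAlgHom_rel K SRARel.γ_x
  rw [map_add, map_mul, map_mul, map_zero] at this
  exact eq_neg_of_add_eq_zero_left this

theorem gen_γ_mul_y : gen .γ * gen .y = -(gen .y * gen .γ) := by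
  have := RingQuot.mkAlgHom_rel K SRARel.γ_y
  rw [map_add, map_mul, map_mul, map_zero] at this
  exact eq_neg_of_add_eq_zero_left this

theorem gen_y_mul_x : gen .y * gen .x =
    gen .x * gen .y + (hbar₁ / 2) • (1 + (2 * hbar₂) • gen .γ) := by
  have := RingQuot.mkAlgHom_rel K SRARel.y_x
  rw [map_mul, map_add, map_mul, map_smul, map_add, map_smul, map_one] at this
  exact this

/-! ### Commutation relations -/

/-- The element `u + v γ` of the group algebra of `ℤ₂` in `𝓡`. -/
def grp (u v : K) : SRA := u • 1 + v • gen .γ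

theorem grp_mul_grp (u v u' v' : K) :
    grp u v * grp u' v' = grp (u * u' + v * v') (u * v' + v * u') := by
  simp only [grp, add_mul, mul_add, smul_mul_smul_comm, gen_γ_mul_γ, mul_one, one_mul]
  module

theorem grp_add_grp (u v u' v' : K) : grp u v + grp u' v' = grp (u + u') (v + v') := by
  simp only [grp]
  module

theorem grp_mul_of_anticomm {X : SRA} (hX : gen .γ * X = -(X * gen .γ)) (u v : K) :
    grp u v * X = X * grp u (-v) := by
  simp only [grp, add_mul, mul_add, smul_mul_assoc, mul_smul_comm, mul_one, one_mul, hX]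
  module

theorem grp_mul_pow_of_anticomm {X : SRA} (hX : gen .γ * X = -(X * gen .γ)) (u v : K) (n : ℕ) :
    grp u v * X ^ n = X ^ n * grp u ((-1) ^ n * v) := by
  induction n with
  | zero => simp
  | succ n ih =>
    rw [pow_succ, ← mul_assoc, ih, mul_assoc, grp_mul_of_anticomm hX, mul_assoc, pow_succ]
    congr 3
    ring

/-- Two elements that satisfy the relations of the generators `x`, `y` of the symplectic reflection
algebra with parameter `κ` instead of `ħ₁`. -/
structure IsDunklPair (X Y : SRA) (κ : K) : Prop where
  γ_fst : gen .γ * X = -(X * gen .γ)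
  γ_snd : gen .γ * Y = -(Y * gen .γ)
  snd_mul_fst : Y * X = X * Y + grp (κ / 2) (κ * hbar₂)

theorem isDunklPair_gen : IsDunklPair (gen .x) (gen .y) hbar₁ where
  γ_fst := gen_γ_mul_x
  γ_snd := gen_γ_mul_y
  snd_mul_fst := by
    rw [gen_y_mul_x, grp]
    module

theorem const_neg_I_eq : const (-Complex.I) = -const Complex.I := const_neg _

/-- The elements `z` and `z̄` satisfy the relations of `x` and `y` with another parameter, so that
the formulas for ordered monomials apply to both pairs. -/
theorem isDunklPair_z : IsDunklPair zElt zbarElt (-2 * const Complex.I * hbar₁) where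
  γ_fst := by
    simp only [zElt, mul_add, add_mul, mul_smul_comm, smul_mul_assoc, gen_γ_mul_x, gen_γ_mul_y]
    module
  γ_snd := by
    simp only [zbarElt, mul_add, add_mul, mul_smul_comm, smul_mul_assoc, gen_γ_mul_x, gen_γ_mul_y]
    module
  snd_mul_fst := by
    simp only [zElt, zbarElt, mul_add, add_mul, mul_smul_comm, smul_mul_assoc, gen_y_mul_x, grp,
      const_neg_I_eq]
    module

namespace IsDunklPair

variable {X Y : SRA} {κ : K} (h : IsDunklPair X Y κ)
include h

theorem snd_mul_pow_fst (n : ℕ) : Y * X ^ (n + 1) = X ^ (n + 1) * Y +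
    X ^ n * grp (κ / 2 * (n + 1)) (κ / 2 * hbar₂ * parityFactor (n + 1)) := by
  induction n with
  | zero =>
    simp only [zero_add, pow_one, pow_zero, one_mul, h.snd_mul_fst, parityFactor_succ]
    congr 2
    · simp
    · simp only [parityFactor_zero]; ring
  | succ n ih =>
    rw [pow_succ, ← mul_assoc, ih, add_mul, mul_assoc, h.snd_mul_fst, mul_assoc,
      grp_mul_of_anticomm h.γ_fst, mul_add, ← mul_assoc, ← pow_succ, ← mul_assoc (X ^ n),
      ← pow_succ, add_assoc, ← mul_add, grp_add_grp]
    rw [parityFactor_succ (n + 1)]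
    congr 3
    · push_cast; ring
    · ring

theorem snd_mul_pow_mul_pow (a b : ℕ) : Y * (X ^ (a + 1) * Y ^ b) = X ^ (a + 1) * Y ^ (b + 1) +
    X ^ a * Y ^ b *
      grp (κ / 2 * (a + 1)) ((-1) ^ b * (κ / 2 * hbar₂ * parityFactor (a + 1))) := by
  rw [← mul_assoc, h.snd_mul_pow_fst, add_mul, mul_assoc _ Y, ← pow_succ', mul_assoc (X ^ a),
    grp_mul_pow_of_anticomm h.γ_snd, ← mul_assoc]

theorem pow_snd_mul_fst (n : ℕ) : Y ^ (n + 1) * X = X * Y ^ (n + 1) +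
    Y ^ n * grp (κ / 2 * (n + 1)) (κ / 2 * hbar₂ * parityFactor (n + 1)) := by
  induction n with
  | zero =>
    simp only [zero_add, pow_one, pow_zero, one_mul, h.snd_mul_fst, parityFactor_succ]
    congr 2
    · simp
    · simp only [parityFactor_zero]; ring
  | succ n ih =>
    rw [pow_succ', mul_assoc, ih, mul_add, ← mul_assoc, h.snd_mul_fst, add_mul,
      grp_mul_pow_of_anticomm h.γ_snd, mul_assoc, ← mul_assoc Y (Y ^ n), ← pow_succ', ← pow_succ',
      add_assoc, ← mul_add, grp_add_grp]
    congr 3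
    · push_cast; ring
    · simp only [parityFactor, pow_succ]; ring

end IsDunklPair

/-! ### The module `𝓡 e` -/

theorem grp_mul_e (u v : K) : grp u v * e = (u + v) • e := by
  simp only [grp, e, add_mul, mul_add, smul_mul_assoc, mul_smul_comm, one_mul, mul_one,
    gen_γ_mul_γ]
  module

theorem gen_γ_mul_e : gen .γ * e = e := by
  simpa [grp] using grp_mul_e 0 1

theorem gen_γ_mul_pow_mul_pow (a b : ℕ) : gen .γ * (gen .x ^ a * gen .y ^ b) =
    (-1 : K) ^ (a + b) • (gen .x ^ a * gen .y ^ b * gen .γ) := by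
  have h1 := grp_mul_pow_of_anticomm gen_γ_mul_x 0 1 a
  have h2 := grp_mul_pow_of_anticomm gen_γ_mul_y 0 ((-1) ^ a) b
  simp only [grp, zero_smul, zero_add, one_smul, mul_one] at h1 h2
  rw [← mul_assoc, h1, mul_assoc, h2, pow_add, mul_comm ((-1) ^ a), mul_smul_comm, mul_smul_comm,
    mul_assoc]

/-- The map `g ↦ g e` from polynomials to `𝓡 e` is `𝓡`-linear, on the generators of `𝓡`. -/
theorem ordered_actGen_mul_e (g : Gen) (f : MvPolynomial (Fin 2) K) :
    ordered (actGen g f) * e = gen g * (ordered f * e) := by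
  have key : (LinearMap.mulRight K e) ∘ₗ ordered ∘ₗ actGen g =
      (LinearMap.mulLeft K (gen g)) ∘ₗ (LinearMap.mulRight K e) ∘ₗ ordered := by
    refine linearMap_ext_mon fun a b => ?_
    simp only [LinearMap.comp_apply, LinearMap.mulRight_apply, LinearMap.mulLeft_apply,
      ordered_mon]
    cases g with
    | x =>
      simp only [actGen, mulX_mon, ordered_mon]
      rw [pow_succ']
      simp only [mul_assoc]
    | y =>
      cases a with
      | zero =>
        simp only [actGen, actY_apply, mulY_mon, dunklOp_mon_zero, smul_zero, add_zero,
          ordered_mon, pow_zero, one_mul]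
        rw [pow_succ', mul_assoc]
      | succ a =>
        simp only [actGen, actY_apply, mulY_mon, dunklOp_mon_succ, map_add, map_smul,
          ordered_mon]
        rw [← mul_assoc (gen .y) (_ * _) e, isDunklPair_gen.snd_mul_pow_mul_pow, add_mul, add_mul,
          mul_assoc _ (grp _ _), grp_mul_e, smul_mul_assoc, smul_mul_assoc, mul_smul_comm,
          smul_smul]
        congr 2
        ring
    | γ =>
      simp only [actGen, actγ_mon, map_smul, ordered_mon]
      rw [← mul_assoc, gen_γ_mul_pow_mul_pow, smul_mul_assoc, smul_mul_assoc, mul_assoc _ (gen .γ),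
        gen_γ_mul_e]
  exact LinearMap.congr_fun key f

/-- Induction over the elements of `𝓡`. -/
theorem sra_induction {p : SRA → Prop} (hgen : ∀ g r, p r → p (gen g * r)) (hone : p 1)
    (hadd : ∀ r s, p r → p s → p (r + s)) (hsmul : ∀ (c : K) r, p r → p (c • r)) (r : SRA) :
    p r := by
  have main : ∀ w : FreeAlgebra K Gen, ∀ r : SRA, p r →
      p (RingQuot.mkAlgHom K SRARel w * r) := by
    intro w
    induction w using FreeAlgebra.induction with
    | grade0 c =>
      intro r hr
      rw [AlgHom.commutes, ← Algebra.smul_def]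
      exact hsmul c r hr
    | grade1 g => exact fun r hr => hgen g r hr
    | mul a b ha hb =>
      intro r hr
      rw [map_mul, mul_assoc]
      exact ha _ (hb _ hr)
    | add a b ha hb =>
      intro r hr
      rw [map_add, add_mul]
      exact hadd _ _ (ha _ hr) (hb _ hr)
  obtain ⟨w, rfl⟩ := RingQuot.mkAlgHom_surjective K SRARel r
  simpa using main w 1 hone

/-- The map `g ↦ g e` from polynomials to `𝓡 e` is `𝓡`-linear. -/
theorem ordered_rep_mul_e (r : SRA) : ∀ f : MvPolynomial (Fin 2) K,
    ordered (rep r f) * e = r * (ordered f * e) := by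
  induction r using sra_induction with
  | hgen g r ih =>
    intro f
    rw [map_mul, Module.End.mul_apply, rep_gen, ordered_actGen_mul_e, ih, mul_assoc]
  | hone =>
    intro f
    rw [map_one, Module.End.one_apply, one_mul]
  | hadd r s hr hs =>
    intro f
    rw [map_add, LinearMap.add_apply, map_add, add_mul, hr, hs, add_mul]
  | hsmul c r hr =>
    intro f
    rw [map_smul, LinearMap.smul_apply, map_smul, smul_mul_assoc, hr, smul_mul_assoc]

/-- Acting on `1`, the ordered monomials give the commutative monomials. -/
theorem rep_pow_mul_pow (a b : ℕ) : rep (gen .x ^ a * gen .y ^ b) (mon 0 0) = mon a b := by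
  have hy : ∀ b : ℕ, (actY ^ b) (mon 0 0) = mon 0 b := fun b => by
    induction b with
    | zero => rfl
    | succ b ih =>
      rw [pow_succ', Module.End.mul_apply, ih, actY_apply, mulY_mon, dunklOp_mon_zero, smul_zero,
        add_zero]
  have hx : ∀ a : ℕ, (mulX ^ a) (mon 0 b) = mon a b := fun a => by
    induction a with
    | zero => rfl
    | succ a ih => rw [pow_succ', Module.End.mul_apply, ih, mulX_mon]
  rw [map_mul, map_pow, map_pow, rep_gen, rep_gen, Module.End.mul_apply]
  exact (congrArg _ (hy b)).trans (hx a)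

theorem rep_ordered (f : MvPolynomial (Fin 2) K) : rep (ordered f) (mon 0 0) = f := by
  have key : (LinearMap.applyₗ (mon 0 0)) ∘ₗ rep.toLinearMap ∘ₗ ordered = LinearMap.id := by
    refine linearMap_ext_mon fun a b => ?_
    rw [LinearMap.comp_apply, LinearMap.comp_apply, ordered_mon]
    exact rep_pow_mul_pow a b
  exact LinearMap.congr_fun key f

theorem rep_e : rep e (mon 0 0) = mon 0 0 := by
  simp only [e, map_smul, map_add, map_one, rep_gen, actGen, LinearMap.smul_apply,
    LinearMap.add_apply, Module.End.one_apply, actγ_mon]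
  module

/-- The Poincaré–Birkhoff–Witt property: `f` is determined by the element `f e` of `𝓡 e`. -/
theorem eq_rep_of_ordered_mul_e_eq {f : MvPolynomial (Fin 2) K} {r : SRA}
    (h : ordered f * e = r * e) : f = rep r (mon 0 0) := by
  have := congrArg (fun s => rep s (mon 0 0)) h
  simp only [map_mul, Module.End.mul_apply, rep_e] at this
  rw [← this, rep_ordered]

theorem ordered_one : ordered (mon 0 0) = 1 := by simp

theorem ordered_rep_one_mul_e (r : SRA) : ordered (rep r (mon 0 0)) * e = r * e := by
  rw [ordered_rep_mul_e, ordered_one, one_mul]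

/-! ### The values of the trace -/

/-- The factor with index `l` of the trace formula, as a polynomial in `ħ₂`. -/
def factorPoly (l : ℕ) : Polynomial ℂ :=
  Polynomial.C ((l : ℂ) / 2) +
    Polynomial.C ((-1) ^ (l + 1) * (2 * (((l + 1) / 2 : ℕ) : ℂ) / ((l : ℂ) + 1))) * Polynomial.X

/-- The value of the trace on `xⁿ yⁿ`, up to `ħ₁ⁿ`, as a polynomial in `ħ₂`. -/
def tracePoly (n : ℕ) : Polynomial ℂ :=
  Polynomial.C ((-(1 / 2)) ^ n) * ∏ l ∈ Finset.Icc 1 n, factorPoly l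

/-- Evaluation of polynomials at `ħ₂`. -/
def evalHbar₂ : Polynomial ℂ →+* K := Polynomial.eval₂RingHom constHom hbar₂

/-- The factor with index `l` of the trace formula. -/
def factor (l : ℕ) : K :=
  (l : K) / 2 + (-1) ^ (l + 1) * (2 * ((l + 1) / 2 : ℕ) * hbar₂ / (l + 1))

theorem evalHbar₂_C (z : ℂ) : evalHbar₂ (Polynomial.C z) = const z :=
  Polynomial.eval₂_C constHom hbar₂

theorem evalHbar₂_X : evalHbar₂ Polynomial.X = hbar₂ := Polynomial.eval₂_X constHom hbar₂

theorem evalHbar₂_factorPoly (l : ℕ) : evalHbar₂ (factorPoly l) = factor l := by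
  rw [factorPoly, map_add, map_mul, evalHbar₂_C, evalHbar₂_C, evalHbar₂_X, factor,
    ← constHom_apply, ← constHom_apply]
  simp only [map_mul, map_div₀, map_pow, map_neg, map_one, map_add, map_natCast, map_ofNat]
  ring

/-- The value of the trace on `xⁿ yⁿ`, up to `ħ₁ⁿ`. -/
def traceCoeff (n : ℕ) : K := evalHbar₂ (tracePoly n)

theorem traceCoeff_eq_prod (n : ℕ) :
    traceCoeff n = (-(1 / 2)) ^ n * ∏ l ∈ Finset.Icc 1 n, factor l := by
  rw [traceCoeff, tracePoly, map_mul, map_prod, evalHbar₂_C, ← constHom_apply]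
  simp only [evalHbar₂_factorPoly, map_pow, map_neg, map_div₀, map_one, map_ofNat]

@[simp] theorem traceCoeff_zero : traceCoeff 0 = 1 := by simp [traceCoeff_eq_prod]

theorem traceCoeff_succ (n : ℕ) :
    traceCoeff (n + 1) = -(1 / 2) * factor (n + 1) * traceCoeff n := by
  rw [traceCoeff_eq_prod, traceCoeff_eq_prod, Finset.prod_Icc_succ_top (by omega), pow_succ]
  ring

theorem natCast_add_ne_zero (n k : ℕ) : (n : K) + ((k + 1 : ℕ) : K) ≠ 0 := by
  exact_mod_cast (by omega : n + (k + 1) ≠ 0)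

/-- The right-hand side is the coefficient of `κ² / 4 Xⁿ Yⁿ` in `apply_sq_snd_mul` for `a = b = n`. -/
theorem factor_recursion (n : ℕ) : 2 * ((n : K) + 2) * factor (n + 1) =
    (n + 2) * (n + 1) +
      (-1) ^ n * hbar₂ * ((n + 2) * parityFactor (n + 1) + (n + 1) * parityFactor (n + 2)) := by
  have h2 : (n : K) + 2 ≠ 0 := natCast_add_ne_zero n 1
  have h3 : (n : K) + 1 + 1 ≠ 0 := by rwa [add_assoc, one_add_one_eq_two]
  rcases Nat.even_or_odd' n with ⟨m, rfl | rfl⟩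
  · have hp : ((-1 : K)) ^ (2 * m) = 1 := by rw [pow_mul]; simp
    simp only [factor, parityFactor, show (2 * m + 1 + 1) / 2 = m + 1 by omega, pow_succ, hp]
    push_cast at h2 h3 ⊢
    field_simp
    ring
  · have hp : ((-1 : K)) ^ (2 * m) = 1 := by rw [pow_mul]; simp
    simp only [factor, parityFactor, show (2 * m + 1 + 1 + 1) / 2 = m + 1 by omega, pow_succ, hp]
    push_cast at h2 h3 ⊢
    field_simp
    ring

/-! ### Functionals on `𝓡` that are invariant under `γ` -/

namespace IsDunklPair

variable {X Y : SRA} {κ : K} (h : IsDunklPair X Y κ) {t : SRA →ₗ[K] K}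
  (ht : ∀ r u v, t (r * grp u v) = (u + v) * t r)
include h ht


/-- The functionals `t` with `t (r (u + v γ)) = (u + v) t r` are those that factor through `r ↦ r e`;
for them, a product of ordered monomials can be evaluated with `γ` replaced by `1` on the right. -/
theorem apply_sq_snd_mul (a b : ℕ) : t (Y * Y * (X ^ (a + 2) * Y ^ b)) =
    t (X ^ (a + 2) * Y ^ (b + 2)) + κ * (a + 2) * t (X ^ (a + 1) * Y ^ (b + 1)) +
    κ ^ 2 / 4 * ((a + 2) * (a + 1) + (-1) ^ b * hbar₂ *
      ((a + 2) * parityFactor (a + 1) + (a + 1) * parityFactor (a + 2))) * t (X ^ a * Y ^ b) := by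
  rw [mul_assoc, h.snd_mul_pow_mul_pow, mul_add, ← mul_assoc Y (_ * _) (grp _ _),
    h.snd_mul_pow_mul_pow, h.snd_mul_pow_mul_pow, add_mul]
  simp only [map_add, ht]
  have := parityFactor_succ_mul (a + 1)
  push_cast
  linear_combination (norm := ring) (((-1) ^ b) ^ 2 * (κ / 2 * hbar₂) ^ 2 *
    t (X ^ a * Y ^ b)) * this

theorem apply_mul_sq_fst (a b : ℕ) : t (X ^ a * Y ^ (b + 2) * (X * X)) =
    t (X ^ (a + 2) * Y ^ (b + 2)) + κ * (b + 2) * t (X ^ (a + 1) * Y ^ (b + 1)) +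
    κ ^ 2 / 4 * ((b + 2) * (b + 1) + hbar₂ *
      ((b + 2) * parityFactor (b + 1) - (b + 1) * parityFactor (b + 2))) * t (X ^ a * Y ^ b) := by
  have e1 : X ^ a * Y ^ (b + 2) * (X * X) = X ^ (a + 2) * Y ^ (b + 2) +
      X ^ (a + 1) * Y ^ (b + 1) * grp (κ / 2 * ((b + 1 : ℕ) + 1))
        (κ / 2 * hbar₂ * parityFactor (b + 2)) +
      (X ^ (a + 1) * Y ^ (b + 1) + X ^ a * Y ^ b * grp (κ / 2 * (b + 1))
        (κ / 2 * hbar₂ * parityFactor (b + 1))) *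
        grp (κ / 2 * ((b + 1 : ℕ) + 1)) (-(κ / 2 * hbar₂ * parityFactor (b + 2))) := by
    rw [← mul_assoc, mul_assoc (X ^ a), h.pow_snd_mul_fst, mul_assoc, add_mul, mul_assoc X,
      h.pow_snd_mul_fst, mul_assoc (Y ^ (b + 1)), grp_mul_of_anticomm h.γ_fst,
      ← mul_assoc (Y ^ (b + 1)), h.pow_snd_mul_fst]
    simp only [mul_add, add_mul, pow_succ, mul_assoc]
  rw [e1]
  simp only [map_add, ht, add_mul]
  have := parityFactor_succ_mul (b + 1)
  push_cast
  linear_combination (norm := ring) (-(κ / 2 * hbar₂) ^ 2 * t (X ^ a * Y ^ b)) * this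

theorem apply_mul_fst_mul_snd (a b : ℕ) : t (X ^ a * Y ^ b * (X * Y)) =
    t (X ^ (a + 1) * Y ^ (b + 1)) +
    κ / 2 * (b - hbar₂ * parityFactor b) * t (X ^ a * Y ^ b) := by
  cases b with
  | zero => simp [pow_succ, mul_assoc]
  | succ b =>
    have e1 : X ^ a * Y ^ (b + 1) * (X * Y) = X ^ (a + 1) * Y ^ (b + 2) +
        X ^ a * Y ^ (b + 1) * grp (κ / 2 * (b + 1)) (-(κ / 2 * hbar₂ * parityFactor (b + 1))) := by
      rw [← mul_assoc, mul_assoc (X ^ a), h.pow_snd_mul_fst, mul_assoc, add_mul,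
        mul_assoc (Y ^ b), grp_mul_of_anticomm h.γ_snd]
      simp only [mul_add, pow_succ, mul_assoc]
    rw [e1, map_add, ht]
    push_cast
    ring

theorem apply_fst_mul_snd_mul (a b : ℕ) : t (X * Y * (X ^ a * Y ^ b)) =
    t (X ^ (a + 1) * Y ^ (b + 1)) +
    κ / 2 * (a + (-1) ^ b * hbar₂ * parityFactor a) * t (X ^ a * Y ^ b) := by
  cases a with
  | zero => simp [pow_succ', mul_assoc]
  | succ a =>
    rw [mul_assoc, h.snd_mul_pow_mul_pow, mul_add, ← mul_assoc X, ← mul_assoc X, ← mul_assoc X,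
      ← pow_succ', map_add, ht, ← pow_succ']
    push_cast
    ring

omit ht in
theorem sq_snd_mul_sq_fst : Y * Y * (X * X) =
    X * X * (Y * Y) + (2 * κ) • (X * Y) + grp (κ ^ 2 / 2) (κ ^ 2 * hbar₂) := by
  have h1 := h.snd_mul_fst
  have h2 := grp_mul_of_anticomm h.γ_fst (κ / 2) (κ * hbar₂)
  have h3 := grp_mul_of_anticomm h.γ_snd (κ / 2) (κ * hbar₂)
  have h4 := grp_mul_of_anticomm h.γ_snd (κ / 2) (-(κ * hbar₂))
  have h5 : X * Y * (grp (κ / 2) (κ * hbar₂) + grp (κ / 2) (-(κ * hbar₂))) = κ • (X * Y) := by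
    rw [grp_add_grp, add_halves, add_neg_cancel, grp, zero_smul, add_zero, mul_smul_comm, mul_one]
  have h6 : grp (κ / 2) (κ * hbar₂) * (grp (κ / 2) (κ * hbar₂) + grp (κ / 2) (-(κ * hbar₂))) =
      grp (κ ^ 2 / 2) (κ ^ 2 * hbar₂) := by
    rw [grp_add_grp, grp_mul_grp]
    congr 1 <;> ring
  rw [neg_neg] at h4
  rw [← h6, two_mul, add_smul, ← h5]
  generalize grp (κ / 2) (κ * hbar₂) = g at *
  generalize grp (κ / 2) (-(κ * hbar₂)) = g' at *
  linear_combination (norm := noncomm_ring) Y * h1 * X + h1 * (Y * X) + X * Y * h1 + X * h1 * Y +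
    g * h1 + h2 * Y + X * h4 + X * h3 + Y * h2 + h1 * g'

end IsDunklPair

/-! ### The trace on `𝓡` -/

/-- The trace on polynomials: `xⁿ yⁿ ↦ ħ₁ⁿ traceCoeff n`, and `xⁱ yʲ ↦ 0` for `i ≠ j`. -/
def polyTrace : MvPolynomial (Fin 2) K →ₗ[K] K :=
  ofMon fun i j => if i = j then hbar₁ ^ i * traceCoeff i else 0

theorem polyTrace_mon (i j : ℕ) :
    polyTrace (mon i j) = if i = j then hbar₁ ^ i * traceCoeff i else 0 := ofMon_mon _ i j

/-- The functional `r ↦ polyTrace (r e)` on `𝓡`. It restricts to a trace on the elements that commute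
with `γ`. -/
def sraTrace : SRA →ₗ[K] K :=
  polyTrace ∘ₗ LinearMap.applyₗ (mon 0 0) ∘ₗ rep.toLinearMap

theorem sraTrace_apply (r : SRA) : sraTrace r = polyTrace (rep r (mon 0 0)) := rfl

theorem sraTrace_one : sraTrace 1 = 1 := by
  simp [sraTrace_apply, polyTrace_mon]

theorem sraTrace_mul_grp (r : SRA) (u v : K) : sraTrace (r * grp u v) = (u + v) * sraTrace r := by
  simp only [sraTrace_apply, grp, mul_add, mul_smul_comm, mul_one, map_add, map_smul, map_mul,
    rep_gen, actGen, Module.End.mul_apply, actγ_mon,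
    smul_eq_mul]
  simp [add_mul]

theorem sraTrace_pow_mul_pow (a b : ℕ) : sraTrace (gen .x ^ a * gen .y ^ b) =
    if a = b then hbar₁ ^ a * traceCoeff a else 0 := by
  rw [sraTrace_apply, rep_pow_mul_pow, polyTrace_mon]

theorem sraTrace_γ_mul (r : SRA) : sraTrace (gen .γ * r) = sraTrace r := by
  have key : polyTrace ∘ₗ actγ = polyTrace := by
    refine linearMap_ext_mon fun a b => ?_
    rw [LinearMap.comp_apply, actγ_mon, map_smul, polyTrace_mon]
    split_ifs with h
    · rw [h, ← two_mul, pow_mul]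
      simp
    · simp
  rw [sraTrace_apply, map_mul, rep_gen, Module.End.mul_apply]
  exact LinearMap.congr_fun key _

/-- The elements that commute with `γ` and with everything under the trace. -/
def traceCommuting : Subalgebra K SRA where
  carrier := {s | gen .γ * s = s * gen .γ ∧ ∀ r, sraTrace (s * r) = sraTrace (r * s)}
  mul_mem' {s s'} hs hs' := ⟨by rw [← mul_assoc, hs.1, mul_assoc, hs'.1, mul_assoc], fun r => by
    rw [mul_assoc, hs.2, mul_assoc, hs'.2, mul_assoc]⟩
  add_mem' {s s'} hs hs' := ⟨by rw [mul_add, hs.1, hs'.1, add_mul], fun r => by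
    rw [add_mul, mul_add, map_add, map_add, hs.2, hs'.2]⟩
  algebraMap_mem' c := ⟨(Algebra.commutes c _).symm, fun r => by rw [Algebra.commutes]⟩

theorem γ_mem_traceCommuting : gen .γ ∈ traceCommuting := by
  refine ⟨rfl, fun r => ?_⟩
  have := sraTrace_mul_grp r 0 1
  rw [grp, zero_smul, one_smul, zero_add, zero_add, one_mul] at this
  rw [sraTrace_γ_mul, this]

theorem grp_mem_traceCommuting (u v : K) : grp u v ∈ traceCommuting :=
  add_mem (Subalgebra.smul_mem _ (one_mem _) u) (Subalgebra.smul_mem _ γ_mem_traceCommuting v)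

/-- An element commuting with `γ` lies in `traceCommuting` if it commutes with the ordered monomials
under the trace. -/
theorem mem_traceCommuting_of_mon {s : SRA} (hs : gen .γ * s = s * gen .γ)
    (h : ∀ a b, sraTrace (s * (gen .x ^ a * gen .y ^ b)) =
      sraTrace (gen .x ^ a * gen .y ^ b * s)) : s ∈ traceCommuting := by
  refine ⟨hs, fun r => ?_⟩
  have hse : s * e = e * s := by
    simp only [e, mul_smul_comm, smul_mul_assoc, mul_add, add_mul, mul_one, one_mul, hs]
  have he : ∀ q : SRA, sraTrace (q * e) = sraTrace q := fun q => by
    rw [sraTrace_apply, map_mul, Module.End.mul_apply, rep_e, sraTrace_apply]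
  have key : sraTrace ∘ₗ LinearMap.mulLeft K s ∘ₗ ordered =
      sraTrace ∘ₗ LinearMap.mulRight K s ∘ₗ ordered := by
    refine linearMap_ext_mon fun a b => ?_
    simpa using h a b
  calc sraTrace (s * r) = sraTrace (s * ordered (rep r (mon 0 0))) := by
        rw [← he (s * r), mul_assoc, ← ordered_rep_one_mul_e, ← mul_assoc, he]
    _ = sraTrace (ordered (rep r (mon 0 0)) * s) := LinearMap.congr_fun key (rep r (mon 0 0))
    _ = sraTrace (r * s) := by
        rw [← he, mul_assoc, hse, ← mul_assoc, ordered_rep_one_mul_e, mul_assoc, ← hse,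
          ← mul_assoc, he]

theorem gen_γ_mul_mul_of_anticomm {X Y : SRA} (hX : gen .γ * X = -(X * gen .γ))
    (hY : gen .γ * Y = -(Y * gen .γ)) : gen .γ * (X * Y) = X * Y * gen .γ := by
  have hγ : grp 0 1 = gen .γ := by rw [grp, zero_smul, one_smul, zero_add]
  rw [← hγ, ← mul_assoc, grp_mul_of_anticomm hX, mul_assoc, grp_mul_of_anticomm hY, neg_neg,
    ← mul_assoc]

/-- The recursion for the values of the trace that is equivalent to its vanishing on the commutators
of `y²` with `xⁿ⁺² yⁿ`. -/
theorem trace_recursion (n : ℕ) : hbar₁ * (n + 2) * (hbar₁ ^ (n + 1) * traceCoeff (n + 1)) +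
    hbar₁ ^ 2 / 4 * ((n + 2) * (n + 1) + (-1) ^ n * hbar₂ *
      ((n + 2) * parityFactor (n + 1) + (n + 1) * parityFactor (n + 2))) *
        (hbar₁ ^ n * traceCoeff n) = 0 := by
  rw [← factor_recursion, traceCoeff_succ]
  ring

theorem y_sq_mem_traceCommuting : gen .y * gen .y ∈ traceCommuting := by
  refine mem_traceCommuting_of_mon (gen_γ_mul_mul_of_anticomm gen_γ_mul_y gen_γ_mul_y) ?_
  intro a b
  have e1 : gen .x ^ a * gen .y ^ b * (gen .y * gen .y) = gen .x ^ a * gen .y ^ (b + 2) := by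
    simp only [pow_succ, mul_assoc]
  rw [e1]
  -- for `a < 2`, the general formula would involve negative powers of `x`
  match a with
  | 0 => simp only [pow_zero, one_mul, pow_succ', mul_assoc]
  | 1 =>
    have h1 := isDunklPair_gen.snd_mul_pow_mul_pow 0 b
    rw [mul_assoc, ← zero_add 1, h1, mul_add, ← mul_assoc (gen .y) (_ * _) (grp _ _),
      isDunklPair_gen.snd_mul_pow_mul_pow]
    simp only [pow_zero, one_mul, ← pow_succ', map_add, add_mul, sraTrace_mul_grp]
    have h2 := sraTrace_pow_mul_pow 0 (b + 1)
    rw [pow_zero, one_mul, if_neg (by omega)] at h2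
    rw [h2]
    ring
  | a + 2 =>
    rw [isDunklPair_gen.apply_sq_snd_mul sraTrace_mul_grp, add_assoc, add_eq_left,
      sraTrace_pow_mul_pow, sraTrace_pow_mul_pow]
    by_cases hab : a = b
    · subst hab
      rw [if_pos rfl, if_pos rfl]
      exact trace_recursion a
    · rw [if_neg (by omega), if_neg hab]
      ring

theorem x_sq_mem_traceCommuting : gen .x * gen .x ∈ traceCommuting := by
  refine mem_traceCommuting_of_mon (gen_γ_mul_mul_of_anticomm gen_γ_mul_x gen_γ_mul_x) ?_
  intro a b
  have e1 : gen .x * gen .x * (gen .x ^ a * gen .y ^ b) = gen .x ^ (a + 2) * gen .y ^ b := by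
    simp only [pow_succ', mul_assoc]
  rw [e1]
  -- for `b < 2`, the general formula would involve negative powers of `y`
  match b with
  | 0 => simp only [pow_zero, mul_one, pow_succ, mul_assoc]
  | 1 =>
    have h1 := isDunklPair_gen.pow_snd_mul_fst 0
    simp only [zero_add, pow_one, pow_zero, one_mul] at h1
    have e2 : gen .x ^ a * gen .y ^ 1 * (gen .x * gen .x) = gen .x ^ (a + 2) * gen .y ^ 1 +
        (gen .x ^ (a + 1) * gen .y ^ 0) * grp (hbar₁ / 2 * ((0 : ℕ) + 1))
          (hbar₁ / 2 * hbar₂ * parityFactor 1) +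
        (gen .x ^ (a + 1) * gen .y ^ 0) * grp (hbar₁ / 2 * ((0 : ℕ) + 1))
          (-(hbar₁ / 2 * hbar₂ * parityFactor 1)) := by
      rw [pow_one, ← mul_assoc, mul_assoc (_ ^ a), h1, mul_assoc (_ ^ a), add_mul, mul_assoc _ _ (gen .x),
        h1, grp_mul_of_anticomm gen_γ_mul_x]
      simp only [mul_add, pow_succ, pow_zero, mul_one, mul_assoc]
    rw [e2]
    simp only [map_add, sraTrace_mul_grp, sraTrace_pow_mul_pow]
    rw [if_neg (by omega : ¬ a + 1 = 0)]
    ring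
  | b + 2 =>
    rw [isDunklPair_gen.apply_mul_sq_fst sraTrace_mul_grp, add_assoc, left_eq_add,
      sraTrace_pow_mul_pow, sraTrace_pow_mul_pow]
    by_cases hab : a = b
    · subst hab
      rw [if_pos rfl, if_pos rfl]
      have := trace_recursion a
      rcases neg_one_pow_eq_or K a with h | h <;>
        simp only [parityFactor, pow_succ, h] at this ⊢ <;>
        linear_combination this
    · rw [if_neg (by omega), if_neg hab]
      ring

theorem x_mul_y_mem_traceCommuting : gen .x * gen .y ∈ traceCommuting := by
  -- `xy` is obtained from the commutator of `y²` and `x²`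
  have e1 : gen .x * gen .y = (2 * hbar₁)⁻¹ • (gen .y * gen .y * (gen .x * gen .x) -
      gen .x * gen .x * (gen .y * gen .y) - grp (hbar₁ ^ 2 / 2) (hbar₁ ^ 2 * hbar₂)) := by
    rw [isDunklPair_gen.sq_snd_mul_sq_fst, eq_inv_smul_iff₀ (by simp [hbar₁_ne_zero])]
    abel
  rw [e1]
  exact Subalgebra.smul_mem _ (sub_mem (sub_mem
    (mul_mem y_sq_mem_traceCommuting x_sq_mem_traceCommuting)
    (mul_mem x_sq_mem_traceCommuting y_sq_mem_traceCommuting)) (grp_mem_traceCommuting _ _)) _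

/-- All monomials of even degree commute with everything under the trace. -/
theorem pow_mul_pow_mem_traceCommuting {a b : ℕ} (h : Even (a + b)) :
    gen .x ^ a * gen .y ^ b ∈ traceCommuting := by
  rcases Nat.even_or_odd' a with ⟨m, rfl | rfl⟩ <;> rcases Nat.even_or_odd' b with ⟨n, rfl | rfl⟩
  · rw [pow_mul, pow_mul, pow_two, pow_two]
    exact mul_mem (pow_mem x_sq_mem_traceCommuting m) (pow_mem y_sq_mem_traceCommuting n)
  · exact absurd h (by rw [Nat.even_iff]; omega)
  · exact absurd h (by rw [Nat.even_iff]; omega)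
  · rw [pow_succ, pow_succ', mul_assoc, ← mul_assoc (gen .x), ← mul_assoc, pow_mul, pow_mul,
      pow_two, pow_two]
    exact mul_mem (mul_mem (pow_mem x_sq_mem_traceCommuting m) x_mul_y_mem_traceCommuting)
      (pow_mem y_sq_mem_traceCommuting n)

/-! ### The trace of the normally ordered monomials -/

theorem zbar_sq_mem_traceCommuting : zbarElt * zbarElt ∈ traceCommuting := by
  have e1 : zbarElt * zbarElt = gen .x * gen .x - gen .y * gen .y -
      const Complex.I • (gen .x * gen .y + (gen .x * gen .y +
        grp (hbar₁ / 2) (hbar₁ * hbar₂))) := by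
    rw [← isDunklPair_gen.snd_mul_fst]
    simp only [zbarElt, mul_add, add_mul, mul_smul_comm, smul_mul_assoc, const_neg]
    match_scalars <;> first | ring1 | linear_combination const_I_mul_I
  rw [e1]
  exact sub_mem (sub_mem x_sq_mem_traceCommuting y_sq_mem_traceCommuting)
    (Subalgebra.smul_mem _ (add_mem x_mul_y_mem_traceCommuting
      (add_mem x_mul_y_mem_traceCommuting (grp_mem_traceCommuting _ _))) _)

theorem z_mul_zbar_mem_traceCommuting : zElt * zbarElt ∈ traceCommuting := by
  have e1 : zElt * zbarElt = gen .x * gen .x + gen .y * gen .y +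
      const Complex.I • grp (hbar₁ / 2) (hbar₁ * hbar₂) := by
    have h1 := isDunklPair_gen.snd_mul_fst
    simp only [zElt, zbarElt, mul_add, add_mul, mul_smul_comm, smul_mul_assoc, const_neg, h1]
    match_scalars <;> first | ring1 | linear_combination -const_I_mul_I
  rw [e1]
  exact add_mem (add_mem x_sq_mem_traceCommuting y_sq_mem_traceCommuting)
    (Subalgebra.smul_mem _ (grp_mem_traceCommuting _ _) _)

theorem const_I_ne_zero : const Complex.I ≠ 0 := by
  rw [← const_zero]
  exact const_injective.ne Complex.I_ne_zero

/-- Under the trace, and for even `p + q`, the commutator of `z z̄` with `zᵖ z̄^q` is a nonzero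
multiple of `(p - q) zᵖ z̄^q`. -/
theorem sraTrace_z_pow_mul_zbar_pow_of_ne {p q : ℕ} (hpq : Even (p + q)) (hne : p ≠ q) :
    sraTrace (zElt ^ p * zbarElt ^ q) = 0 := by
  have h := z_mul_zbar_mem_traceCommuting.2 (zElt ^ p * zbarElt ^ q)
  rw [isDunklPair_z.apply_fst_mul_snd_mul sraTrace_mul_grp,
    isDunklPair_z.apply_mul_fst_mul_snd sraTrace_mul_grp, add_right_inj] at h
  have h1 : (-1 : K) ^ p * (-1) ^ q = 1 := by rw [← pow_add, hpq.neg_one_pow]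
  have h2 : ((p : K) - q) * (const Complex.I * hbar₁) * sraTrace (zElt ^ p * zbarElt ^ q) = 0 := by
    simp only [parityFactor] at h
    linear_combination -h + const Complex.I * hbar₁ * hbar₂ * sraTrace (zElt ^ p * zbarElt ^ q) * h1
  have h3 : (p : K) - q ≠ 0 := sub_ne_zero.2 (Nat.cast_injective.ne hne)
  simpa [h3, const_I_ne_zero, hbar₁_ne_zero] using h2

/-- The recursion for these values expresses that `z̄²` commutes with `zⁿ⁺² z̄ⁿ` under the trace. -/
theorem sraTrace_z_pow_mul_zbar_pow (n : ℕ) : sraTrace (zElt ^ n * zbarElt ^ n) =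
    (const Complex.I * hbar₁) ^ n * ∏ l ∈ Finset.Icc 1 n, factor l := by
  induction n with
  | zero => simpa using sraTrace_one
  | succ n ih =>
    have h := zbar_sq_mem_traceCommuting.2 (zElt ^ (n + 2) * zbarElt ^ n)
    have e1 : zElt ^ (n + 2) * zbarElt ^ n * (zbarElt * zbarElt) =
        zElt ^ (n + 2) * zbarElt ^ (n + 2) := by
      simp only [pow_succ, mul_assoc]
    rw [isDunklPair_z.apply_sq_snd_mul sraTrace_mul_grp, e1, add_assoc, add_eq_left,
      ← factor_recursion, ih] at h
    rw [Finset.prod_Icc_succ_top (by omega), pow_succ (const Complex.I * hbar₁)]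
    have h2 : (n : K) + 2 ≠ 0 := natCast_add_ne_zero n 1
    have h3 : -2 * const Complex.I * hbar₁ * (n + 2) ≠ 0 := by
      simp [const_I_ne_zero, hbar₁_ne_zero, h2]
    refine mul_left_cancel₀ h3 ?_
    linear_combination h

/-! ### Coefficients of the trace -/

/-- The exponent of the monomial `xⁱ yʲ`. -/
abbrev expo (i j : ℕ) : Fin 2 →₀ ℕ := Finsupp.single 0 i + Finsupp.single 1 j

theorem expo_eta (s : Fin 2 →₀ ℕ) : expo (s 0) (s 1) = s := by
  ext i
  fin_cases i <;> simp

theorem expo_injective {i j i' j' : ℕ} (h : expo i j = expo i' j') : i = i' ∧ j = j' := by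
  have h0 := DFunLike.congr_fun h 0
  have h1 := DFunLike.congr_fun h 1
  simpa using And.intro h0 h1

theorem exists_polyTrace_eq_sum (P : MvPolynomial (Fin 2) K) :
    ∃ R : ℕ, (∀ k, R ≤ k → P.coeff (expo k k) = 0) ∧
      polyTrace P = ∑ k ∈ Finset.range R, hbar₁ ^ k * traceCoeff k * P.coeff (expo k k) := by
  classical
  refine ⟨P.support.sup (fun s => s 0) + 1, fun k hk => ?_, ?_⟩
  · by_contra h
    have h1 := Finset.le_sup (f := fun s : Fin 2 →₀ ℕ => s 0) (MvPolynomial.mem_support_iff.2 h)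
    simp at h1
    omega
  · set R := P.support.sup (fun s => s 0) + 1
    have h1 : ∀ s ∈ P.support, P.coeff s * polyTrace (mon (s 0) (s 1)) =
        ∑ k ∈ Finset.range R, if expo k k = s then hbar₁ ^ k * traceCoeff k * P.coeff s else 0 := by
      intro s hs
      have h2 : s 0 < R := Nat.lt_succ_of_le (Finset.le_sup (f := fun s : Fin 2 →₀ ℕ => s 0) hs)
      rw [polyTrace_mon]
      split_ifs with h
      · rw [Finset.sum_eq_single_of_mem (s 0) (Finset.mem_range.2 h2), if_pos, mul_comm]
        · conv_rhs => rw [← expo_eta s, ← h]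
        · intro k _ hk
          rw [if_neg]
          intro h3
          rw [← expo_eta s] at h3
          exact hk (expo_injective h3).1
      · rw [Finset.sum_eq_zero, mul_zero]
        intro k _
        rw [if_neg]
        intro h3
        rw [← expo_eta s] at h3
        exact h ((expo_injective h3).1.symm.trans (expo_injective h3).2)
    conv_lhs => rw [sum_coeff_mon P]
    simp only [map_sum, map_smul, smul_eq_mul]
    rw [Finset.sum_congr rfl h1, Finset.sum_comm]
    refine Finset.sum_congr rfl fun k _ => ?_
    rw [Finset.sum_ite_eq]
    split_ifs with h
    · rfl
    · rw [MvPolynomial.notMem_support_iff.1 h, mul_zero]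

theorem coeff_mul_evalHbar₂ {p : Polynomial ℂ} {R : ℕ} (hp : p.natDegree < R) (k : ℕ) (c : K)
    (n m : ℤ) : (hbar₁ ^ k * evalHbar₂ p * c).coeff n m =
      ∑ l ∈ Finset.range R, p.coeff l * c.coeff (n - l) (m - k) := by
  have h1 : evalHbar₂ p = ∑ l ∈ Finset.range R, const (p.coeff l) * hbar₂ ^ l :=
    Polynomial.eval₂_eq_sum_range' constHom hp hbar₂
  rw [mul_assoc, K.coeff_hbar₁_pow_mul, h1, Finset.sum_mul, K.coeff_sum]
  refine Finset.sum_congr rfl fun l _ => ?_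
  rw [mul_assoc, K.coeff_const_mul, K.coeff_hbar₂_pow_mul]

/-- The trace of a polynomial through its individual complex coefficients; all sums are finite. -/
theorem coeff_polyTrace (P : MvPolynomial (Fin 2) K) (n m : ℤ) :
    (polyTrace P).coeff n m = ∑ᶠ l : ℕ, ∑ᶠ k : ℕ,
      (tracePoly k).coeff l * (P.coeff (expo k k)).coeff (n - l) (m - k) := by
  obtain ⟨R, hR, h⟩ := exists_polyTrace_eq_sum P
  set R' := (Finset.range R).sup (fun k => (tracePoly k).natDegree) + 1
  have hR' : ∀ k ∈ Finset.range R, (tracePoly k).natDegree < R' := fun k hk =>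
    Nat.lt_succ_of_le (Finset.le_sup (f := fun k => (tracePoly k).natDegree) hk)
  have h1 : ∀ l : ℕ, ∑ᶠ k : ℕ,
      (tracePoly k).coeff l * (P.coeff (expo k k)).coeff (n - l) (m - k) =
      ∑ k ∈ Finset.range R, (tracePoly k).coeff l * (P.coeff (expo k k)).coeff (n - l) (m - k) := by
    intro l
    refine finsum_eq_sum_of_support_subset _ fun k hk => ?_
    by_contra hlt
    rw [Finset.mem_coe, Finset.mem_range, not_lt] at hlt
    exact hk (by simp only [hR k hlt, K.coeff_zero, mul_zero])
  simp_rw [h1]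
  rw [finsum_eq_sum_of_support_subset (s := Finset.range R'), h, K.coeff_sum, Finset.sum_comm]
  · exact Finset.sum_congr rfl fun k hk => coeff_mul_evalHbar₂ (hR' k hk) k _ n m
  · intro l hl
    by_contra hlt
    rw [Finset.mem_coe, Finset.mem_range, not_lt] at hlt
    refine hl (Finset.sum_eq_zero fun k hk => ?_)
    rw [Polynomial.coeff_eq_zero_of_natDegree_lt ((hR' k hk).trans_le hlt), zero_mul]

/-! ### Homogeneity -/

/-- The polynomials over `ℂ[ħ₁, ħ₂]` that are homogeneous of degree `w` for the grading in which `x`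
and `y` have degree `1`, `ħ₁` has degree `2` and `ħ₂` has degree `0`. -/
def homogeneous (w : ℕ) : AddSubgroup (MvPolynomial (Fin 2) K) :=
  AddSubgroup.closure {g | ∃ (z : ℂ) (m n i j : ℕ), 2 * m + i + j = w ∧
    g = (const z * (hbar₁ ^ m * hbar₂ ^ n)) • mon i j}

theorem smul_mon_mem_homogeneous (z : ℂ) {m n i j w : ℕ} (h : 2 * m + i + j = w) :
    (const z * (hbar₁ ^ m * hbar₂ ^ n)) • mon i j ∈ homogeneous w :=
  AddSubgroup.subset_closure ⟨z, m, n, i, j, h, rfl⟩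

theorem map_mem_homogeneous {w w' : ℕ} (f : MvPolynomial (Fin 2) K →ₗ[K] MvPolynomial (Fin 2) K)
    (hf : ∀ (z : ℂ) (m n i j : ℕ), 2 * m + i + j = w →
      (const z * (hbar₁ ^ m * hbar₂ ^ n)) • f (mon i j) ∈ homogeneous w')
    {g : MvPolynomial (Fin 2) K} (hg : g ∈ homogeneous w) : f g ∈ homogeneous w' := by
  induction hg using AddSubgroup.closure_induction with
  | mem g hg =>
    obtain ⟨z, m, n, i, j, h, rfl⟩ := hg
    rw [map_smul]
    exact hf z m n i j h
  | zero => rw [map_zero]; exact zero_mem _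
  | add g g' _ _ hg hg' => rw [map_add]; exact add_mem hg hg'
  | neg g _ hg => rw [map_neg]; exact neg_mem hg

theorem const_smul_mem_homogeneous {w : ℕ} (c : ℂ) {g : MvPolynomial (Fin 2) K}
    (hg : g ∈ homogeneous w) : const c • g ∈ homogeneous w := by
  refine map_mem_homogeneous (const c • LinearMap.id) (fun z m n i j h => ?_) hg
  rw [LinearMap.smul_apply, LinearMap.id_apply, smul_smul, mul_right_comm, ← const_mul]
  exact smul_mon_mem_homogeneous _ h

theorem mulX_mem_homogeneous {w : ℕ} {g : MvPolynomial (Fin 2) K} (hg : g ∈ homogeneous w) :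
    mulX g ∈ homogeneous (w + 1) := by
  refine map_mem_homogeneous mulX (fun z m n i j h => ?_) hg
  rw [mulX_mon]
  exact smul_mon_mem_homogeneous _ (by omega)

theorem actY_mem_homogeneous {w : ℕ} {g : MvPolynomial (Fin 2) K} (hg : g ∈ homogeneous w) :
    actY g ∈ homogeneous (w + 1) := by
  refine map_mem_homogeneous actY (fun z m n i j h => ?_) hg
  rw [actY_apply, mulY_mon, smul_add]
  refine add_mem (smul_mon_mem_homogeneous _ (by omega)) ?_
  cases i with
  | zero =>
    rw [dunklOp_mon_zero, smul_zero, smul_zero]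
    exact zero_mem _
  | succ i =>
    have e1 : (const z * (hbar₁ ^ m * hbar₂ ^ n)) • (hbar₁ / 2) • dunklOp (mon (i + 1) j) =
        (const (z * ((i + 1) / 2)) * (hbar₁ ^ (m + 1) * hbar₂ ^ n)) • mon i j +
        (const (z * ((-1) ^ j * (1 - (-1) ^ (i + 1)) / 2)) *
          (hbar₁ ^ (m + 1) * hbar₂ ^ (n + 1))) • mon i j := by
      rw [dunklOp_mon_succ, smul_smul, smul_smul, ← add_smul]
      congr 1
      simp only [← constHom_apply, map_mul, map_div₀, map_add, map_sub, map_pow, map_neg, map_one,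
        map_natCast, map_ofNat, parityFactor]
      ring
    rw [e1]
    exact add_mem (smul_mon_mem_homogeneous _ (by omega)) (smul_mon_mem_homogeneous _ (by omega))

theorem rep_z_pow_mul_zbar_pow_mem_homogeneous (p q : ℕ) :
    rep (zElt ^ p * zbarElt ^ q) (mon 0 0) ∈ homogeneous (p + q) := by
  have hz : ∀ (c : ℂ) (w : ℕ) (g : MvPolynomial (Fin 2) K), g ∈ homogeneous w →
      rep (gen .x + const c • gen .y) g ∈ homogeneous (w + 1) := by
    intro c w g hg
    rw [map_add, map_smul, rep_gen, rep_gen]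
    exact add_mem (mulX_mem_homogeneous hg) (const_smul_mem_homogeneous c (actY_mem_homogeneous hg))
  have h0 : mon 0 0 ∈ homogeneous 0 := by
    simpa using smul_mon_mem_homogeneous 1 (m := 0) (n := 0) (i := 0) (j := 0) rfl
  have hq : ∀ q : ℕ, rep (zbarElt ^ q) (mon 0 0) ∈ homogeneous q := fun q => by
    induction q with
    | zero => simpa using h0
    | succ q ih =>
      rw [pow_succ', map_mul]
      exact hz _ _ _ ih
  induction p with
  | zero => simpa using hq q
  | succ p ih =>
    rw [pow_succ', mul_assoc, map_mul, add_right_comm]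
    exact hz _ _ _ ih

/-- In a homogeneous polynomial, the powers of `ħ₁`, `ħ₂`, `x` and `y` in a term that occurs are
nonnegative, and the degree determines the power of `ħ₁`. -/
theorem coeff_ne_zero_of_mem_homogeneous {w : ℕ} {g : MvPolynomial (Fin 2) K}
    (hg : g ∈ homogeneous w) {i j : ℕ} {n m : ℤ} (h : (g.coeff (expo i j)).coeff n m ≠ 0) :
    0 ≤ n ∧ 0 ≤ m ∧ 2 * m + i + j = w := by
  by_contra hc
  refine h ?_
  clear h
  induction hg using AddSubgroup.closure_induction with
  | mem g hg =>
    obtain ⟨z, m', n', i', j', h, rfl⟩ := hg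
    rw [MvPolynomial.coeff_smul, coeff_mon, smul_eq_mul]
    split_ifs with h1
    · obtain ⟨rfl, rfl⟩ := h1
      rw [mul_one, K.coeff_const_mul, K.coeff_hbar₁_pow_mul, ← mul_one (hbar₂ ^ n'),
        K.coeff_hbar₂_pow_mul, ← const_one, K.coeff_const, if_neg (by omega), mul_zero]
    · rw [mul_zero, K.coeff_zero]
  | zero => rfl
  | add g g' _ _ hg hg' => rw [MvPolynomial.coeff_add, K.coeff_add, hg, hg', add_zero]
  | neg g _ hg => rw [MvPolynomial.coeff_neg, K.coeff_neg, hg, neg_zero]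

/-! ### Smooth functions and their Taylor coefficients -/

/-- The smooth complex-valued functions on a normed space. -/
def Smooth (E : Type) [NormedAddCommGroup E] [NormedSpace ℝ E] : Submodule ℂ (E → ℂ) where
  carrier := {f | ContDiff ℝ ∞ f}
  add_mem' {f g} (hf : ContDiff ℝ ∞ f) (hg : ContDiff ℝ ∞ g) := hf.add hg
  zero_mem' := (contDiff_const : ContDiff ℝ ∞ fun _ : E => (0 : ℂ))
  smul_mem' c f (hf : ContDiff ℝ ∞ f) := (contDiff_const (c := c)).smul hf

theorem Smooth.contDiff {E : Type} [NormedAddCommGroup E] [NormedSpace ℝ E] (f : Smooth E) :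
    ContDiff ℝ ∞ f.1 := f.2

section Derivatives

variable {E : Type} [NormedAddCommGroup E] [NormedSpace ℝ E]

theorem contDiff_fderiv_const_apply {f : E → ℂ} (hf : ContDiff ℝ ∞ f) (v : E) :
    ContDiff ℝ ∞ fun r => fderiv ℝ f r v :=
  (hf.fderiv_right (m := ∞) (by simp)).clm_apply contDiff_const

/-- The derivative in the direction `v`. -/
def dirDeriv (v : E) : Smooth E →ₗ[ℂ] Smooth E where
  toFun f := ⟨fun r => fderiv ℝ f.1 r v, contDiff_fderiv_const_apply f.2 v⟩
  map_add' f g := Subtype.ext <| funext fun r => by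
    change fderiv ℝ (f.1 + g.1) r v = fderiv ℝ f.1 r v + fderiv ℝ g.1 r v
    rw [fderiv_add ((Smooth.contDiff f).differentiable (by simp) r) ((Smooth.contDiff g).differentiable (by simp) r)]
    rfl
  map_smul' c f := Subtype.ext <| funext fun r => by
    change fderiv ℝ (c • f.1) r v = c • fderiv ℝ f.1 r v
    rw [fderiv_const_smul ((Smooth.contDiff f).differentiable (by simp) r)]
    rfl

/-- The function `f` vanishes at the origin to order `m`. -/
def Vanish : ℕ → (E → ℂ) → Prop
  | 0, _ => True
  | m + 1, f => f 0 = 0 ∧ ∀ v, Vanish m fun r => fderiv ℝ f r v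

theorem fderiv_neg_of_parity {f : E → ℂ} (hf : ContDiff ℝ ∞ f) {c : ℂ}
    (h : ∀ r, f (-r) = c * f r) (r v : E) : fderiv ℝ f (-r) v = -c * fderiv ℝ f r v := by
  have h1 : (fun r => f (-r)) = c • f := funext h
  have h4 : HasFDerivAt (fun r => f (-r)) ((fderiv ℝ f (-r)).comp
      (-ContinuousLinearMap.id ℝ E)) r :=
    (hf.differentiable (by simp) (-r)).hasFDerivAt.comp r (hasFDerivAt_id r).neg
  have h2 := h4.fderiv
  rw [h1, fderiv_const_smul (hf.differentiable (by simp) r)] at h2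
  have h3 : c * fderiv ℝ f r v = -fderiv ℝ f (-r) v := by
    simpa using congrArg (fun L => L v) h2
  rw [neg_mul, h3, neg_neg]

end Derivatives

theorem dx_iterate (f : Smooth Plane) (i : ℕ) : dx^[i] f.1 = ((dirDeriv (1, 0) ^ i) f).1 := by
  induction i with
  | zero => rfl
  | succ i ih => rw [Function.iterate_succ_apply', ih, pow_succ']; rfl

theorem dy_iterate (f : Smooth Plane) (i : ℕ) : dy^[i] f.1 = ((dirDeriv (0, 1) ^ i) f).1 := by
  induction i with
  | zero => rfl
  | succ i ih => rw [Function.iterate_succ_apply', ih, pow_succ']; rfl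

/-- The Taylor coefficient of `xⁱ yʲ`, as a linear functional. -/
def taylorLM (i j : ℕ) : Smooth Plane →ₗ[ℂ] ℂ where
  toFun f := taylor f.1 i j
  map_add' f g := by
    have := map_add (dirDeriv ((1, 0) : Plane) ^ i * dirDeriv ((0, 1) : Plane) ^ j) f g
    simp only [Module.End.mul_apply] at this
    simp only [taylor, dy_iterate, dx_iterate, this]
    exact add_div _ _ _
  map_smul' c f := by
    have := map_smul (dirDeriv ((1, 0) : Plane) ^ i * dirDeriv ((0, 1) : Plane) ^ j) c f
    simp only [Module.End.mul_apply] at this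
    simp only [taylor, dy_iterate, dx_iterate, this]
    exact mul_div_assoc _ _ _

theorem taylorLM_apply (i j : ℕ) (f : Smooth Plane) : taylorLM i j f = taylor f.1 i j := rfl

theorem taylor_zero (i j : ℕ) : taylor 0 i j = 0 := map_zero (taylorLM i j)

/-- The function `xᵃ yᵇ`. -/
def monFun (a b : ℕ) (p : Plane) : ℂ := (p.1 : ℂ) ^ a * (p.2 : ℂ) ^ b

theorem contDiff_ofReal : ContDiff ℝ ∞ (fun x : ℝ => (x : ℂ)) := Complex.ofRealCLM.contDiff

theorem contDiff_monFun (a b : ℕ) : ContDiff ℝ ∞ (monFun a b) :=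
  ((contDiff_ofReal.comp contDiff_fst).pow a).mul ((contDiff_ofReal.comp contDiff_snd).pow b)

theorem hasDerivAt_ofReal_pow (a : ℕ) (x : ℝ) :
    HasDerivAt (fun x : ℝ => (x : ℂ) ^ a) (a * (x : ℂ) ^ (a - 1)) x := by
  simpa using (hasDerivAt_id x).ofReal_comp.fun_pow a

theorem fderiv_apply_eq_deriv {E : Type} [NormedAddCommGroup E] [NormedSpace ℝ E] {f : E → ℂ}
    (hf : ContDiff ℝ ∞ f) {c : ℝ → E} {t : ℝ} {v : E} (hc : HasDerivAt c v t) {w : ℂ}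
    (h : HasDerivAt (fun s => f (c s)) w t) : fderiv ℝ f (c t) v = w :=
  ((hf.differentiable (by simp) (c t)).hasFDerivAt.comp_hasDerivAt t hc).unique h

theorem dx_monFun (a b : ℕ) : dx (monFun a b) = fun p => a * monFun (a - 1) b p := by
  funext p
  have h := fderiv_apply_eq_deriv (contDiff_monFun a b) (c := fun s => (s, p.2)) (t := p.1)
    ((hasDerivAt_id p.1).prodMk (hasDerivAt_const p.1 p.2))
    ((hasDerivAt_ofReal_pow a p.1).mul_const ((p.2 : ℂ) ^ b))
  rw [mul_assoc] at h
  exact h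

theorem dy_monFun (a b : ℕ) : dy (monFun a b) = fun p => b * monFun a (b - 1) p := by
  funext p
  have h := fderiv_apply_eq_deriv (contDiff_monFun a b) (c := fun s => (p.1, s)) (t := p.2)
    ((hasDerivAt_const p.2 p.1).prodMk (hasDerivAt_id p.2))
    ((hasDerivAt_ofReal_pow b p.2).const_mul ((p.1 : ℂ) ^ a))
  rw [mul_left_comm] at h
  exact h

/-- The monomial `xᵃ yᵇ` as a smooth function. -/
def monSmooth (a b : ℕ) : Smooth Plane := ⟨monFun a b, contDiff_monFun a b⟩

theorem dirDeriv_fst_monSmooth (a b : ℕ) :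
    dirDeriv (1, 0) (monSmooth a b) = (a : ℂ) • monSmooth (a - 1) b :=
  Subtype.ext (dx_monFun a b)

theorem dirDeriv_snd_monSmooth (a b : ℕ) :
    dirDeriv (0, 1) (monSmooth a b) = (b : ℂ) • monSmooth a (b - 1) :=
  Subtype.ext (dy_monFun a b)

theorem dirDeriv_fst_pow_monSmooth (a b i : ℕ) : (dirDeriv (1, 0) ^ i) (monSmooth a b) =
    (a.descFactorial i : ℂ) • monSmooth (a - i) b := by
  induction i with
  | zero => simp
  | succ i ih =>
    rw [pow_succ', Module.End.mul_apply, ih, map_smul, dirDeriv_fst_monSmooth, smul_smul,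
      Nat.descFactorial_succ, Nat.sub_sub]
    push_cast
    rw [mul_comm]

theorem dirDeriv_snd_pow_monSmooth (a b i : ℕ) : (dirDeriv (0, 1) ^ i) (monSmooth a b) =
    (b.descFactorial i : ℂ) • monSmooth a (b - i) := by
  induction i with
  | zero => simp
  | succ i ih =>
    rw [pow_succ', Module.End.mul_apply, ih, map_smul, dirDeriv_snd_monSmooth, smul_smul,
      Nat.descFactorial_succ, Nat.sub_sub]
    push_cast
    rw [mul_comm]

theorem taylor_monFun (a b i j : ℕ) : taylor (monFun a b) i j = if a = i ∧ b = j then 1 else 0 := by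
  have h : taylor (monFun a b) i j = taylor (monSmooth a b).1 i j := rfl
  rw [h, taylor, dy_iterate, dx_iterate, dirDeriv_snd_pow_monSmooth, map_smul,
    dirDeriv_fst_pow_monSmooth]
  change (b.descFactorial j : ℂ) * ((a.descFactorial i : ℂ) * monFun (a - i) (b - j) 0) / _ = _
  simp only [monFun, Prod.fst_zero, Prod.snd_zero, Complex.ofReal_zero]
  have hf : ∀ n : ℕ, (n.factorial : ℂ) ≠ 0 := fun n => by exact_mod_cast n.factorial_ne_zero
  rcases lt_trichotomy a i with ha | rfl | ha
  · rw [Nat.descFactorial_of_lt ha, if_neg (by omega)]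
    simp
  · rcases lt_trichotomy b j with hb | rfl | hb
    · rw [Nat.descFactorial_of_lt hb, if_neg (by omega)]
      simp
    · rw [if_pos ⟨rfl, rfl⟩]
      simp only [Nat.descFactorial_self, Nat.sub_self, pow_zero, mul_one]
      rw [mul_comm, div_self (mul_ne_zero (hf _) (hf _))]
    · rw [if_neg (by omega), zero_pow (by omega : b - j ≠ 0)]
      simp
  · rw [if_neg (by omega), zero_pow (by omega : a - i ≠ 0)]
    simp

theorem taylor_congr {f g : Plane → ℂ} (h : f =ᶠ[nhds 0] g) (i j : ℕ) :
    taylor f i j = taylor g i j := by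
  have hx : ∀ {f g : Plane → ℂ}, f =ᶠ[nhds 0] g → ∀ i : ℕ, dx^[i] f =ᶠ[nhds 0] dx^[i] g := by
    intro f g h i
    induction i with
    | zero => exact h
    | succ i ih =>
      rw [Function.iterate_succ_apply', Function.iterate_succ_apply']
      exact ih.fderiv.fun_comp fun L => L (1, 0)
  have hy : ∀ j : ℕ, dy^[j] f =ᶠ[nhds 0] dy^[j] g := by
    intro j
    induction j with
    | zero => exact h
    | succ j ih =>
      rw [Function.iterate_succ_apply', Function.iterate_succ_apply']
      exact ih.fderiv.fun_comp fun L => L (0, 1)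
  rw [taylor, taylor, (hx (hy j) i).self_of_nhds]

/-! ### Parity -/

theorem neg_pow_parity {E : Type} [NormedAddCommGroup E] [NormedSpace ℝ E]
    (L : Smooth E →ₗ[ℂ] Smooth E)
    (hL : ∀ (f : Smooth E) (c : ℂ), (∀ r, f.1 (-r) = c * f.1 r) →
      ∀ r, (L f).1 (-r) = -c * (L f).1 r) (i : ℕ) (f : Smooth E) {c : ℂ}
    (h : ∀ r, f.1 (-r) = c * f.1 r) (r : E) :
    ((L ^ i) f).1 (-r) = (-1) ^ i * c * ((L ^ i) f).1 r := by
  induction i generalizing r with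
  | zero => simpa using h r
  | succ i ih =>
    rw [pow_succ', Module.End.mul_apply, hL _ _ ih, pow_succ]
    ring

theorem dirDeriv_neg {E : Type} [NormedAddCommGroup E] [NormedSpace ℝ E] (v : E) (f : Smooth E)
    (c : ℂ) (h : ∀ r, f.1 (-r) = c * f.1 r) (r : E) :
    (dirDeriv v f).1 (-r) = -c * (dirDeriv v f).1 r :=
  fderiv_neg_of_parity f.2 h r v

theorem eq_zero_of_neg_apply_zero {f : Plane → ℂ} {n : ℕ} (hn : Odd n)
    (h : f (-0) = (-1) ^ n * 1 * f 0) : f 0 = 0 := by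
  rw [neg_zero, hn.neg_one_pow] at h
  linear_combination h / 2

theorem taylor_eq_zero_of_odd (f : EvenFun) {i j : ℕ} (h : Odd (i + j)) : taylor f.1 i j = 0 := by
  let F : Smooth Plane := ⟨f.1, f.2.1⟩
  have h1 := neg_pow_parity _ (dirDeriv_neg ((0, 1) : Plane)) j F (c := 1)
    (fun r => (f.2.2 r).trans (one_mul _).symm)
  have h2 := neg_pow_parity _ (dirDeriv_neg ((1, 0) : Plane)) i _ h1 0
  have h3 : taylor f.1 i j = taylor F.1 i j := rfl
  rw [← mul_assoc, ← pow_add] at h2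
  rw [h3, taylor, dy_iterate, dx_iterate, eq_zero_of_neg_apply_zero h h2, zero_div]

/-- The operator `∂/∂z`. -/
def dzLM : Smooth Plane →ₗ[ℂ] Smooth Plane :=
  (1 / 2 : ℂ) • (dirDeriv (1, 0) - Complex.I • dirDeriv (0, 1))

/-- The operator `∂/∂z̄`. -/
def dzbarLM : Smooth Plane →ₗ[ℂ] Smooth Plane :=
  (1 / 2 : ℂ) • (dirDeriv (1, 0) + Complex.I • dirDeriv (0, 1))

theorem dzLM_apply (f : Smooth Plane) (p : Plane) : (dzLM f).1 p =
    1 / 2 * ((dirDeriv (1, 0) f).1 p - Complex.I * (dirDeriv (0, 1) f).1 p) := rfl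

theorem dzbarLM_apply (f : Smooth Plane) (p : Plane) : (dzbarLM f).1 p =
    1 / 2 * ((dirDeriv (1, 0) f).1 p + Complex.I * (dirDeriv (0, 1) f).1 p) := rfl

theorem dz_iterate (f : Smooth Plane) (i : ℕ) : dz^[i] f.1 = ((dzLM ^ i) f).1 := by
  induction i with
  | zero => rfl
  | succ i ih =>
    rw [Function.iterate_succ_apply', ih, pow_succ', Module.End.mul_apply]
    funext p
    rw [dzLM_apply, mul_comm, mul_one_div]
    rfl

theorem dzbar_iterate (f : Smooth Plane) (i : ℕ) : dzbar^[i] f.1 = ((dzbarLM ^ i) f).1 := by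
  induction i with
  | zero => rfl
  | succ i ih =>
    rw [Function.iterate_succ_apply', ih, pow_succ', Module.End.mul_apply]
    funext p
    rw [dzbarLM_apply, mul_comm, mul_one_div]
    rfl

theorem taylorZ_eq_zero_of_odd (f : EvenFun) {p q : ℕ} (h : Odd (p + q)) :
    taylorZ f.1 p q = 0 := by
  let F : Smooth Plane := ⟨f.1, f.2.1⟩
  have hz : ∀ (f : Smooth Plane) (c : ℂ), (∀ r, f.1 (-r) = c * f.1 r) →
      ∀ r, (dzLM f).1 (-r) = -c * (dzLM f).1 r := fun f c hf r => by
    rw [dzLM_apply, dirDeriv_neg _ f c hf, dirDeriv_neg _ f c hf, dzLM_apply]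
    ring
  have hzb : ∀ (f : Smooth Plane) (c : ℂ), (∀ r, f.1 (-r) = c * f.1 r) →
      ∀ r, (dzbarLM f).1 (-r) = -c * (dzbarLM f).1 r := fun f c hf r => by
    rw [dzbarLM_apply, dirDeriv_neg _ f c hf, dirDeriv_neg _ f c hf, dzbarLM_apply]
    ring
  have h1 := neg_pow_parity _ hzb q F (c := 1) (fun r => (f.2.2 r).trans (one_mul _).symm)
  have h2 := neg_pow_parity _ hz p _ h1 0
  have h3 : taylorZ f.1 p q = taylorZ F.1 p q := rfl
  rw [← mul_assoc, ← pow_add] at h2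
  rw [h3, taylorZ, dzbar_iterate, dz_iterate, eq_zero_of_neg_apply_zero h h2, zero_div]

/-! ### Borel's theorem -/

/-- The directional derivative of a component of an iterated derivative is a component of the next
one. -/
theorem exists_fderiv_eq_iteratedFDeriv {E : Type} [NormedAddCommGroup E] [NormedSpace ℝ E]
    {f g : E → ℂ} (hf : ContDiff ℝ ∞ f) {n : ℕ} {u : Fin n → E}
    (h : ∀ p, g p = iteratedFDeriv ℝ n f p u) (v p : E) :
    fderiv ℝ g p v = iteratedFDeriv ℝ (n + 1) f p (Fin.cons v u : Fin (n + 1) → E) := by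
  rw [iteratedFDeriv_succ_apply_left, funext h, fderiv_continuousMultilinear_apply_const]
  · simp
  · exact hf.differentiable_iteratedFDeriv (by exact_mod_cast ENat.natCast_lt_top n) p

theorem exists_taylor_eq_iteratedFDeriv (i j : ℕ) : ∃ u : Fin (j + i) → Plane,
    ∀ f : Plane → ℂ, ContDiff ℝ ∞ f →
      taylor f i j = iteratedFDeriv ℝ (j + i) f 0 u / (i.factorial * j.factorial) := by
  have hy : ∀ j : ℕ, ∃ u : Fin j → Plane, ∀ f : Plane → ℂ, ContDiff ℝ ∞ f →
      ∀ p, dy^[j] f p = iteratedFDeriv ℝ j f p u := by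
    intro j
    induction j with
    | zero => exact ⟨0, fun f _ p => by simp⟩
    | succ j ih =>
      obtain ⟨u, hu⟩ := ih
      refine ⟨Fin.cons (0, 1) u, fun f hf p => ?_⟩
      rw [Function.iterate_succ_apply']
      exact exists_fderiv_eq_iteratedFDeriv hf (hu f hf) _ p
  have hx : ∀ i : ℕ, ∃ u : Fin (j + i) → Plane, ∀ f : Plane → ℂ, ContDiff ℝ ∞ f →
      ∀ p, dx^[i] (dy^[j] f) p = iteratedFDeriv ℝ (j + i) f p u := by
    intro i
    induction i with
    | zero => exact hy j
    | succ i ih =>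
      obtain ⟨u, hu⟩ := ih
      refine ⟨Fin.cons (1, 0) u, fun f hf p => ?_⟩
      rw [Function.iterate_succ_apply']
      exact exists_fderiv_eq_iteratedFDeriv hf (hu f hf) _ p
  obtain ⟨u, hu⟩ := hx i
  exact ⟨u, fun f hf => by rw [taylor, hu f hf]⟩

/-- The homogeneous polynomial function of degree `d` with coefficients `t i j`. -/
def homFun (t : ℕ → ℕ → ℂ) (d : ℕ) : Smooth Plane :=
  ∑ ij ∈ Finset.HasAntidiagonal.antidiagonal d, t ij.1 ij.2 • monSmooth ij.1 ij.2

theorem homFun_apply (t : ℕ → ℕ → ℂ) (d : ℕ) (p : Plane) : (homFun t d).1 p =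
    ∑ ij ∈ Finset.HasAntidiagonal.antidiagonal d, t ij.1 ij.2 * monFun ij.1 ij.2 p := by
  rw [homFun, AddSubmonoidClass.coe_finsetSum, Finset.sum_apply]
  rfl

theorem homFun_smul (t : ℕ → ℕ → ℂ) (d : ℕ) (c : ℝ) (p : Plane) :
    (homFun t d).1 (c • p) = (c : ℂ) ^ d * (homFun t d).1 p := by
  rw [homFun_apply, homFun_apply, Finset.mul_sum]
  refine Finset.sum_congr rfl fun ij hij => ?_
  rw [← Finset.HasAntidiagonal.mem_antidiagonal.1 hij, pow_add]
  simp only [monFun, Prod.smul_fst, Prod.smul_snd, smul_eq_mul, Complex.ofReal_mul]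
  ring

theorem taylor_homFun (t : ℕ → ℕ → ℂ) (d i j : ℕ) :
    taylor (homFun t d).1 i j = if d = i + j then t i j else 0 := by
  rw [← taylorLM_apply, homFun, map_sum]
  have h : ∀ ij : ℕ × ℕ, taylorLM i j (t ij.1 ij.2 • monSmooth ij.1 ij.2) =
      if ij = (i, j) then t i j else 0 := by
    intro ij
    rw [map_smul, taylorLM_apply]
    change t ij.1 ij.2 * taylor (monFun ij.1 ij.2) i j = _
    rw [taylor_monFun]
    by_cases hc : ij.1 = i ∧ ij.2 = j
    · rw [if_pos hc, if_pos (Prod.ext hc.1 hc.2), hc.1, hc.2, mul_one]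
    · rw [if_neg hc, if_neg, mul_zero]
      rintro rfl
      exact hc ⟨rfl, rfl⟩
  simp_rw [h]
  rw [Finset.sum_ite_eq']
  exact if_congr (by rw [Finset.HasAntidiagonal.mem_antidiagonal]; exact eq_comm) rfl rfl

/-- A bump function on the plane. -/
def planeBump : ContDiffBump (0 : Plane) := ⟨1, 2, one_pos, one_lt_two⟩

/-- The function `homFun t d` cut off outside a neighbourhood of the origin. -/
def cutFun (t : ℕ → ℕ → ℂ) (d : ℕ) (p : Plane) : ℂ := (planeBump p : ℂ) * (homFun t d).1 p

theorem contDiff_cutFun (t : ℕ → ℕ → ℂ) (d : ℕ) : ContDiff ℝ ∞ (cutFun t d) :=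
  (contDiff_ofReal.comp planeBump.contDiff).mul (homFun t d).2

theorem exists_bound_iteratedFDeriv_cutFun (t : ℕ → ℕ → ℂ) (d k : ℕ) :
    ∃ C : ℝ, ∀ p, ‖iteratedFDeriv ℝ k (cutFun t d) p‖ ≤ C := by
  have h1 : HasCompactSupport (cutFun t d) :=
    (planeBump.hasCompactSupport.comp_left (g := fun x : ℝ => (x : ℂ)) Complex.ofReal_zero).mul_right
  exact (h1.iteratedFDeriv k).exists_bound_of_continuous
    ((contDiff_cutFun t d).continuous_iteratedFDeriv (by exact_mod_cast le_top))

/-- **Borel's theorem**: Taylor coefficients of smooth functions can be prescribed. -/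
theorem exists_contDiff_taylor_eq (t : ℕ → ℕ → ℂ) :
    ∃ f : Plane → ℂ, ContDiff ℝ ∞ f ∧ ∀ i j, taylor f i j = t i j := by
  choose C hC using exists_bound_iteratedFDeriv_cutFun t
  have hC0 : ∀ d k, 0 ≤ C d k := fun d k => (norm_nonneg _).trans (hC d k 0)
  -- the homogeneous part of degree `d` is cut off at a radius of order `1 / s d`; the factor `s d` is
  -- so large that the derivatives of order `k < d` are bounded by `2⁻ᵈ`
  let s : ℕ → ℝ := fun d => 1 + 2 ^ d * ∑ k ∈ Finset.range d, C d k
  have hs1 : ∀ d, 1 ≤ s d := fun d =>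
    le_add_of_nonneg_right (mul_nonneg (by positivity) (Finset.sum_nonneg fun k _ => hC0 d k))
  have hs0 : ∀ d, 0 < s d := fun d => one_pos.trans_le (hs1 d)
  have hsC : ∀ d k, k < d → C d k ≤ s d * (1 / 2) ^ d := by
    intro d k hk
    have h1 : C d k ≤ ∑ k ∈ Finset.range d, C d k :=
      Finset.single_le_sum (fun k _ => hC0 d k) (Finset.mem_range.2 hk)
    have h2 : (2 : ℝ) ^ d * (1 / 2) ^ d = 1 := by rw [← mul_pow]; norm_num
    have h3 : (0 : ℝ) < (1 / 2) ^ d := by positivity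
    have h4 : s d * (1 / 2) ^ d = (1 / 2) ^ d + (∑ k ∈ Finset.range d, C d k) * (2 ^ d * (1 / 2) ^ d) := by
      simp only [s]; ring
    rw [h4, h2]
    linarith
  let F : ℕ → Plane → ℂ := fun d p => ((s d)⁻¹ ^ d) • cutFun t d (s d • p)
  have hcomp : ∀ d, ContDiff ℝ ∞ fun p => cutFun t d (s d • p) := fun d =>
    (contDiff_cutFun t d).comp (contDiff_const_smul (s d))
  have hF : ∀ d, ContDiff ℝ ∞ (F d) := fun d => (hcomp d).const_smul ((s d)⁻¹ ^ d)
  have hFk : ∀ d k p, ‖iteratedFDeriv ℝ k (F d) p‖ ≤ (s d)⁻¹ ^ d * ((s d) ^ k * C d k) := by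
    intro d k p
    have hk : ((k : ℕ) : ℕ∞ω) ≤ ∞ := by exact_mod_cast le_top
    have e1 : iteratedFDeriv ℝ k (F d) p =
        (s d)⁻¹ ^ d • (s d) ^ k • iteratedFDeriv ℝ k (cutFun t d) (s d • p) := by
      have h1 := iteratedFDeriv_const_smul_apply' (i := k) (x := p) (a := (s d)⁻¹ ^ d)
        (((hcomp d).of_le hk).contDiffAt)
      have h2 := iteratedFDeriv_comp_const_smul (s d) ((contDiff_cutFun t d).of_le hk)
      rw [h2] at h1
      exact h1
    rw [e1, norm_smul, norm_smul, Real.norm_of_nonneg (by have := hs0 d; positivity),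
      Real.norm_of_nonneg (by have := hs0 d; positivity)]
    have := hs0 d
    gcongr
    exact hC d k _
  let v : ℕ → ℕ → ℝ := fun k d => if k < d then (1 / 2) ^ d else (s d)⁻¹ ^ d * ((s d) ^ k * C d k)
  have hv : ∀ k d p, ‖iteratedFDeriv ℝ k (F d) p‖ ≤ v k d := by
    intro k d p
    simp only [v]
    split_ifs with hk
    · refine (hFk d k p).trans ?_
      obtain ⟨r, rfl⟩ : ∃ r, d = k + r + 1 := ⟨d - k - 1, by omega⟩
      set d := k + r + 1
      have h0 := hs0 d
      have h1 : (s d)⁻¹ ^ (k + r + 1) * ((s d) ^ k * C d k) = (s d)⁻¹ ^ r * ((s d)⁻¹ * C d k) := by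
        rw [pow_succ, pow_add]
        have : (s d)⁻¹ ^ k * (s d) ^ k = 1 := by rw [← mul_pow, inv_mul_cancel₀ h0.ne', one_pow]
        linear_combination ((s d)⁻¹ ^ r * (s d)⁻¹ * C d k) * this
      rw [h1]
      have h2 : (s d)⁻¹ * C d k ≤ (1 / 2) ^ d := by
        rw [inv_mul_le_iff₀ h0]
        exact hsC d k hk
      have h3 : (s d)⁻¹ ^ r ≤ 1 := pow_le_one₀ (by positivity) (inv_le_one_of_one_le₀ (hs1 d))
      have h4 : 0 ≤ (s d)⁻¹ * C d k := mul_nonneg (by positivity) (hC0 d k)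
      exact (mul_le_of_le_one_left h4 h3).trans h2
    · exact hFk d k p
  have hvs : ∀ k, Summable (v k) := by
    intro k
    rw [← summable_nat_add_iff (k + 1)]
    have : (fun d => v k (d + (k + 1))) = fun d => (1 / 2 : ℝ) ^ (d + (k + 1)) :=
      funext fun d => if_pos (by omega)
    rw [this, summable_nat_add_iff (k + 1)]
    exact summable_geometric_two
  refine ⟨fun p => ∑' d, F d p, contDiff_tsum hF (fun k _ => hvs k) fun k d p _ => hv k d p, ?_⟩
  intro i j
  obtain ⟨u, hu⟩ := exists_taylor_eq_iteratedFDeriv i j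
  have hT : ∀ d, taylor (F d) i j = if d = i + j then t i j else 0 := by
    intro d
    rw [← taylor_homFun]
    refine taylor_congr ?_ i j
    have h1 : Filter.Tendsto (fun p : Plane => s d • p) (nhds 0) (nhds 0) := by
      have : Continuous fun p : Plane => s d • p := continuous_const_smul (s d)
      simpa using this.tendsto 0
    filter_upwards [h1.eventually planeBump.eventuallyEq_one] with p hp
    simp only [F, cutFun, hp, homFun_smul, Pi.one_apply, Complex.ofReal_one, one_mul]
    rw [Complex.real_smul, ← mul_assoc, ← Complex.ofReal_pow, ← Complex.ofReal_mul, ← mul_pow,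
      inv_mul_cancel₀ (hs0 d).ne', one_pow, Complex.ofReal_one, one_mul]
  have hsum : Summable fun d => iteratedFDeriv ℝ (j + i) (F d) 0 :=
    .of_norm_bounded (hvs (j + i)) fun d => hv (j + i) d 0
  rw [hu _ (contDiff_tsum hF (fun k _ => hvs k) fun k d p _ => hv k d p),
    iteratedFDeriv_tsum_apply (N := ⊤) hF (fun k _ => hvs k) (fun k d p _ => hv k d p) le_top,
    ← ContinuousMultilinearMap.apply_apply (𝕜 := ℝ) (m := u),
    ContinuousLinearMap.map_tsum _ hsum, ← tsum_div_const]
  simp only [ContinuousMultilinearMap.apply_apply]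
  simp_rw [← hu _ (hF _), hT]
  exact tsum_ite_eq (i + j) _

/-- Borel's theorem for even functions. -/
theorem exists_evenFun_taylor_eq (t : ℕ → ℕ → ℂ) (ht : ∀ i j, Odd (i + j) → t i j = 0) :
    ∃ f : EvenFun, ∀ i j, taylor f.1 i j = t i j := by
  obtain ⟨g, hg, hgt⟩ := exists_contDiff_taylor_eq t
  have hgn : ContDiff ℝ ∞ fun p => g (-p) := hg.comp contDiff_neg
  let G : Smooth Plane := ⟨g, hg⟩
  let G' : Smooth Plane := ⟨fun p => g (-p), hgn⟩
  -- the even part of `g` has the same Taylor coefficients of even degree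
  let A : Smooth Plane := (1 / 2 : ℂ) • (G + G')
  let O : Smooth Plane := (1 / 2 : ℂ) • (G - G')
  have hA : ∀ p, A.1 p = 1 / 2 * (g p + g (-p)) := fun p => rfl
  have hO : ∀ p, O.1 p = 1 / 2 * (g p - g (-p)) := fun p => rfl
  have hAn : ∀ p, A.1 (-p) = A.1 p := fun p => by rw [hA, hA, neg_neg, add_comm]
  refine ⟨⟨A.1, A.2, hAn⟩, fun i j => ?_⟩
  rcases Nat.even_or_odd (i + j) with h | h
  · have h1 := neg_pow_parity _ (dirDeriv_neg ((0, 1) : Plane)) j O (c := -1)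
      (fun r => by rw [hO, hO, neg_neg]; ring)
    have h2 := neg_pow_parity _ (dirDeriv_neg ((1, 0) : Plane)) i _ h1 0
    have h3 : taylor O.1 i j = 0 := by
      rw [taylor, dy_iterate, dx_iterate]
      rw [← mul_assoc, ← pow_add, h.neg_one_pow, neg_zero, one_mul] at h2
      rw [show ((dirDeriv (1, 0) ^ i) ((dirDeriv (0, 1) ^ j) O)).1 0 = 0 by
        linear_combination h2 / 2, zero_div]
    have h4 : A = G - O := by
      refine Subtype.ext (funext fun p => ?_)
      change 1 / 2 * (g p + g (-p)) = g p - 1 / 2 * (g p - g (-p))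
      ring
    change taylor A.1 i j = t i j
    rw [← taylorLM_apply, h4, map_sub, taylorLM_apply, taylorLM_apply, h3, sub_zero]
    exact hgt i j
  · rw [ht i j h]
    exact taylor_eq_zero_of_odd ⟨A.1, A.2, hAn⟩ h

/-! ### Hadamard's lemma and primitives -/

theorem apply_eq_add_integral_fderiv {E : Type} [NormedAddCommGroup E] [NormedSpace ℝ E]
    {f : E → ℂ} (hf : ContDiff ℝ ∞ f) (r : E) :
    f r = f 0 + ∫ t in (0 : ℝ)..1, fderiv ℝ f (t • r) r := by
  have h1 : ∀ t : ℝ, HasDerivAt (fun s : ℝ => f (s • r)) (fderiv ℝ f (t • r) r) t := fun t => by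
    have h2 : HasDerivAt (fun s : ℝ => s • r) r t := by
      simpa using (hasDerivAt_id t).smul_const r
    exact (hf.differentiable (by simp) (t • r)).hasFDerivAt.comp_hasDerivAt t h2
  have hc : Continuous fun t : ℝ => fderiv ℝ f (t • r) r :=
    (contDiff_fderiv_const_apply hf r).continuous.comp (by fun_prop)
  rw [intervalIntegral.integral_eq_sub_of_hasDerivAt (fun t _ => h1 t) (hc.intervalIntegrable 0 1)]
  simp

/-- The average of the derivative of `f` in the direction `v` over the segment from `0` to `r`. -/
def segmentAverage {E : Type} [NormedAddCommGroup E] [NormedSpace ℝ E] [FiniteDimensional ℝ E]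
    (f : Smooth E) (v : E) : Smooth E :=
  ⟨fun r => ∫ t in (0 : ℝ)..1, fderiv ℝ f.1 (t • r) v,
    contDiff_integral 0 1 (fun s : E × ℝ => fderiv ℝ f.1 (s.2 • s.1) v)
      ((contDiff_fderiv_const_apply f.2 v).comp (contDiff_snd.smul contDiff_fst))⟩

theorem segmentAverage_apply {E : Type} [NormedAddCommGroup E] [NormedSpace ℝ E]
    [FiniteDimensional ℝ E] (f : Smooth E) (v r : E) :
    (segmentAverage f v).1 r = ∫ t in (0 : ℝ)..1, fderiv ℝ f.1 (t • r) v := rfl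

theorem segmentAverage_intervalIntegrable {E : Type} [NormedAddCommGroup E] [NormedSpace ℝ E]
    (f : Smooth E) (v r : E) :
    IntervalIntegrable (fun t : ℝ => fderiv ℝ f.1 (t • r) v) MeasureTheory.volume 0 1 :=
  ((contDiff_fderiv_const_apply f.2 v).continuous.comp
    (by fun_prop : Continuous fun t : ℝ => t • r)).intervalIntegrable 0 1

theorem apply_eq_add_sum_segmentAverage {E : Type} [NormedAddCommGroup E] [NormedSpace ℝ E]
    [FiniteDimensional ℝ E] (f : Smooth E) {ι : Type} (s : Finset ι) (v : ι → E) (c : ι → E → ℝ)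
    (hc : ∀ r, r = ∑ i ∈ s, c i r • v i) (r : E) :
    f.1 r = f.1 0 + ∑ i ∈ s, (c i r : ℂ) * (segmentAverage f (v i)).1 r := by
  rw [apply_eq_add_integral_fderiv f.2 r]
  congr 1
  have h1 : ∀ t : ℝ, fderiv ℝ f.1 (t • r) r =
      ∑ i ∈ s, (c i r : ℂ) * fderiv ℝ f.1 (t • r) (v i) := fun t => by
    have h2 := congrArg (fderiv ℝ f.1 (t • r)) (hc r)
    rw [map_sum] at h2
    refine h2.trans (Finset.sum_congr rfl fun i _ => ?_)
    rw [map_smul, Complex.real_smul]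
  simp_rw [h1]
  rw [intervalIntegral.integral_finsetSum fun i _ =>
    (segmentAverage_intervalIntegrable f (v i) r).const_mul _]
  refine Finset.sum_congr rfl fun i _ => ?_
  rw [intervalIntegral.integral_const_mul, segmentAverage_apply]

theorem segmentAverage_neg {E : Type} [NormedAddCommGroup E] [NormedSpace ℝ E]
    [FiniteDimensional ℝ E] {f : Smooth E} (hf : ∀ r, f.1 (-r) = f.1 r) (v r : E) :
    (segmentAverage f v).1 (-r) = -(segmentAverage f v).1 r := by
  rw [segmentAverage_apply, segmentAverage_apply, ← intervalIntegral.integral_neg]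
  refine intervalIntegral.integral_congr fun t _ => ?_
  have h := fderiv_neg_of_parity f.2 (c := 1) (fun r => (hf r).trans (one_mul _).symm) (t • r) v
  simpa using h

theorem plane_eq_sum (r : Plane) :
    r = ∑ i ∈ Finset.univ, (![r.1, r.2] : Fin 2 → ℝ) i • (![(1, 0), (0, 1)] : Fin 2 → Plane) i := by
  ext <;> simp

/-- Every odd smooth function is `∂/∂y` of an even one. -/
theorem exists_even_dy_eq {G : Smooth Plane} (hG : ∀ r, G.1 (-r) = -G.1 r) :
    ∃ a : EvenFun, ∀ p, dy a.1 p = G.1 p := by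
  let A : Plane → ℂ := fun p => (p.2 : ℂ) * ∫ t in (0 : ℝ)..1, G.1 (p.1, t * p.2)
  have hA : ContDiff ℝ ∞ A := (contDiff_ofReal.comp contDiff_snd).mul
    (contDiff_integral 0 1 (fun s : Plane × ℝ => G.1 (s.1.1, s.2 * s.1.2))
      ((Smooth.contDiff G).comp (by fun_prop)))
  refine ⟨⟨A, hA, fun p => ?_⟩, fun p => ?_⟩
  · have h : ∀ t : ℝ, G.1 ((-p).1, t * (-p).2) = -G.1 (p.1, t * p.2) := fun t => by
      rw [← hG]
      simp
    simp only [A, h, intervalIntegral.integral_neg]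
    simp
  · have h1 : ∀ y : ℝ, A (p.1, y) = ∫ s in (0 : ℝ)..y, G.1 (p.1, s) := fun y => by
      have := intervalIntegral.smul_integral_comp_mul_right (a := 0) (b := 1)
        (fun s => G.1 (p.1, s)) y
      rw [zero_mul, one_mul, Complex.real_smul] at this
      exact this
    have hc : Continuous fun s : ℝ => G.1 (p.1, s) :=
      (Smooth.contDiff G).continuous.comp (by fun_prop)
    have h2 : HasDerivAt (fun y : ℝ => A (p.1, y)) (G.1 (p.1, p.2)) p.2 := by
      simp_rw [h1]
      exact intervalIntegral.integral_hasDerivAt_right (hc.intervalIntegrable _ _)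
        (hc.stronglyMeasurableAtFilter _ _) hc.continuousAt
    exact fderiv_apply_eq_deriv hA ((hasDerivAt_const p.2 p.1).prodMk (hasDerivAt_id p.2)) h2

/-- Every odd smooth function is `∂/∂x` of an even one. -/
theorem exists_even_dx_eq {G : Smooth Plane} (hG : ∀ r, G.1 (-r) = -G.1 r) :
    ∃ a : EvenFun, ∀ p, dx a.1 p = G.1 p := by
  let A : Plane → ℂ := fun p => (p.1 : ℂ) * ∫ t in (0 : ℝ)..1, G.1 (t * p.1, p.2)
  have hA : ContDiff ℝ ∞ A := (contDiff_ofReal.comp contDiff_fst).mul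
    (contDiff_integral 0 1 (fun s : Plane × ℝ => G.1 (s.2 * s.1.1, s.1.2))
      ((Smooth.contDiff G).comp (by fun_prop)))
  refine ⟨⟨A, hA, fun p => ?_⟩, fun p => ?_⟩
  · have h : ∀ t : ℝ, G.1 (t * (-p).1, (-p).2) = -G.1 (t * p.1, p.2) := fun t => by
      rw [← hG]
      simp
    simp only [A, h, intervalIntegral.integral_neg]
    simp
  · have h1 : ∀ x : ℝ, A (x, p.2) = ∫ s in (0 : ℝ)..x, G.1 (s, p.2) := fun x => by
      have := intervalIntegral.smul_integral_comp_mul_right (a := 0) (b := 1)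
        (fun s => G.1 (s, p.2)) x
      rw [zero_mul, one_mul, Complex.real_smul] at this
      exact this
    have hc : Continuous fun s : ℝ => G.1 (s, p.2) :=
      (Smooth.contDiff G).continuous.comp (by fun_prop)
    have h2 : HasDerivAt (fun x : ℝ => A (x, p.2)) (G.1 (p.1, p.2)) p.1 := by
      simp_rw [h1]
      exact intervalIntegral.integral_hasDerivAt_right (hc.intervalIntegrable _ _)
        (hc.stronglyMeasurableAtFilter _ _) hc.continuousAt
    exact fderiv_apply_eq_deriv hA ((hasDerivAt_id p.1).prodMk (hasDerivAt_const p.1 p.2)) h2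

/-- An even function is the sum of its value at the origin and of images of even functions under the
vector fields `y ∂/∂x` and `x ∂/∂y`. -/
theorem exists_eq_add_dx_add_dy (f : EvenFun) : ∃ a g : EvenFun, ∀ p : Plane,
    f.1 p = f.1 0 + p.2 * dx g.1 p - p.1 * dy a.1 p := by
  let F : Smooth Plane := ⟨f.1, f.2.1⟩
  have hF : ∀ r, F.1 (-r) = F.1 r := f.2.2
  obtain ⟨a, ha⟩ := exists_even_dy_eq (segmentAverage_neg hF (1, 0))
  obtain ⟨g, hg⟩ := exists_even_dx_eq (segmentAverage_neg hF (0, 1))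
  refine ⟨-a, g, fun p => ?_⟩
  have h := apply_eq_add_sum_segmentAverage F Finset.univ (![(1, 0), (0, 1)] : Fin 2 → Plane)
    (fun i r => (![r.1, r.2] : Fin 2 → ℝ) i) plane_eq_sum p
  simp only [Fin.sum_univ_two, Matrix.cons_val_zero, Matrix.cons_val_one] at h
  rw [← ha, ← hg] at h
  have h2 : dy (-a : EvenFun).1 p = -dy a.1 p := by
    change fderiv ℝ (-a.1) p (0, 1) = _
    rw [fderiv_neg]
    rfl
  rw [h2]
  change f.1 p = _ at h
  rw [h]
  change f.1 0 + _ = _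
  ring

/-! ### Functions vanishing to high order at the origin -/

section Vanish

variable {E E' : Type} [NormedAddCommGroup E] [NormedSpace ℝ E] [NormedAddCommGroup E']
  [NormedSpace ℝ E']



theorem Vanish.add {m : ℕ} {f g : E → ℂ} (hf : ContDiff ℝ ∞ f) (hg : ContDiff ℝ ∞ g)
    (h : Vanish m f) (h' : Vanish m g) : Vanish m (f + g) := by
  induction m generalizing f g with
  | zero => trivial
  | succ m ih =>
    refine ⟨by simp [h.1, h'.1], fun v => ?_⟩
    have e1 : (fun r => fderiv ℝ (f + g) r v) =
        (fun r => fderiv ℝ f r v) + fun r => fderiv ℝ g r v := funext fun r => by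
      rw [fderiv_add (hf.differentiable (by simp) r) (hg.differentiable (by simp) r)]
      rfl
    rw [e1]
    exact ih (contDiff_fderiv_const_apply hf v) (contDiff_fderiv_const_apply hg v) (h.2 v) (h'.2 v)

theorem Vanish.const_smul {m : ℕ} {f : E → ℂ} (hf : ContDiff ℝ ∞ f) (h : Vanish m f) (c : ℂ) :
    Vanish m (c • f) := by
  induction m generalizing f with
  | zero => trivial
  | succ m ih =>
    refine ⟨by simp [h.1], fun v => ?_⟩
    have e1 : (fun r => fderiv ℝ (c • f) r v) = c • fun r => fderiv ℝ f r v := funext fun r => by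
      rw [fderiv_const_smul (hf.differentiable (by simp) r)]
      rfl
    rw [e1]
    exact ih (contDiff_fderiv_const_apply hf v) (h.2 v)

theorem vanish_zero (m : ℕ) : Vanish m (0 : E → ℂ) := by
  induction m with
  | zero => trivial
  | succ m ih =>
    refine ⟨rfl, fun v => ?_⟩
    have e1 : (fun r : E => fderiv ℝ (0 : E → ℂ) r v) = 0 := funext fun r => by simp
    rw [e1]
    exact ih

theorem Vanish.comp_clm {m : ℕ} {f : E → ℂ} (hf : ContDiff ℝ ∞ f) (h : Vanish m f)
    (L : E' →L[ℝ] E) : Vanish m (f ∘ L) := by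
  induction m generalizing f with
  | zero => trivial
  | succ m ih =>
    refine ⟨by simp [h.1], fun v => ?_⟩
    have e1 : (fun r => fderiv ℝ (f ∘ L) r v) = (fun r => fderiv ℝ f r (L v)) ∘ L :=
      funext fun r => by
        rw [fderiv_comp r (hf.differentiable (by simp) _) L.differentiableAt, L.fderiv]
        rfl
    rw [e1]
    exact ih (contDiff_fderiv_const_apply hf (L v)) (h.2 (L v))

theorem Vanish.clm_mul {m : ℕ} {f : E → ℂ} (hf : ContDiff ℝ ∞ f) (h : Vanish m f)
    (L : E →L[ℝ] ℝ) : Vanish (m + 1) (fun r => (L r : ℂ) * f r) := by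
  have hL : ContDiff ℝ ∞ fun r => (L r : ℂ) := contDiff_ofReal.comp L.contDiff
  have e1 : ∀ {f : E → ℂ}, ContDiff ℝ ∞ f → ∀ v, (fun r => fderiv ℝ (fun r => (L r : ℂ) * f r) r v) =
      (fun r => (L r : ℂ) * fderiv ℝ f r v) + (L v : ℂ) • f := fun {f} hf v => funext fun r => by
    have h1 : HasFDerivAt (fun r => (L r : ℂ)) (Complex.ofRealCLM.comp L) r :=
      (Complex.ofRealCLM.comp L).hasFDerivAt
    rw [(h1.fun_mul (hf.differentiable (by simp) r).hasFDerivAt).fderiv]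
    simp [mul_comm]
  induction m generalizing f with
  | zero => exact ⟨by simp, fun v => trivial⟩
  | succ m ih =>
    refine ⟨by simp, fun v => ?_⟩
    rw [e1 hf]
    exact (ih (contDiff_fderiv_const_apply hf v) (h.2 v)).add
      (hL.mul (contDiff_fderiv_const_apply hf v)) (hf.const_smul (L v : ℂ)) (h.const_smul hf _)

theorem fderiv_partial {G : E × ℝ → ℂ} (hG : ContDiff ℝ ∞ G) (r v : E) (t : ℝ) :
    fderiv ℝ (fun r => G (r, t)) r v = fderiv ℝ G (r, t) (v, 0) := by
  have h : HasFDerivAt (fun r => G (r, t))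
      ((fderiv ℝ G (r, t)).comp (ContinuousLinearMap.inl ℝ E ℝ)) r :=
    (hG.differentiable (by simp) (r, t)).hasFDerivAt.comp r (hasFDerivAt_prodMk_left r t)
  rw [h.fderiv]
  rfl

theorem fderiv_integral_apply [FiniteDimensional ℝ E] {a b : ℝ} {G : E × ℝ → ℂ}
    (hG : ContDiff ℝ ∞ G) (r v : E) : fderiv ℝ (fun r => ∫ t in a..b, G (r, t)) r v =
      ∫ t in a..b, fderiv ℝ (fun r => G (r, t)) r v := by
  let G' : E × ℝ → E →L[ℝ] ℂ := fun q => (fderiv ℝ G q).comp (ContinuousLinearMap.inl ℝ E ℝ)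
  have hG' : Continuous G' :=
    ((hG.fderiv_right (m := ∞) (by simp)).clm_comp contDiff_const).continuous
  obtain ⟨C, hC⟩ := ((isCompact_closedBall r 1).prod
    (isCompact_uIcc (a := a) (b := b))).bddAbove_image hG'.norm.continuousOn
  have hG'r : Continuous fun t : ℝ => G' (r, t) := hG'.comp (by fun_prop)
  have key : HasFDerivAt (fun r => ∫ t in a..b, G (r, t)) (∫ t in a..b, G' (r, t)) r := by
    refine (intervalIntegral.hasFDerivAt_integral_of_dominated_of_fderiv_le
      (F := fun p t => G (p, t)) (F' := fun p t => G' (p, t))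
      (bound := fun _ => C) (Metric.ball_mem_nhds r one_pos) ?_ ?_ ?_ ?_ ?_ ?_)
    · refine Filter.Eventually.of_forall fun x => ?_
      exact (hG.continuous.comp (by fun_prop : Continuous fun t : ℝ => (x, t))).aestronglyMeasurable
    · exact (hG.continuous.comp
        (by fun_prop : Continuous fun t : ℝ => (r, t))).intervalIntegrable a b
    · exact hG'r.aestronglyMeasurable
    · refine Filter.Eventually.of_forall fun t ht x hx => ?_
      exact hC ⟨(x, t), ⟨Metric.ball_subset_closedBall hx, Set.uIoc_subset_uIcc ht⟩, rfl⟩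
    · exact intervalIntegrable_const
    · refine Filter.Eventually.of_forall fun t _ x _ => ?_
      exact (hG.differentiable (by simp) (x, t)).hasFDerivAt.comp x (hasFDerivAt_prodMk_left x t)
  rw [key.fderiv, ContinuousLinearMap.intervalIntegral_apply (hG'r.intervalIntegrable a b)]
  exact intervalIntegral.integral_congr fun t _ => (fderiv_partial hG r v t).symm

theorem Vanish.integral [FiniteDimensional ℝ E] {a b : ℝ} {m : ℕ} {G : E × ℝ → ℂ}
    (hG : ContDiff ℝ ∞ G) (h : ∀ t, Vanish m fun r => G (r, t)) :
    Vanish m fun r => ∫ t in a..b, G (r, t) := by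
  induction m generalizing G with
  | zero => trivial
  | succ m ih =>
    refine ⟨by simp [(h _).1], fun v => ?_⟩
    simp_rw [fderiv_integral_apply hG]
    have h2 := ih (G := fun s => fderiv ℝ G s (v, 0)) (contDiff_fderiv_const_apply hG _) fun t => by
      have := (h t).2 v
      simp_rw [fderiv_partial hG] at this
      exact this
    simp_rw [fderiv_partial hG]
    exact h2

theorem taylor_eq_zero_of_vanish {f : Plane → ℂ} {i j m : ℕ} (hm : i + j < m) (h : Vanish m f) :
    taylor f i j = 0 := by
  have hy : ∀ j, j < m → Vanish (m - j) (dy^[j] f) := by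
    intro j hj
    induction j with
    | zero => exact h
    | succ j ih =>
      have h1 := ih (by omega)
      rw [show m - j = m - (j + 1) + 1 by omega] at h1
      rw [Function.iterate_succ_apply']
      exact h1.2 _
  have hx : ∀ i, i + j < m → Vanish (m - j - i) (dx^[i] (dy^[j] f)) := by
    intro i hi
    induction i with
    | zero => exact hy j (by omega)
    | succ i ih =>
      have h1 := ih (by omega)
      rw [show m - j - i = m - j - (i + 1) + 1 by omega] at h1
      rw [Function.iterate_succ_apply']
      exact h1.2 _
  have h1 := hx i hm
  rw [show m - j - i = m - j - i - 1 + 1 by omega] at h1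
  rw [taylor, h1.1, zero_div]

end Vanish

/-! ### Monomials in two points and the operators of the star product -/

/-- The function `x₁ᵃ y₁ᵇ x₂ᶜ y₂ᵈ`. -/
def monFun₂ (a b c d : ℕ) (r : Plane × Plane) : ℂ := monFun a b r.1 * monFun c d r.2

theorem contDiff_monFun₂ (a b c d : ℕ) : ContDiff ℝ ∞ (monFun₂ a b c d) :=
  ((contDiff_monFun a b).comp contDiff_fst).mul ((contDiff_monFun c d).comp contDiff_snd)

/-- The monomial `x₁ᵃ y₁ᵇ x₂ᶜ y₂ᵈ` as a smooth function. -/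
def mon₂ (a b c d : ℕ) : Smooth₂ := ⟨monFun₂ a b c d, contDiff_monFun₂ a b c d⟩

theorem mon₂_apply (a b c d : ℕ) (x₁ y₁ x₂ y₂ : ℝ) : (mon₂ a b c d).1 ((x₁, y₁), (x₂, y₂)) =
    (x₁ : ℂ) ^ a * (y₁ : ℂ) ^ b * ((x₂ : ℂ) ^ c * (y₂ : ℂ) ^ d) := rfl

theorem fderiv_mon₂_y₁ (a b c d : ℕ) (x₁ y₁ x₂ y₂ : ℝ) :
    fderiv ℝ (mon₂ a b c d).1 ((x₁, y₁), (x₂, y₂)) ((0, 1), (0, 0)) =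
      b * (mon₂ a (b - 1) c d).1 ((x₁, y₁), (x₂, y₂)) := by
  refine fderiv_apply_eq_deriv (mon₂ a b c d).2
    (((hasDerivAt_const y₁ x₁).prodMk (hasDerivAt_id y₁)).prodMk (hasDerivAt_const y₁ (x₂, y₂))) ?_
  have h := ((hasDerivAt_ofReal_pow b y₁).const_mul ((x₁ : ℂ) ^ a)).mul_const
    ((x₂ : ℂ) ^ c * (y₂ : ℂ) ^ d)
  have e : (b : ℂ) * (mon₂ a (b - 1) c d).1 ((x₁, y₁), (x₂, y₂)) =
      (x₁ : ℂ) ^ a * (b * (y₁ : ℂ) ^ (b - 1)) * ((x₂ : ℂ) ^ c * (y₂ : ℂ) ^ d) := by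
    rw [mon₂_apply]
    ring
  rw [e]
  exact h

theorem fderiv_mon₂_x₂ (a b c d : ℕ) (x₁ y₁ x₂ y₂ : ℝ) :
    fderiv ℝ (mon₂ a b c d).1 ((x₁, y₁), (x₂, y₂)) ((0, 0), (1, 0)) =
      c * (mon₂ a b (c - 1) d).1 ((x₁, y₁), (x₂, y₂)) := by
  refine fderiv_apply_eq_deriv (mon₂ a b c d).2
    ((hasDerivAt_const x₂ (x₁, y₁)).prodMk ((hasDerivAt_id x₂).prodMk (hasDerivAt_const x₂ y₂))) ?_
  have h := ((hasDerivAt_ofReal_pow c x₂).mul_const ((y₂ : ℂ) ^ d)).const_mul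
    ((x₁ : ℂ) ^ a * (y₁ : ℂ) ^ b)
  have e : (c : ℂ) * (mon₂ a b (c - 1) d).1 ((x₁, y₁), (x₂, y₂)) =
      (x₁ : ℂ) ^ a * (y₁ : ℂ) ^ b * (c * (x₂ : ℂ) ^ (c - 1) * (y₂ : ℂ) ^ d) := by
    rw [mon₂_apply]
    ring
  rw [e]
  exact h

theorem opPartial_mon₂ (a b c d : ℕ) :
    opPartial (mon₂ a b c d) = (c : ℂ) • mon₂ a b (c - 1) d :=
  Subtype.ext <| funext fun r => fderiv_mon₂_x₂ a b c d r.1.1 r.1.2 r.2.1 r.2.2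

theorem opDelta_apply (F : Smooth₂) (x₁ y₁ x₂ y₂ : ℝ) : (opDelta F).1 ((x₁, y₁), (x₂, y₂)) =
    ∫ t in (0 : ℝ)..1, fderiv ℝ F.1 ((x₁, y₂ + t * (y₁ - y₂)), (x₂, y₂)) ((0, 1), (0, 0)) := rfl

theorem opDunkl_apply (F : Smooth₂) (x₁ y₁ x₂ y₂ : ℝ) : (opDunkl F).1 ((x₁, y₁), (x₂, y₂)) =
    ∫ t in (-1 : ℝ)..1, fderiv ℝ F.1 ((x₁, y₁), (t * x₂, -y₂)) ((0, 0), (1, 0)) := rfl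

theorem opDunkl_mon₂ (a b c d : ℕ) :
    opDunkl (mon₂ a b c d) = ((-1) ^ d * (1 - (-1) ^ c) : ℂ) • mon₂ a b (c - 1) d := by
  refine Subtype.ext <| funext fun r => ?_
  obtain ⟨⟨x₁, y₁⟩, ⟨x₂, y₂⟩⟩ := r
  change _ = ((-1) ^ d * (1 - (-1) ^ c) : ℂ) * (mon₂ a b (c - 1) d).1 ((x₁, y₁), (x₂, y₂))
  rw [opDunkl_apply]
  simp_rw [fderiv_mon₂_x₂]
  cases c with
  | zero => simp
  | succ c =>
    have h1 : ∀ t : ℝ, ((c + 1 : ℕ) : ℂ) * (mon₂ a b (c + 1 - 1) d).1 ((x₁, y₁), (t * x₂, -y₂)) =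
        ((c + 1 : ℂ) * ((-1) ^ d * (mon₂ a b c d).1 ((x₁, y₁), (x₂, y₂)))) * ((t ^ c : ℝ) : ℂ) :=
      fun t => by
        rw [mon₂_apply, mon₂_apply, neg_eq_neg_one_mul y₂]
        push_cast
        ring
    simp_rw [h1]
    rw [intervalIntegral.integral_const_mul, intervalIntegral.integral_ofReal, integral_pow]
    have h2 : (c + 1 : ℂ) ≠ 0 := by exact_mod_cast c.succ_ne_zero
    rw [add_tsub_cancel_right]
    push_cast
    field_simp
    ring

/-- The integral defining `δ` is a difference quotient. -/
theorem sub_mul_opDelta (F : Smooth₂) (x₁ y₁ x₂ y₂ : ℝ) :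
    ((y₁ : ℂ) - y₂) * (opDelta F).1 ((x₁, y₁), (x₂, y₂)) =
      F.1 ((x₁, y₁), (x₂, y₂)) - F.1 ((x₁, y₂), (x₂, y₂)) := by
  have hF : ContDiff ℝ ∞ F.1 := F.2
  have hd : ∀ s : ℝ, HasDerivAt (fun s : ℝ => F.1 ((x₁, s), (x₂, y₂)))
      (fderiv ℝ F.1 ((x₁, s), (x₂, y₂)) ((0, 1), (0, 0))) s := fun s =>
    (hF.differentiable (by simp) ((x₁, s), (x₂, y₂))).hasFDerivAt.comp_hasDerivAt s
      (((hasDerivAt_const s x₁).prodMk (hasDerivAt_id s)).prodMk (hasDerivAt_const s (x₂, y₂)))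
  have hc : Continuous fun s : ℝ => fderiv ℝ F.1 ((x₁, s), (x₂, y₂)) ((0, 1), (0, 0)) :=
    (contDiff_fderiv_apply F.2 _).continuous.comp (by fun_prop)
  rw [← intervalIntegral.integral_eq_sub_of_hasDerivAt (fun t _ => hd t)
    (hc.intervalIntegrable _ _), opDelta_apply]
  have := intervalIntegral.smul_integral_comp_add_mul (a := 0) (b := 1)
    (fun s => fderiv ℝ F.1 ((x₁, s), (x₂, y₂)) ((0, 1), (0, 0))) (y₁ - y₂) y₂
  rw [mul_zero, mul_one, add_zero, add_sub_cancel, Complex.real_smul] at this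
  rw [← this]
  push_cast
  congr 1
  refine intervalIntegral.integral_congr fun t _ => ?_
  simp only [mul_comm]

theorem opDelta_mon₂ (a b c d : ℕ) : opDelta (mon₂ a b c d) =
    ∑ i ∈ Finset.range b, mon₂ a i c (d + (b - 1 - i)) := by
  refine Subtype.ext <| funext fun r => ?_
  obtain ⟨⟨x₁, y₁⟩, ⟨x₂, y₂⟩⟩ := r
  rw [AddSubmonoidClass.coe_finsetSum, Finset.sum_apply]
  have h1 : ∀ i ∈ Finset.range b, (mon₂ a i c (d + (b - 1 - i))).1 ((x₁, y₁), (x₂, y₂)) =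
      ((x₁ : ℂ) ^ a * (x₂ : ℂ) ^ c * (y₂ : ℂ) ^ d) * ((y₁ : ℂ) ^ i * (y₂ : ℂ) ^ (b - 1 - i)) :=
    fun i _ => by rw [mon₂_apply]; ring
  rw [Finset.sum_congr rfl h1, ← Finset.mul_sum]
  by_cases h : y₁ = y₂
  · subst h
    have h2 : ∀ i ∈ Finset.range b, (y₁ : ℂ) ^ i * (y₁ : ℂ) ^ (b - 1 - i) = (y₁ : ℂ) ^ (b - 1) :=
      fun i hi => by
        rw [← pow_add, Nat.add_sub_of_le]
        have := Finset.mem_range.1 hi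
        omega
    rw [Finset.sum_congr rfl h2, opDelta_apply]
    simp only [sub_self, mul_zero, add_zero, intervalIntegral.integral_const, fderiv_mon₂_y₁,
      Finset.sum_const, Finset.card_range, sub_zero, one_smul, mon₂_apply]
    rw [nsmul_eq_mul]
    ring
  · have h2 : (y₁ : ℂ) - y₂ ≠ 0 := sub_ne_zero.2 fun hc => h (Complex.ofReal_injective hc)
    refine mul_left_cancel₀ h2 ?_
    rw [sub_mul_opDelta, mul_left_comm, mul_comm ((y₁ : ℂ) - y₂), geom_sum₂_mul, mon₂_apply,
      mon₂_apply]
    ring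

/-- The recursion that splits off the factor of `((∂ + ħ₂ D) δ)ᵏ` which is applied first, whereas the
definition of `opPow` splits off the last one. -/
theorem opPow_succ_zero_apply (k : ℕ) (F : Smooth₂) :
    opPow (k + 1) 0 F = opPow k 0 (opPartial (opDelta F)) := by
  induction k with
  | zero => rfl
  | succ k ih =>
    change opPartial (opDelta (opPow (k + 1) 0 F)) = _
    rw [ih]
    rfl

theorem opPow_succ_succ_apply (k l : ℕ) (F : Smooth₂) : opPow (k + 1) (l + 1) F =
    opPow k (l + 1) (opPartial (opDelta F)) + opPow k l (opDunkl (opDelta F)) := by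
  induction k generalizing l with
  | zero =>
    change opPartial (opDelta (opPow 0 (l + 1) F)) + opDunkl (opDelta (opPow 0 l F)) = _
    cases l with
    | zero => simp [opPow]
    | succ l => simp [opPow]
  | succ k ih =>
    change opPartial (opDelta (opPow (k + 1) (l + 1) F)) +
      opDunkl (opDelta (opPow (k + 1) l F)) = _
    rw [ih]
    cases l with
    | zero =>
      rw [opPow_succ_zero_apply]
      simp only [map_add]
      change _ = opPartial (opDelta (opPow k 1 _)) + opDunkl (opDelta (opPow k 0 _)) +
        opPartial (opDelta (opPow k 0 _))
      abel
    | succ l =>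
      rw [ih]
      simp only [map_add]
      change _ = opPartial (opDelta (opPow k (l + 2) _)) + opDunkl (opDelta (opPow k (l + 1) _)) +
        (opPartial (opDelta (opPow k (l + 1) _)) + opDunkl (opDelta (opPow k l _)))
      abel

/-- The coefficient of `ħ₂ⁿ ħ₁ᵐ` in `∑ₖ (ħ₁ / 2)ᵏ ((∂ + ħ₂ D) δ)ᵏ F`, evaluated at `(p, p)`. -/
def diagCoeff (n m : ℤ) (p : Plane) : Smooth₂ →ₗ[ℂ] ℂ where
  toFun F := if 0 ≤ n ∧ 0 ≤ m then (1 / 2) ^ m.toNat * (opPow m.toNat n.toNat F).1 (p, p) else 0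
  map_add' F G := by
    split_ifs
    · rw [map_add, ← mul_add]
      rfl
    · rw [add_zero]
  map_smul' c F := by
    split_ifs
    · rw [map_smul]
      change _ * (c * _) = c * _
      ring
    · rw [smul_zero]

theorem diagCoeff_of_neg {n m : ℤ} (h : ¬(0 ≤ n ∧ 0 ≤ m)) (p : Plane) (F : Smooth₂) :
    diagCoeff n m p F = 0 := if_neg h

theorem diagCoeff_natCast (n m : ℕ) (p : Plane) (F : Smooth₂) :
    diagCoeff n m p F = (1 / 2) ^ m * (opPow m n F).1 (p, p) :=
  (if_pos ⟨Int.natCast_nonneg n, Int.natCast_nonneg m⟩ :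
    (if 0 ≤ (n : ℤ) ∧ 0 ≤ (m : ℤ) then
      (1 / 2) ^ (m : ℤ).toNat * (opPow (m : ℤ).toNat (n : ℤ).toNat F).1 (p, p) else 0) = _)

/-- The recursion in `k` for `∑ₖ (ħ₁ / 2)ᵏ ((∂ + ħ₂ D) δ)ᵏ F`, coefficientwise. -/
theorem diagCoeff_eq (n m : ℤ) (p : Plane) (F : Smooth₂) : diagCoeff n m p F =
    (if n = 0 ∧ m = 0 then F.1 (p, p) else 0) +
      1 / 2 * (diagCoeff n (m - 1) p (opPartial (opDelta F)) +
        diagCoeff (n - 1) (m - 1) p (opDunkl (opDelta F))) := by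
  by_cases h : 0 ≤ n ∧ 0 ≤ m
  · obtain ⟨n, rfl⟩ := Int.eq_ofNat_of_zero_le h.1
    obtain ⟨m, rfl⟩ := Int.eq_ofNat_of_zero_le h.2
    cases m with
    | zero =>
      rw [diagCoeff_natCast, diagCoeff_of_neg (n := (n : ℤ)) (m := (0 : ℕ) - 1) (by omega),
        diagCoeff_of_neg (n := (n : ℤ) - 1) (m := (0 : ℕ) - 1) (by omega)]
      cases n with
      | zero => simp [opPow]
      | succ n =>
        rw [if_neg (by omega)]
        simp [opPow]
    | succ m =>
      rw [if_neg (by omega), show ((m + 1 : ℕ) : ℤ) - 1 = m by push_cast; ring,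
        diagCoeff_natCast, diagCoeff_natCast]
      cases n with
      | zero =>
        rw [diagCoeff_of_neg (by omega), opPow_succ_zero_apply]
        ring
      | succ n =>
        rw [show ((n + 1 : ℕ) : ℤ) - 1 = n by push_cast; ring, diagCoeff_natCast,
          opPow_succ_succ_apply]
        change _ * ((opPow m (n + 1) _).1 (p, p) + (opPow m n _).1 (p, p)) = _
        ring
  · rw [diagCoeff_of_neg h, if_neg (by omega), diagCoeff_of_neg (by omega),
      diagCoeff_of_neg (by omega)]
    ring

/-- The value at `p` of a polynomial with coefficients in `K`. -/
def evalAt (p : Plane) : MvPolynomial (Fin 2) K →+* K :=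
  MvPolynomial.eval ![const (p.1 : ℂ), const (p.2 : ℂ)]

theorem evalAt_smul (p : Plane) (c : K) (g : MvPolynomial (Fin 2) K) :
    evalAt p (c • g) = c * evalAt p g := MvPolynomial.smul_eval _ _ _

theorem evalAt_mon (p : Plane) (a b : ℕ) : evalAt p (mon a b) = const (monFun a b p) := by
  rw [evalAt, mon, MvPolynomial.eval_monomial, one_mul,
    Finsupp.prod_add_index' (by simp) (by intros; rw [pow_add]), Finsupp.prod_single_index (by simp),
    Finsupp.prod_single_index (by simp)]
  simp [monFun, const_mul, const_pow]

theorem pow_eq_pow_add_sum {R : Type} [Ring R] (A B : R) (b : ℕ) :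
    A ^ b = B ^ b + ∑ i ∈ Finset.range b, A ^ i * ((A - B) * B ^ (b - 1 - i)) := by
  induction b with
  | zero => simp
  | succ b ih =>
    have h1 : ∀ i ∈ Finset.range b, A ^ i * ((A - B) * B ^ (b + 1 - 1 - i)) =
        A ^ i * ((A - B) * B ^ (b - 1 - i)) * B := fun i hi => by
      have := Finset.mem_range.1 hi
      rw [show b + 1 - 1 - i = b - 1 - i + 1 by omega, pow_succ]
      simp only [mul_assoc]
    rw [Finset.sum_range_succ, Finset.sum_congr rfl h1, ← Finset.sum_mul,
      ← sub_eq_iff_eq_add'.2 ih]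
    simp only [add_tsub_cancel_right, Nat.sub_self, pow_zero, mul_one, pow_succ]
    noncomm_ring

theorem mulY_pow_mon (a b n : ℕ) : (mulY ^ n) (mon a b) = mon a (b + n) := by
  induction n with
  | zero => rfl
  | succ n ih => rw [pow_succ', Module.End.mul_apply, ih, mulY_mon, add_assoc]

theorem mulX_pow_mon (a b n : ℕ) : (mulX ^ n) (mon a b) = mon (a + n) b := by
  induction n with
  | zero => rfl
  | succ n ih => rw [pow_succ', Module.End.mul_apply, ih, mulX_mon, add_assoc]

/-- The powers of `y + (ħ₁ / 2) (∂ₓ + ħ₂ D)` satisfy the recursion of `diagCoeff_eq`: the divided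
difference of `y₁ᵇ` corresponds to the telescoping sum for the difference to multiplication by `yᵇ`. -/
theorem actY_pow_mon (b c d : ℕ) : (actY ^ b) (mon c d) = mon c (d + b) +
    (hbar₁ / 2) • ∑ i ∈ Finset.range b,
      (c + hbar₂ * ((-1) ^ (d + (b - 1 - i)) * parityFactor c)) •
        (actY ^ i) (mon (c - 1) (d + (b - 1 - i))) := by
  rw [pow_eq_pow_add_sum actY mulY b, LinearMap.add_apply, mulY_pow_mon, LinearMap.sum_apply,
    Finset.smul_sum]
  congr 1
  refine Finset.sum_congr rfl fun i _ => ?_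
  have h1 : actY - mulY = (hbar₁ / 2) • dunklOp := add_sub_cancel_left _ _
  rw [Module.End.mul_apply, Module.End.mul_apply, mulY_pow_mon, h1, LinearMap.smul_apply,
    map_smul, dunklOp_mon, map_smul]

/-- On monomials, the bidifferential operators of the star product are given by the product of the
symplectic reflection algebra. -/
theorem diagCoeff_mon₂ (p : Plane) (a b c d : ℕ) (n m : ℤ) :
    diagCoeff n m p (mon₂ a b c d) =
      (evalAt p ((mulX ^ a) ((actY ^ b) (mon c d)))).coeff n m := by
  induction b using Nat.strong_induction_on generalizing c d n m with
  | _ b ih =>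
    rw [diagCoeff_eq, actY_pow_mon]
    simp only [map_add, map_smul, map_sum, evalAt_smul, K.coeff_add, mulX_pow_mon, evalAt_mon,
      K.coeff_const]
    congr 1
    · refine if_congr Iff.rfl ?_ rfl
      change monFun a b p * monFun c d p = monFun (c + a) (d + b) p
      simp only [monFun]
      ring
    · have h2 : hbar₁ / 2 = const (1 / 2) * hbar₁ := by
        rw [← constHom_apply, map_div₀, map_one, map_ofNat]
        ring
      rw [h2, mul_assoc (const _) hbar₁, K.coeff_const_mul, K.coeff_hbar₁_mul, K.coeff_sum, opDelta_mon₂]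
      simp only [map_sum, opPartial_mon₂, opDunkl_mon₂, map_smul, smul_eq_mul]
      rw [← Finset.sum_add_distrib]
      congr 1
      refine Finset.sum_congr rfl fun i hi => ?_
      rw [ih i (Finset.mem_range.1 hi), ih i (Finset.mem_range.1 hi)]
      have h3 : (c + hbar₂ * ((-1) ^ (d + (b - 1 - i)) * parityFactor c) : K) =
          const c + const ((-1) ^ (d + (b - 1 - i)) * (1 - (-1) ^ c)) * hbar₂ := by
        simp only [← constHom_apply, map_mul, map_sub, map_pow, map_neg, map_one, map_natCast,
          parityFactor]
        ring
      rw [h3, add_mul, K.coeff_add, K.coeff_const_mul, mul_assoc (const _) hbar₂, K.coeff_const_mul,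
        K.coeff_hbar₂_mul]

/-! ### Functionals of finite order at the origin -/

theorem Vanish.pathIntegral {a b : ℝ} {v : Plane × Plane}
    {P : (Plane × Plane) × ℝ → Plane × Plane} {hP : ContDiff ℝ ∞ P}
    (hlin : ∀ t, IsLinearMap ℝ fun r => P (r, t)) {m : ℕ} {F : Smooth₂}
    (h : Vanish (m + 1) F.1) : Vanish m (pathIntegral a b v P hP F).1 := by
  refine Vanish.integral (G := fun s => fderiv ℝ F.1 (P s) v)
    ((contDiff_fderiv_apply F.2 v).comp hP) fun t => ?_
  exact (h.2 v).comp_clm (contDiff_fderiv_apply F.2 v)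
    (LinearMap.toContinuousLinearMap ((hlin t).mk' _))

theorem vanish_opPartial {m : ℕ} {F : Smooth₂} (h : Vanish (m + 1) F.1) :
    Vanish m (opPartial F).1 := h.2 _

theorem vanish_opDunkl {m : ℕ} {F : Smooth₂} (h : Vanish (m + 1) F.1) :
    Vanish m (opDunkl F).1 :=
  Vanish.pathIntegral (fun t => ⟨fun r s => by ext <;> simp <;> ring,
    fun c r => by ext <;> simp; ring⟩) h

theorem vanish_opDelta {m : ℕ} {F : Smooth₂} (h : Vanish (m + 1) F.1) :
    Vanish m (opDelta F).1 :=
  Vanish.pathIntegral (fun t => ⟨fun r s => by ext <;> simp; ring,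
    fun c r => by ext <;> simp; ring⟩) h

/-- Each of the operators `∂`, `D` and `δ` lowers the order of vanishing by at most one. -/
theorem vanish_opPow {k : ℕ} : ∀ {l m : ℕ} {F : Smooth₂}, Vanish (m + 2 * k) F.1 →
    Vanish m (opPow k l F).1 := by
  induction k with
  | zero =>
    intro l m F h
    cases l with
    | zero => exact h
    | succ l => exact vanish_zero m
  | succ k ih =>
    intro l m F h
    have h1 : ∀ l, Vanish (m + 1 + 1) (opPow k l F).1 := fun l =>
      ih (show Vanish (m + 1 + 1 + 2 * k) F.1 by
        rwa [show m + 1 + 1 + 2 * k = m + 2 * (k + 1) by ring])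
    cases l with
    | zero => exact vanish_opPartial (vanish_opDelta (h1 0))
    | succ l =>
      exact (vanish_opPartial (vanish_opDelta (h1 (l + 1)))).add
        (opPartial _).2 (opDunkl _).2 (vanish_opDunkl (vanish_opDelta (h1 l)))

theorem vanish_diagonal {m : ℕ} {F : Smooth₂} (h : Vanish m F.1) :
    Vanish m fun p : Plane => F.1 (p, p) :=
  h.comp_clm F.2 ((ContinuousLinearMap.id ℝ Plane).prod (ContinuousLinearMap.id ℝ Plane))

/-- The coordinate functions on `ℝ² × ℝ²`. -/
def coord : Fin 4 → (Plane × Plane →L[ℝ] ℝ) :=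
  ![(ContinuousLinearMap.fst ℝ ℝ ℝ).comp (ContinuousLinearMap.fst ℝ Plane Plane),
    (ContinuousLinearMap.snd ℝ ℝ ℝ).comp (ContinuousLinearMap.fst ℝ Plane Plane),
    (ContinuousLinearMap.fst ℝ ℝ ℝ).comp (ContinuousLinearMap.snd ℝ Plane Plane),
    (ContinuousLinearMap.snd ℝ ℝ ℝ).comp (ContinuousLinearMap.snd ℝ Plane Plane)]

/-- Multiplication by a coordinate function. -/
def mulCoord (i : Fin 4) : Smooth₂ →ₗ[ℂ] Smooth₂ where
  toFun F := ⟨fun r => (coord i r : ℂ) * F.1 r,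
    (contDiff_ofReal.comp (coord i).contDiff).mul (show ContDiff ℝ ∞ F.1 from F.2)⟩
  map_add' _ _ := Subtype.ext <| funext fun _ => mul_add _ _ _
  map_smul' _ _ := Subtype.ext <| funext fun _ => mul_left_comm _ _ _

/-- The polynomial functions on `ℝ² × ℝ²`. -/
def polynomials₂ : Submodule ℂ Smooth₂ :=
  Submodule.span ℂ (Set.range fun s : (ℕ × ℕ) × (ℕ × ℕ) => mon₂ s.1.1 s.1.2 s.2.1 s.2.2)

theorem mon₂_mem_polynomials₂ (a b c d : ℕ) : mon₂ a b c d ∈ polynomials₂ :=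
  Submodule.subset_span ⟨((a, b), (c, d)), rfl⟩

theorem mulCoord_mem_polynomials₂ (i : Fin 4) {F : Smooth₂} (hF : F ∈ polynomials₂) :
    mulCoord i F ∈ polynomials₂ := by
  have h : polynomials₂ ≤ polynomials₂.comap (mulCoord i) := by
    refine Submodule.span_le.2 ?_
    rintro _ ⟨⟨⟨a, b⟩, ⟨c, d⟩⟩, rfl⟩
    change mulCoord i (mon₂ a b c d) ∈ polynomials₂
    have key : ∀ {a' b' c' d' : ℕ}, (∀ x₁ y₁ x₂ y₂ : ℝ,
        (coord i ((x₁, y₁), (x₂, y₂)) : ℂ) * (mon₂ a b c d).1 ((x₁, y₁), (x₂, y₂)) =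
          (mon₂ a' b' c' d').1 ((x₁, y₁), (x₂, y₂))) → mulCoord i (mon₂ a b c d) ∈ polynomials₂ :=
      fun {a' b' c' d'} h => by
        have : mulCoord i (mon₂ a b c d) = mon₂ a' b' c' d' :=
          Subtype.ext <| funext fun r => h r.1.1 r.1.2 r.2.1 r.2.2
        rw [this]
        exact mon₂_mem_polynomials₂ _ _ _ _
    fin_cases i
    · refine key (a' := a + 1) (b' := b) (c' := c) (d' := d) fun x₁ y₁ x₂ y₂ => ?_
      rw [mon₂_apply, mon₂_apply]
      change (x₁ : ℂ) * _ = _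
      ring
    · refine key (a' := a) (b' := b + 1) (c' := c) (d' := d) fun x₁ y₁ x₂ y₂ => ?_
      rw [mon₂_apply, mon₂_apply]
      change (y₁ : ℂ) * _ = _
      ring
    · refine key (a' := a) (b' := b) (c' := c + 1) (d' := d) fun x₁ y₁ x₂ y₂ => ?_
      rw [mon₂_apply, mon₂_apply]
      change (x₂ : ℂ) * _ = _
      ring
    · refine key (a' := a) (b' := b) (c' := c) (d' := d + 1) fun x₁ y₁ x₂ y₂ => ?_
      rw [mon₂_apply, mon₂_apply]
      change (y₂ : ℂ) * _ = _
      ring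
  exact h hF

theorem eq_sum_coord (r : Plane × Plane) : r = ∑ i, coord i r •
    (![((1, 0), (0, 0)), ((0, 1), (0, 0)), ((0, 0), (1, 0)), ((0, 0), (0, 1))] :
      Fin 4 → Plane × Plane) i := by
  simp only [Fin.sum_univ_four]
  obtain ⟨⟨x₁, y₁⟩, ⟨x₂, y₂⟩⟩ := r
  change _ = x₁ • ((1, 0), (0, 0)) + y₁ • ((0, 1), (0, 0)) + x₂ • ((0, 0), (1, 0)) +
    y₂ • (((0, 0), (0, 1)) : Plane × Plane)
  ext <;> simp

/-- Taylor's theorem: up to a function that vanishes to order `m`, a smooth function is a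
polynomial. -/
theorem exists_vanish_sub_mem_polynomials₂ (m : ℕ) (F : Smooth₂) :
    ∃ P ∈ polynomials₂, Vanish m (F - P).1 := by
  induction m generalizing F with
  | zero => exact ⟨0, zero_mem _, trivial⟩
  | succ m ih =>
    let v : Fin 4 → Plane × Plane :=
      ![((1, 0), (0, 0)), ((0, 1), (0, 0)), ((0, 0), (1, 0)), ((0, 0), (0, 1))]
    have had := apply_eq_add_sum_segmentAverage (E := Plane × Plane) ⟨F.1, F.2⟩ Finset.univ v
      (fun i r => coord i r) eq_sum_coord
    let A : Fin 4 → Smooth₂ := fun i =>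
      ⟨(segmentAverage (E := Plane × Plane) ⟨F.1, F.2⟩ (v i)).1, Subtype.property _⟩
    choose Q hQ hQA using fun i => ih (A i)
    refine ⟨F.1 0 • mon₂ 0 0 0 0 + ∑ i, mulCoord i (Q i),
      add_mem (Submodule.smul_mem _ _ (mon₂_mem_polynomials₂ _ _ _ _))
        (sum_mem fun i _ => mulCoord_mem_polynomials₂ i (hQ i)), ?_⟩
    have e1 : F - (F.1 0 • mon₂ 0 0 0 0 + ∑ i, mulCoord i (Q i)) =
        ∑ i, mulCoord i (A i - Q i) := by
      have e2 : F = F.1 0 • mon₂ 0 0 0 0 + ∑ i, mulCoord i (A i) :=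
        Subtype.ext <| funext fun r => by
          change F.1 r = F.1 0 * (monFun 0 0 r.1 * monFun 0 0 r.2) + (∑ i, mulCoord i (A i)).1 r
          rw [AddSubmonoidClass.coe_finsetSum, Finset.sum_apply]
          simp only [monFun, pow_zero, mul_one]
          exact had r
      simp only [map_sub, Finset.sum_sub_distrib]
      nth_rewrite 1 [e2]
      abel
    rw [e1]
    have h1 : ∀ i, Vanish (m + 1) (mulCoord i (A i - Q i)).1 := fun i =>
      (hQA i).clm_mul (A i - Q i).2 (coord i)
    rw [Fin.sum_univ_four]
    exact (((h1 0).add (Subtype.property _) (Subtype.property _) (h1 1)).add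
      (Subtype.property _) (Subtype.property _) (h1 2)).add
      (Subtype.property _) (Subtype.property _) (h1 3)

/-- Precomposition with `(p, q) ↦ (s p, t q)`. -/
def rescale (s t : ℝ) : Smooth₂ →ₗ[ℂ] Smooth₂ where
  toFun F := ⟨fun r => F.1 (s • r.1, t • r.2),
    (show ContDiff ℝ ∞ F.1 from F.2).comp
      ((contDiff_fst.const_smul s).prodMk (contDiff_snd.const_smul t))⟩
  map_add' _ _ := rfl
  map_smul' _ _ := rfl

theorem rescale_mon₂ (s t : ℝ) (a b c d : ℕ) : rescale s t (mon₂ a b c d) =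
    ((s : ℂ) ^ (a + b) * (t : ℂ) ^ (c + d)) • mon₂ a b c d :=
  Subtype.ext <| funext fun r => by
    change (mon₂ a b c d).1 ((s * r.1.1, s * r.1.2), (t * r.2.1, t * r.2.2)) =
      ((s : ℂ) ^ (a + b) * (t : ℂ) ^ (c + d)) * (mon₂ a b c d).1 ((r.1.1, r.1.2), (r.2.1, r.2.2))
    rw [mon₂_apply, mon₂_apply]
    push_cast
    ring

theorem vanish_rescale (s t : ℝ) {m : ℕ} {F : Smooth₂} (h : Vanish m F.1) :
    Vanish m (rescale s t F).1 :=
  h.comp_clm F.2 ((s • ContinuousLinearMap.fst ℝ Plane Plane).prod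
    (t • ContinuousLinearMap.snd ℝ Plane Plane))

/-- A functional of finite order at the origin that vanishes on all monomials is zero. -/
theorem eq_zero_of_vanish_of_mon₂ (W : Smooth₂ →ₗ[ℂ] ℂ) (m : ℕ)
    (hvan : ∀ F : Smooth₂, Vanish m F.1 → W F = 0) (hmon : ∀ a b c d, W (mon₂ a b c d) = 0) :
    W = 0 := by
  ext F
  obtain ⟨P, hP, hFP⟩ := exists_vanish_sub_mem_polynomials₂ m F
  have h1 : polynomials₂ ≤ LinearMap.ker W := by
    refine Submodule.span_le.2 ?_
    rintro _ ⟨s, rfl⟩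
    exact hmon _ _ _ _
  have h2 := hvan _ hFP
  rw [map_sub, LinearMap.mem_ker.1 (h1 hP), sub_zero] at h2
  exact h2

/-- For functions that are even in both points, it suffices to consider monomials of even degree
in both points. -/
theorem apply_eq_zero_of_even_mon₂ (W : Smooth₂ →ₗ[ℂ] ℂ) (m : ℕ)
    (hvan : ∀ F : Smooth₂, Vanish m F.1 → W F = 0)
    (hmon : ∀ a b c d, Even (a + b) → Even (c + d) → W (mon₂ a b c d) = 0)
    (F : EvenFun₂) : W ⟨F.1, F.2.1⟩ = 0 := by
  -- averaging over the signs of the two points kills the remaining monomials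
  let V : Smooth₂ →ₗ[ℂ] ℂ := W ∘ₗ rescale 1 1 + W ∘ₗ rescale 1 (-1) + W ∘ₗ rescale (-1) 1 +
    W ∘ₗ rescale (-1) (-1)
  have hV : V = 0 := by
    refine eq_zero_of_vanish_of_mon₂ V m (fun F hF => ?_) fun a b c d => ?_
    · simp [V, hvan _ (vanish_rescale _ _ hF)]
    · simp only [V, LinearMap.add_apply, LinearMap.comp_apply, rescale_mon₂, map_smul, smul_eq_mul]
      by_cases h : Even (a + b) ∧ Even (c + d)
      · simp [hmon a b c d h.1 h.2]
      · push_cast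
        rw [not_and_or, Nat.not_even_iff_odd, Nat.not_even_iff_odd] at h
        rcases h with h | h
        · rw [h.neg_one_pow]
          ring
        · rw [h.neg_one_pow]
          ring
  have h1 : ∀ s t : ℝ, (∀ r : Plane × Plane, F.1 (s • r.1, t • r.2) = F.1 r) →
      rescale s t ⟨F.1, F.2.1⟩ = ⟨F.1, F.2.1⟩ := fun s t h => Subtype.ext <| funext h
  have h2 := LinearMap.congr_fun hV ⟨F.1, F.2.1⟩
  simp only [V, LinearMap.add_apply, LinearMap.comp_apply] at h2
  rw [h1 1 1 (by simp), h1 1 (-1) fun r => by simpa using (F.2.2 r.1 r.2).2,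
    h1 (-1) 1 fun r => by simpa using (F.2.2 r.1 r.2).1,
    h1 (-1) (-1) fun r => by simpa using ((F.2.2 r.1 (-r.2)).1).trans (F.2.2 r.1 r.2).2,
    LinearMap.zero_apply] at h2
  have h3 : (4 : ℂ) * W ⟨F.1, F.2.1⟩ = 0 := by
    rw [← h2]
    ring
  exact (mul_eq_zero.1 h3).resolve_left (by norm_num)

/-! ### Polynomial elements of the Dunkl-Weyl algebra -/

theorem Dunkl.ext {a b : Dunkl} (h : ∀ n m, a.coeff n m = b.coeff n m) : a = b :=
  HahnSeries.ext (funext fun n => HahnSeries.ext (funext fun m => h n m))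

/-- Evaluation of invariant functions at `p`. -/
def evalHom (p : Plane) : EvenFun →+* ℂ where
  toFun f := f.1 p
  map_one' := rfl
  map_mul' _ _ := rfl
  map_zero' := rfl
  map_add' _ _ := rfl

/-- Evaluation at `p` of series of invariant functions. -/
def evalDunkl (p : Plane) : Dunkl →ₗ[K] K where
  toFun := (laurentMap (laurentMap (evalHom p)) : Undeformed →+* LaurentSeries (LaurentSeries ℂ))
  map_add' := map_add (laurentMap (laurentMap (evalHom p)))
  map_smul' c a := by
    refine (map_mul (laurentMap (laurentMap (evalHom p))) (scalars c) a).trans ?_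
    congr 1

theorem coeff_evalDunkl (p : Plane) (a : Dunkl) (n m : ℤ) :
    (evalDunkl p a).coeff n m = (a.coeff n m).1 p := rfl

theorem eq_of_evalDunkl {a b : Dunkl} (h : ∀ p, evalDunkl p a = evalDunkl p b) : a = b :=
  Dunkl.ext fun n m => Subtype.ext <| funext fun p => by
    rw [← coeff_evalDunkl, ← coeff_evalDunkl, h]

theorem isPolynomial_iff {a : Dunkl} {f : MvPolynomial (Fin 2) K} :
    IsPolynomial a f ↔ ∀ p, evalDunkl p a = evalAt p f :=
  ⟨fun h p => K.ext fun n m => h p n m, fun h p n m => by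
    rw [← coeff_evalDunkl, h]
    rfl⟩

theorem isPolynomial_sum_smul {ι : Type} (s : Finset ι) (c : ι → K) {a : ι → Dunkl}
    {f : ι → MvPolynomial (Fin 2) K} (h : ∀ i ∈ s, IsPolynomial (a i) (f i)) :
    IsPolynomial (∑ i ∈ s, c i • a i) (∑ i ∈ s, c i • f i) := by
  refine isPolynomial_iff.2 fun p => ?_
  rw [map_sum, map_sum]
  refine Finset.sum_congr rfl fun i hi => ?_
  rw [map_smul, evalAt_smul, isPolynomial_iff.1 (h i hi) p, smul_eq_mul]

theorem evalAt_eq_sum (p : Plane) (f : MvPolynomial (Fin 2) K) :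
    evalAt p f = ∑ s ∈ f.support, f.coeff s * const (monFun (s 0) (s 1) p) := by
  conv_lhs => rw [sum_coeff_mon f]
  rw [map_sum]
  exact Finset.sum_congr rfl fun s _ => by rw [evalAt_smul, evalAt_mon]

/-- The Taylor coefficients of a polynomial function are the coefficients of the polynomial. -/
theorem taylor_eq_coeff {u : Plane → ℂ} {f : MvPolynomial (Fin 2) K} {n m : ℤ}
    (h : ∀ p, u p = (evalAt p f).coeff n m) (i j : ℕ) :
    taylor u i j = (f.coeff (expo i j)).coeff n m := by
  have e1 : u = (∑ s ∈ f.support, (f.coeff s).coeff n m • monSmooth (s 0) (s 1)).1 :=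
    funext fun p => by
      rw [h, evalAt_eq_sum, K.coeff_sum, AddSubmonoidClass.coe_finsetSum, Finset.sum_apply]
      refine Finset.sum_congr rfl fun s _ => ?_
      rw [mul_comm, K.coeff_const_mul, mul_comm]
      rfl
  have e2 : ∀ s : Fin 2 →₀ ℕ, taylorLM i j ((f.coeff s).coeff n m • monSmooth (s 0) (s 1)) =
      if s = expo i j then (f.coeff s).coeff n m else 0 := fun s => by
    rw [map_smul, taylorLM_apply]
    change (f.coeff s).coeff n m * taylor (monFun (s 0) (s 1)) i j = _
    rw [taylor_monFun]
    by_cases hs : s = expo i j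
    · rw [if_pos hs, if_pos (expo_injective ((expo_eta s).trans hs)), mul_one]
    · rw [if_neg hs, if_neg fun hc => hs (by rw [← expo_eta s, hc.1, hc.2]), mul_zero]
  rw [e1, ← taylorLM_apply, map_sum, Finset.sum_congr rfl fun s _ => e2 s, Finset.sum_ite_eq']
  split_ifs with hs
  · rfl
  · rw [MvPolynomial.notMem_support_iff.1 hs, K.coeff_zero]

theorem eq_of_evalAt {f g : MvPolynomial (Fin 2) K} (h : ∀ p, evalAt p f = evalAt p g) :
    f = g := by
  refine sub_eq_zero.1 (MvPolynomial.ext _ _ fun s => K.ext fun n m => ?_)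
  rw [← expo_eta s, ← taylor_eq_coeff (u := 0) (f := f - g) (n := n) (m := m) (fun p => by
    rw [map_sub, h, sub_self]
    rfl), taylor_zero, MvPolynomial.coeff_zero, K.coeff_zero]

/-- The inclusion of the invariant functions as constant series. -/
def emb (f : EvenFun) : Dunkl :=
  (HahnSeries.single 0 (HahnSeries.single 0 f) : LaurentSeries (LaurentSeries EvenFun))

theorem coeff_emb (f : EvenFun) (n m : ℤ) :
    (emb f).coeff n m = if n = 0 ∧ m = 0 then f else 0 := by
  change HahnSeries.coeff (HahnSeries.coeff (HahnSeries.single 0 (HahnSeries.single 0 f)) n) m = _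
  by_cases hn : n = 0 <;> by_cases hm : m = 0 <;> simp [hn, hm, HahnSeries.coeff_single_of_ne]

theorem evalDunkl_emb (p : Plane) (f : EvenFun) : evalDunkl p (emb f) = const (f.1 p) := by
  refine K.ext fun n m => ?_
  rw [coeff_evalDunkl, K.coeff_const, coeff_emb]
  split_ifs <;> rfl

theorem monFun_neg (a b : ℕ) (p : Plane) : monFun a b (-p) = (-1) ^ (a + b) * monFun a b p := by
  simp only [monFun, Prod.fst_neg, Prod.snd_neg, Complex.ofReal_neg]
  rw [neg_pow (p.1 : ℂ), neg_pow (p.2 : ℂ)]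
  ring

open Classical in
/-- The monomial `xᵃ yᵇ` as an invariant function; zero if `a + b` is odd. -/
def evenMon (a b : ℕ) : EvenFun :=
  if h : Even (a + b) then
    ⟨monFun a b, contDiff_monFun a b, fun p => by rw [monFun_neg, h.neg_one_pow, one_mul]⟩
  else 0

theorem evenMon_coe {a b : ℕ} (h : Even (a + b)) : (evenMon a b).1 = monFun a b := by
  rw [evenMon, dif_pos h]

theorem isPolynomial_emb_evenMon {a b : ℕ} (h : Even (a + b)) :
    IsPolynomial (emb (evenMon a b)) (mon a b) :=
  isPolynomial_iff.2 fun p => by rw [evalDunkl_emb, evalAt_mon, evenMon_coe h]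

/-- The exponents of even degree in a polynomial. -/
def evenSupport (f : MvPolynomial (Fin 2) K) : Finset (Fin 2 →₀ ℕ) :=
  f.support.filter fun s => Even (s 0 + s 1)

theorem even_of_mem_evenSupport {f : MvPolynomial (Fin 2) K} {s : Fin 2 →₀ ℕ}
    (h : s ∈ evenSupport f) : Even (s 0 + s 1) := (Finset.mem_filter.1 h).2

/-- A polynomial that represents an element of the Dunkl-Weyl algebra has even degree in each of its
terms. -/
theorem IsPolynomial.eq_sum_mon {a : Dunkl} {f : MvPolynomial (Fin 2) K} (h : IsPolynomial a f) :
    f = ∑ s ∈ evenSupport f, f.coeff s • mon (s 0) (s 1) := by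
  refine eq_of_evalAt fun p => ?_
  -- the function is invariant, hence equal to its average over `± p`
  have h1 : evalAt (-p) f = evalAt p f := by
    rw [← isPolynomial_iff.1 h, ← isPolynomial_iff.1 h]
    exact K.ext fun n m => (a.coeff n m).2.2 p
  have h2 : 2 * evalAt p f = evalAt p f + evalAt (-p) f := by rw [h1, two_mul]
  refine mul_left_cancel₀ (two_ne_zero (α := K)) ?_
  rw [h2, evalAt_eq_sum, evalAt_eq_sum, ← Finset.sum_add_distrib, map_sum, evenSupport,
    Finset.sum_filter, Finset.mul_sum]
  refine Finset.sum_congr rfl fun s _ => ?_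
  rw [monFun_neg, const_mul, const_pow, const_neg, const_one]
  split_ifs with hs
  · rw [hs.neg_one_pow, evalAt_smul, evalAt_mon]
    ring
  · rw [(Nat.not_even_iff_odd.1 hs).neg_one_pow]
    ring

theorem IsPolynomial.eq_sum_emb {a : Dunkl} {f : MvPolynomial (Fin 2) K} (h : IsPolynomial a f) :
    a = ∑ s ∈ evenSupport f, f.coeff s • emb (evenMon (s 0) (s 1)) := by
  refine eq_of_evalDunkl fun p => ?_
  rw [isPolynomial_iff.1 h p]
  have h1 := isPolynomial_iff.1 (isPolynomial_sum_smul (evenSupport f) (fun s => f.coeff s)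
    fun s hs => isPolynomial_emb_evenMon (even_of_mem_evenSupport hs)) p
  rw [h1, ← h.eq_sum_mon]

/-! ### The star product on polynomials -/

/-- The inclusion of the scalars in the space of `1`-chains. -/
def scalars₂ : K →+* Chains₁ := laurentMap (laurentMap (algebraMap ℂ EvenFun₂))


theorem mulCoeff_apply (k l : ℕ) (F : EvenFun₂) (p : Plane) : (mulCoeff k l F).1 p =
    (1 / 2) ^ k * (opPow k l ⟨F.1, F.2.1⟩).1 (p, p) := rfl

theorem mulCoeff_algebraMap_mul (k l : ℕ) (c : ℂ) (F : EvenFun₂) :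
    mulCoeff k l (algebraMap ℂ EvenFun₂ c * F) = algebraMap ℂ EvenFun c * mulCoeff k l F := by
  refine Subtype.ext <| funext fun p => ?_
  change _ = c * (mulCoeff k l F).1 p
  rw [mulCoeff_apply, mulCoeff_apply]
  have : (⟨(algebraMap ℂ EvenFun₂ c * F).1, (algebraMap ℂ EvenFun₂ c * F).2.1⟩ : Smooth₂) =
      c • (⟨F.1, F.2.1⟩ : Smooth₂) := rfl
  rw [this, map_smul]
  change _ * (c * _) = _
  ring

theorem mulMap_scalars₂_mul (c : K) (C : Chains₁) : mulMap (scalars₂ c * C) = c • mulMap C :=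
  seriesMap₂_laurentMap_mul (algebraMap ℂ EvenFun₂) (algebraMap ℂ EvenFun)
    (fun l k => mulCoeff k l) (fun l k => mulCoeff_algebraMap_mul k l) c C

theorem tensor_smul_left (c : K) (a b : Dunkl) : tensor (c • a) b = scalars₂ c * tensor a b := by
  have h : ∀ u v : Undeformed, laurentMap (laurentMap inFst) (scalars c * u) *
      laurentMap (laurentMap inSnd) v =
        scalars₂ c * (laurentMap (laurentMap inFst) u * laurentMap (laurentMap inSnd) v) :=
    fun u v => by
      rw [map_mul, mul_assoc]
      rfl
  exact h a b

theorem tensor_smul_right (c : K) (a b : Dunkl) : tensor a (c • b) = scalars₂ c * tensor a b := by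
  have h : ∀ u v : Undeformed, laurentMap (laurentMap inFst) u *
      laurentMap (laurentMap inSnd) (scalars c * v) =
        scalars₂ c * (laurentMap (laurentMap inFst) u * laurentMap (laurentMap inSnd) v) :=
    fun u v => by
      rw [map_mul, mul_left_comm]
      rfl
  exact h a b

theorem tensor_add_left (a a' b : Dunkl) : tensor (a + a') b = tensor a b + tensor a' b := by
  have h : ∀ u u' v : Undeformed, laurentMap (laurentMap inFst) (u + u') *
      laurentMap (laurentMap inSnd) v =
        laurentMap (laurentMap inFst) u * laurentMap (laurentMap inSnd) v +
          laurentMap (laurentMap inFst) u' * laurentMap (laurentMap inSnd) v := fun u u' v => by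
    rw [map_add, add_mul]
  exact h a a' b

theorem tensor_add_right (a b b' : Dunkl) : tensor a (b + b') = tensor a b + tensor a b' := by
  have h : ∀ u v v' : Undeformed, laurentMap (laurentMap inFst) u *
      laurentMap (laurentMap inSnd) (v + v') =
        laurentMap (laurentMap inFst) u * laurentMap (laurentMap inSnd) v +
          laurentMap (laurentMap inFst) u * laurentMap (laurentMap inSnd) v' := fun u v v' => by
    rw [map_add, mul_add]
  exact h a b b'

/-- The star product as a bilinear map. -/
def starBilin : Dunkl →ₗ[K] Dunkl →ₗ[K] Dunkl :=
  LinearMap.mk₂ K starMul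
    (fun a a' b => by rw [starMul, tensor_add_left, map_add]; rfl)
    (fun c a b => by rw [starMul, tensor_smul_left, mulMap_scalars₂_mul]; rfl)
    (fun a b b' => by rw [starMul, tensor_add_right, map_add]; rfl)
    (fun c a b => by rw [starMul, tensor_smul_right, mulMap_scalars₂_mul]; rfl)

theorem starBilin_apply (a b : Dunkl) : starBilin a b = a ⋆ b := rfl

theorem laurentMap_single {R S : Type} [CommRing R] [CommRing S] (f : R →+* S) (r : R) :
    laurentMap f (HahnSeries.single 0 r) = HahnSeries.single 0 (f r) := by
  ext n
  change f (HahnSeries.coeff (HahnSeries.single 0 r) n) = _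
  by_cases h : n = 0
  · rw [h, HahnSeries.coeff_single_same, HahnSeries.coeff_single_same]
  · rw [HahnSeries.coeff_single_of_ne h, HahnSeries.coeff_single_of_ne h, map_zero]

theorem tensor_emb (f g : EvenFun) : tensor (emb f) (emb g) =
    HahnSeries.single 0 (HahnSeries.single 0 (inFst f * inSnd g)) := by
  have h1 : laurentMap (laurentMap inFst) (HahnSeries.single 0 (HahnSeries.single 0 f)) =
      HahnSeries.single 0 (HahnSeries.single 0 (inFst f)) := by
    rw [laurentMap_single, laurentMap_single]
  have h2 : laurentMap (laurentMap inSnd) (HahnSeries.single 0 (HahnSeries.single 0 g)) =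
      HahnSeries.single 0 (HahnSeries.single 0 (inSnd g)) := by
    rw [laurentMap_single, laurentMap_single]
  refine (congrArg₂ (· * ·) h1 h2).trans ?_
  rw [HahnSeries.single_mul_single, HahnSeries.single_mul_single, add_zero]

theorem isPolynomial_emb_star_emb {a b c d : ℕ} (h : Even (a + b)) (h' : Even (c + d)) :
    IsPolynomial (emb (evenMon a b) ⋆ emb (evenMon c d))
      (rep (gen .x ^ a * gen .y ^ b) (mon c d)) := by
  intro p n m
  have h1 : (⟨(inFst (evenMon a b) * inSnd (evenMon c d)).1,
      (inFst (evenMon a b) * inSnd (evenMon c d)).2.1⟩ : Smooth₂) = mon₂ a b c d :=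
    Subtype.ext <| funext fun r => by
      change (evenMon a b).1 r.1 * (evenMon c d).1 r.2 = _
      rw [evenMon_coe h, evenMon_coe h']
      rfl
  have h2 : (emb (evenMon a b) ⋆ emb (evenMon c d)).coeff n m = if 0 ≤ n ∧ 0 ≤ m then
      mulCoeff m.toNat n.toNat (inFst (evenMon a b) * inSnd (evenMon c d)) else 0 := by
    rw [starMul, tensor_emb]
    exact coeff_seriesMap₂_C (fun l k => mulCoeff k l) _ n m
  have h3 := diagCoeff_mon₂ p a b c d n m
  rw [map_mul, map_pow, map_pow, rep_gen, rep_gen]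
  refine Eq.trans ?_ h3
  rw [h2]
  change _ = if 0 ≤ n ∧ 0 ≤ m then _ else _
  split_ifs
  · rw [mulCoeff_apply, h1]
  · rfl

/-- On polynomials, the star product is given by the polynomial representation of `𝓡`. -/
theorem IsPolynomial.star {a b : Dunkl} {f g : MvPolynomial (Fin 2) K} (ha : IsPolynomial a f)
    (hb : IsPolynomial b g) : IsPolynomial (a ⋆ b) (rep (ordered f) g) := by
  have e1 : a ⋆ b = ∑ s ∈ evenSupport f, f.coeff s • ∑ t ∈ evenSupport g,
      g.coeff t • (emb (evenMon (s 0) (s 1)) ⋆ emb (evenMon (t 0) (t 1))) := by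
    rw [← starBilin_apply]
    conv_lhs => rw [ha.eq_sum_emb, hb.eq_sum_emb]
    rw [map_sum starBilin, LinearMap.sum_apply]
    refine Finset.sum_congr rfl fun s _ => ?_
    rw [map_smul, LinearMap.smul_apply, map_sum]
    congr 1
    refine Finset.sum_congr rfl fun t _ => ?_
    rw [map_smul, starBilin_apply]
  have e2 : rep (ordered f) g = ∑ s ∈ evenSupport f, f.coeff s • ∑ t ∈ evenSupport g,
      g.coeff t • rep (gen .x ^ s 0 * gen .y ^ s 1) (mon (t 0) (t 1)) := by
    conv_lhs => rw [ha.eq_sum_mon, hb.eq_sum_mon]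
    rw [map_sum ordered, map_sum rep, LinearMap.sum_apply]
    refine Finset.sum_congr rfl fun s _ => ?_
    rw [map_smul, map_smul, ordered_mon, LinearMap.smul_apply, map_sum]
    congr 1
    refine Finset.sum_congr rfl fun t _ => ?_
    rw [map_smul]
  rw [e1, e2]
  exact isPolynomial_sum_smul _ _ fun s hs => isPolynomial_sum_smul _ _ fun t ht =>
    isPolynomial_emb_star_emb (even_of_mem_evenSupport hs) (even_of_mem_evenSupport ht)

theorem IsPolynomial.e_mul {a : Dunkl} {f : MvPolynomial (Fin 2) K} (h : IsPolynomial a f) :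
    e * (ordered f * e) = ordered f * e := by
  have h1 : gen .γ * (ordered f * e) = ordered f * e := by
    rw [h.eq_sum_mon, map_sum, Finset.sum_mul, Finset.mul_sum]
    refine Finset.sum_congr rfl fun s hs => ?_
    rw [map_smul, ordered_mon, smul_mul_assoc, mul_smul_comm, ← mul_assoc, gen_γ_mul_pow_mul_pow,
      (even_of_mem_evenSupport hs).neg_one_pow, one_smul, mul_assoc, gen_γ_mul_e]
  rw [e, smul_mul_assoc, add_mul, one_mul, ← e, h1]
  module

/-! ### The trace on the Dunkl-Weyl algebra -/

/-- The Taylor coefficients of an invariant function, as an additive map. -/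
def taylorHom (i j : ℕ) : EvenFun →+ ℂ where
  toFun f := taylor f.1 i j
  map_zero' := taylor_zero i j
  map_add' f g := map_add (taylorLM i j) ⟨f.1, f.2.1⟩ ⟨g.1, g.2.1⟩

/-- The coefficient of `ħ₂ˡ ħ₁ᵏ` in the trace. -/
def traceOp (l k : ℕ) : EvenFun →+ ℂ :=
  (AddMonoidHom.mulLeft ((tracePoly k).coeff l)).comp (taylorHom k k)

theorem traceOp_apply (l k : ℕ) (f : EvenFun) :
    traceOp l k f = (tracePoly k).coeff l * taylor f.1 k k := rfl

theorem traceOp_algebraMap_mul (l k : ℕ) (c : ℂ) (f : EvenFun) :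
    traceOp l k (algebraMap ℂ EvenFun c * f) = c * traceOp l k f := by
  have h : taylor (algebraMap ℂ EvenFun c * f).1 k k = c * taylor f.1 k k :=
    map_smul (taylorLM k k) c ⟨f.1, f.2.1⟩
  rw [traceOp_apply, traceOp_apply, h]
  ring


/-- The trace on the Dunkl-Weyl algebra: the functional on Taylor series whose value on polynomials
is `polyTrace`. -/
def dunklTrace : Dunkl →ₗ[K] K where
  toFun := (seriesMap₂ traceOp : Undeformed →+ LaurentSeries (LaurentSeries ℂ))
  map_add' := map_add (seriesMap₂ traceOp)
  map_smul' c a := seriesMap₂_laurentMap_mul (algebraMap ℂ EvenFun) (RingHom.id ℂ) traceOp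
    traceOp_algebraMap_mul c a

theorem coeff_dunklTrace (a : Dunkl) (n m : ℤ) : (dunklTrace a).coeff n m =
    ∑ᶠ l : ℕ, ∑ᶠ k : ℕ, (tracePoly k).coeff l * taylor (a.coeff (n - l) (m - k)).1 k k :=
  coeff_seriesMap₂ traceOp a n m

/-- A coefficient of the trace of `a` agrees with that of a polynomial as soon as the Taylor
coefficients entering it do. -/
theorem coeff_dunklTrace_eq {a : Dunkl} {P : MvPolynomial (Fin 2) K} {n m : ℤ}
    (h : ∀ l k : ℕ, taylor (a.coeff (n - l) (m - k)).1 k k =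
      (P.coeff (expo k k)).coeff (n - l) (m - k)) :
    (dunklTrace a).coeff n m = (polyTrace P).coeff n m := by
  rw [coeff_dunklTrace, coeff_polyTrace]
  simp_rw [h]

theorem dunklTrace_of_isPolynomial {a : Dunkl} {f : MvPolynomial (Fin 2) K}
    (h : IsPolynomial a f) : dunklTrace a = polyTrace f :=
  K.ext fun _ _ => coeff_dunklTrace_eq fun _ k => taylor_eq_coeff (fun p => h p _ _) k k

theorem isPolynomial_one : IsPolynomial 1 (mon 0 0) := by
  refine isPolynomial_iff.2 fun p => ?_
  rw [evalAt_mon]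
  refine (map_one (laurentMap (laurentMap (evalHom p)))).trans ?_
  have : monFun 0 0 p = 1 := by simp [monFun]
  rw [this, const_one]
  rfl

theorem dunklTrace_one : dunklTrace 1 = 1 := by
  rw [dunklTrace_of_isPolynomial isPolynomial_one, polyTrace_mon, if_pos rfl, traceCoeff_zero,
    pow_zero, mul_one]

/-- The coefficient of `ħ₂ˡ ħ₁ᵏ` in the Hochschild boundary. -/
def boundaryOp (l k : ℕ) : EvenFun₂ →+ EvenFun :=
  mulCoeff k l - (mulCoeff k l).comp swapFactors.toAddMonoidHom

theorem boundary_eq_seriesMap₂ : (boundary : Chains₁ →+ Dunkl) = seriesMap₂ boundaryOp := by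
  have h := seriesMap₂_sub (fun l k => mulCoeff k l)
    (fun l k => (mulCoeff k l).comp swapFactors.toAddMonoidHom)
  exact h.symm

theorem swap_tensor (a b : Dunkl) :
    laurentMap (laurentMap swapFactors) (tensor a b) = tensor b a := by
  have h : ∀ u v : Undeformed, laurentMap (laurentMap swapFactors)
      (laurentMap (laurentMap inFst) u * laurentMap (laurentMap inSnd) v) =
        laurentMap (laurentMap inFst) v * laurentMap (laurentMap inSnd) u := fun u v => by
    rw [map_mul, mul_comm]
    rfl
  exact h a b

theorem boundary_tensor (a b : Dunkl) : boundary (tensor a b) = a ⋆ b - b ⋆ a := by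
  change mulMap (tensor a b) - mulMap (laurentMap (laurentMap swapFactors) (tensor a b)) = _
  rw [swap_tensor]
  rfl

theorem dunklTrace_boundary_emb {a b c d : ℕ} (h : Even (a + b)) (h' : Even (c + d)) :
    dunklTrace (boundary (tensor (emb (evenMon a b)) (emb (evenMon c d)))) = 0 := by
  have h1 : ∀ {a b c d : ℕ}, rep (gen .x ^ a * gen .y ^ b) (mon c d) =
      rep (gen .x ^ a * gen .y ^ b * (gen .x ^ c * gen .y ^ d)) (mon 0 0) := fun {a b c d} => by
    rw [map_mul rep (gen .x ^ a * gen .y ^ b), Module.End.mul_apply, rep_pow_mul_pow]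
  rw [boundary_tensor, map_sub, dunklTrace_of_isPolynomial (isPolynomial_emb_star_emb h h'),
    dunklTrace_of_isPolynomial (isPolynomial_emb_star_emb h' h), h1, h1, ← sraTrace_apply,
    ← sraTrace_apply, (pow_mul_pow_mem_traceCommuting h).2, sub_self]

/-- The restriction to the diagonal of the coefficient of `ħ₁ᵏ ħ₂ˡ` in the product. -/
def diagonalOp (k l : ℕ) : Smooth₂ →ₗ[ℂ] Smooth Plane where
  toFun F := ⟨fun p => (1 / 2 : ℂ) ^ k * (opPow k l F).1 (p, p),
    contDiff_const.mul ((show ContDiff ℝ ∞ (opPow k l F).1 from (opPow k l F).2).comp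
      (contDiff_id.prodMk contDiff_id))⟩
  map_add' F G := Subtype.ext <| funext fun p => by
    rw [map_add]
    exact mul_add _ _ _
  map_smul' c F := Subtype.ext <| funext fun p => by
    rw [map_smul]
    exact mul_left_comm _ _ _

/-- The flip of the two points. -/
def swapSmooth : Smooth₂ →ₗ[ℂ] Smooth₂ where
  toFun F := ⟨fun r => F.1 (r.2, r.1),
    (show ContDiff ℝ ∞ F.1 from F.2).comp (contDiff_snd.prodMk contDiff_fst)⟩
  map_add' _ _ := rfl
  map_smul' _ _ := rfl

theorem vanish_diagonalOp {k l m : ℕ} {F : Smooth₂} (h : Vanish (m + 2 * k) F.1) :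
    Vanish m (diagonalOp k l F).1 :=
  (vanish_diagonal (vanish_opPow h)).const_smul
    ((show ContDiff ℝ ∞ (opPow k l F).1 from (opPow k l F).2).comp
      (contDiff_id.prodMk contDiff_id)) _

theorem vanish_swapSmooth {m : ℕ} {F : Smooth₂} (h : Vanish m F.1) :
    Vanish m (swapSmooth F).1 :=
  h.comp_clm F.2 ((ContinuousLinearMap.snd ℝ Plane Plane).prod
    (ContinuousLinearMap.fst ℝ Plane Plane))

/-- The coefficient of `ħ₂ˡ ħ₁ᵏ` in the composite of the trace and the boundary, on functions without
parity. -/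
def traceBoundaryOp (l k : ℕ) : Smooth₂ →ₗ[ℂ] ℂ :=
  ∑ u ∈ Finset.HasAntidiagonal.antidiagonal l, ∑ v ∈ Finset.HasAntidiagonal.antidiagonal k,
    (tracePoly v.1).coeff u.1 • taylorLM v.1 v.1 ∘ₗ diagonalOp v.2 u.2 ∘ₗ
      (LinearMap.id - swapSmooth)

theorem traceBoundaryOp_apply (l k : ℕ) (F : EvenFun₂) :
    (∑ u ∈ Finset.HasAntidiagonal.antidiagonal l, ∑ v ∈ Finset.HasAntidiagonal.antidiagonal k,
      (traceOp u.1 v.1).comp (boundaryOp u.2 v.2)) F = traceBoundaryOp l k ⟨F.1, F.2.1⟩ := by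
  simp only [AddMonoidHom.finsetSum_apply, traceBoundaryOp, LinearMap.sum_apply]
  refine Finset.sum_congr rfl fun u _ => Finset.sum_congr rfl fun v _ => ?_
  change (tracePoly v.1).coeff u.1 * taylor (boundaryOp u.2 v.2 F).1 v.1 v.1 =
    (tracePoly v.1).coeff u.1 * taylor (diagonalOp v.2 u.2 (⟨F.1, F.2.1⟩ -
      swapSmooth ⟨F.1, F.2.1⟩)).1 v.1 v.1
  rw [map_sub]
  rfl

theorem traceBoundaryOp_of_vanish (l k : ℕ) {F : Smooth₂} (h : Vanish (2 * k + 1) F.1) :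
    traceBoundaryOp l k F = 0 := by
  simp only [traceBoundaryOp, LinearMap.sum_apply]
  refine Finset.sum_eq_zero fun u _ => Finset.sum_eq_zero fun v hv => ?_
  have hv' : v.1 + v.2 = k := by simpa using hv
  have h1 : ∀ G : Smooth₂, Vanish (2 * k + 1) G.1 → taylorLM v.1 v.1 (diagonalOp v.2 u.2 G) = 0 :=
    fun G hG => taylor_eq_zero_of_vanish (m := 2 * v.1 + 1) (by omega)
      (vanish_diagonalOp (by rwa [show 2 * v.1 + 1 + 2 * v.2 = 2 * k + 1 by omega]))
  change (tracePoly v.1).coeff u.1 • taylorLM v.1 v.1 (diagonalOp v.2 u.2 (F - swapSmooth F)) = _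
  rw [map_sub, map_sub, h1 _ h, h1 _ (vanish_swapSmooth h), sub_zero, smul_zero]

theorem traceBoundaryOp_mon₂ (l k : ℕ) {a b c d : ℕ} (h : Even (a + b)) (h' : Even (c + d)) :
    traceBoundaryOp l k (mon₂ a b c d) = 0 := by
  have h1 : (⟨(inFst (evenMon a b) * inSnd (evenMon c d)).1,
      (inFst (evenMon a b) * inSnd (evenMon c d)).2.1⟩ : Smooth₂) = mon₂ a b c d :=
    Subtype.ext <| funext fun r => by
      change (evenMon a b).1 r.1 * (evenMon c d).1 r.2 = _
      rw [evenMon_coe h, evenMon_coe h']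
      rfl
  have h2 := congrArg (fun c : K => c.coeff l k) (dunklTrace_boundary_emb h h')
  have h3 : dunklTrace (boundary (tensor (emb (evenMon a b)) (emb (evenMon c d)))) =
      ((seriesMap₂ traceOp).comp (seriesMap₂ boundaryOp))
        (tensor (emb (evenMon a b)) (emb (evenMon c d))) := by
    rw [boundary_eq_seriesMap₂]
    rfl
  rw [h3, seriesMap₂_comp_seriesMap₂, tensor_emb] at h2
  have h4 := (coeff_seriesMap₂_C _ _ _ _).symm.trans h2
  rw [if_pos ⟨Int.natCast_nonneg l, Int.natCast_nonneg k⟩] at h4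
  rw [← h1, ← traceBoundaryOp_apply]
  exact h4

/-- The trace vanishes on Hochschild boundaries. The coefficients of the composite of trace and
boundary have finite order at the origin, so that the claim reduces to the case of polynomials. -/
theorem dunklTrace_boundary (C : Chains₁) : dunklTrace (boundary C) = 0 := by
  have h1 : dunklTrace (boundary C) = ((seriesMap₂ traceOp).comp (seriesMap₂ boundaryOp)) C := by
    rw [boundary_eq_seriesMap₂]
    rfl
  rw [h1, seriesMap₂_comp_seriesMap₂]
  refine K.ext fun n m => ?_
  refine (coeff_seriesMap₂ _ C n m).trans ?_
  have h2 : ∀ (l k : ℕ) (F : EvenFun₂), (∑ u ∈ Finset.HasAntidiagonal.antidiagonal l,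
      ∑ v ∈ Finset.HasAntidiagonal.antidiagonal k,
        (traceOp u.1 v.1).comp (boundaryOp u.2 v.2)) F = 0 := fun l k F => by
    rw [traceBoundaryOp_apply]
    exact apply_eq_zero_of_even_mon₂ _ (2 * k + 1) (fun F hF => traceBoundaryOp_of_vanish l k hF)
      (fun a b c d h h' => traceBoundaryOp_mon₂ l k h h') F
  simp only [h2, finsum_zero]
  rfl

theorem isTrace_dunklTrace : IsTrace dunklTrace := fun a b => by
  have h := dunklTrace_boundary (tensor a b)
  rwa [boundary_tensor, map_sub, sub_eq_zero] at h

theorem mk_one_ne_zero : HH₀.mk 1 ≠ 0 := by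
  intro h
  obtain ⟨C, hC⟩ := (QuotientAddGroup.eq_zero_iff (N := boundary.range) (1 : Dunkl)).1 h
  have h1 := dunklTrace_boundary C
  rw [hC, dunklTrace_one] at h1
  exact one_ne_zero h1

/-! ### Uniqueness of the trace -/


theorem opDelta_inFst_mul_inSnd (u v : EvenFun) (x₁ y₁ x₂ y₂ : ℝ) :
    (opDelta ⟨(inFst u * inSnd v).1, (inFst u * inSnd v).2.1⟩).1 ((x₁, y₁), (x₂, y₂)) =
      (∫ t in (0 : ℝ)..1, dy u.1 (x₁, y₂ + t * (y₁ - y₂))) * v.1 (x₂, y₂) := by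
  have h : ∀ s : ℝ, fderiv ℝ (inFst u * inSnd v).1 ((x₁, s), (x₂, y₂)) ((0, 1), (0, 0)) =
      dy u.1 (x₁, s) * v.1 (x₂, y₂) := fun s => by
    have hu : HasDerivAt (fun s => u.1 (x₁, s)) (dy u.1 (x₁, s)) s :=
      (u.2.1.differentiable (by simp) (x₁, s)).hasFDerivAt.comp_hasDerivAt s
        ((hasDerivAt_const s x₁).prodMk (hasDerivAt_id s))
    exact fderiv_apply_eq_deriv (inFst u * inSnd v).2.1
      (((hasDerivAt_const s x₁).prodMk (hasDerivAt_id s)).prodMk (hasDerivAt_const s (x₂, y₂)))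
      (hu.mul_const (v.1 (x₂, y₂)))
  rw [opDelta_apply]
  simp_rw [h]
  exact intervalIntegral.integral_mul_const _ _

theorem opPartial_opDelta_inFst_mul_inSnd (u v : EvenFun) (p : Plane) :
    (opPartial (opDelta ⟨(inFst u * inSnd v).1, (inFst u * inSnd v).2.1⟩)).1 (p, p) =
      dy u.1 p * dx v.1 p := by
  obtain ⟨x, y⟩ := p
  have hv : HasDerivAt (fun s => v.1 (s, y)) (dx v.1 (x, y)) x :=
    (v.2.1.differentiable (by simp) (x, y)).hasFDerivAt.comp_hasDerivAt x
      ((hasDerivAt_id x).prodMk (hasDerivAt_const x y))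
  refine fderiv_apply_eq_deriv (opDelta _).2
    ((hasDerivAt_const x (x, y)).prodMk ((hasDerivAt_id x).prodMk (hasDerivAt_const x y))) ?_
  simp only [id, opDelta_inFst_mul_inSnd, sub_self, mul_zero, add_zero,
    intervalIntegral.integral_const, sub_zero, one_smul]
  exact hv.const_mul _

theorem swapFactors_inFst_mul_inSnd (u v : EvenFun) :
    swapFactors (inFst u * inSnd v) = inFst v * inSnd u := by
  rw [map_mul, mul_comm]
  rfl

theorem boundaryOp_apply (l k : ℕ) (F : EvenFun₂) (p : Plane) :
    (boundaryOp l k F).1 p = (mulCoeff k l F).1 p - (mulCoeff k l (swapFactors F)).1 p := rfl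

theorem boundaryOp_zero_zero : boundaryOp 0 0 = 0 := by
  ext F p
  exact sub_self _

/-- To first order in `ħ₁`, the commutator is given by the Poisson bracket. -/
theorem boundaryOp_zero_one_apply (u v : EvenFun) (p : Plane) :
    (boundaryOp 0 1 (inFst u * inSnd v)).1 p =
      1 / 2 * (dy u.1 p * dx v.1 p - dy v.1 p * dx u.1 p) := by
  have h : ∀ u v : EvenFun, (mulCoeff 1 0 (inFst u * inSnd v)).1 p =
      1 / 2 * (dy u.1 p * dx v.1 p) := fun u v => by
    rw [mulCoeff_apply, ← opPartial_opDelta_inFst_mul_inSnd, pow_one]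
    rfl
  rw [boundaryOp_apply, swapFactors_inFst_mul_inSnd, h, h]
  ring

/-- The coefficient of `ħ₂ˡ ħ₁ᵏ` in the commutator with `q`. -/
def commOp (q : EvenFun) (l k : ℕ) : EvenFun →+ EvenFun :=
  (boundaryOp l k).comp ((AddMonoidHom.mulLeft (inFst q)).comp inSnd.toAddMonoidHom)

theorem tensor_emb_left (q : EvenFun) (a : Dunkl) : tensor (emb q) a =
    coeffMap (coeffMap ((AddMonoidHom.mulLeft (inFst q)).comp inSnd.toAddMonoidHom)) a := by
  have h1 : laurentMap (laurentMap inFst) (HahnSeries.single 0 (HahnSeries.single 0 q)) =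
      HahnSeries.single 0 (HahnSeries.single 0 (inFst q)) := by
    rw [laurentMap_single, laurentMap_single]
  have h2 : ∀ u : Undeformed, HahnSeries.single 0 (HahnSeries.single 0 (inFst q)) *
      laurentMap (laurentMap inSnd) u = coeffMap (coeffMap
        ((AddMonoidHom.mulLeft (inFst q)).comp inSnd.toAddMonoidHom)) u := fun u => by
    refine HahnSeries.ext (funext fun n => HahnSeries.ext (funext fun m => ?_))
    rw [HahnSeries.coeff_single_mul, HahnSeries.coeff_single_mul, sub_zero, sub_zero]
    rfl
  exact (congrArg (· * _) h1).trans (h2 a)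

theorem seriesMap₂_commOp (q : EvenFun) (a : Dunkl) :
    (seriesMap₂ (commOp q) : Undeformed →+ Undeformed) a = emb q ⋆ a - a ⋆ emb q := by
  rw [← boundary_tensor, tensor_emb_left, boundary_eq_seriesMap₂]
  rfl

/-- The operator `c ↦ ħ₁ c` from scalars to constant functions. -/
def unitOp (l k : ℕ) : ℂ →+ EvenFun :=
  if l = 0 ∧ k = 1 then (algebraMap ℂ EvenFun).toAddMonoidHom else 0

theorem seriesMap₂_unitOp (c : K) :
    (seriesMap₂ unitOp : LaurentSeries (LaurentSeries ℂ) →+ Undeformed) c =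
      (hbar₁ * c) • (1 : Dunkl) := by
  refine Dunkl.ext fun n m => ?_
  have h1 : ((hbar₁ * c) • (1 : Dunkl)).coeff n m = algebraMap ℂ EvenFun (c.coeff n (m - 1)) := by
    rw [← K.coeff_hbar₁_mul]
    have h : ∀ d : K, (scalars d * 1 : Undeformed) = scalars d := fun d => mul_one _
    exact congrArg (fun a : Dunkl => a.coeff n m) (h (hbar₁ * c))
  rw [h1]
  refine (coeff_seriesMap₂ unitOp c n m).trans ?_
  rw [finsum_eq_single _ 0, finsum_eq_single _ 1]
  · simp only [unitOp, and_self, if_true, Nat.cast_zero, sub_zero, Nat.cast_one]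
    rfl
  · intro k hk
    rw [unitOp, if_neg fun h => hk h.2]
    rfl
  · intro l hl
    simp only [unitOp, if_neg fun h : l = 0 ∧ _ => hl h.1, AddMonoidHom.zero_apply, finsum_zero]

/-- Constants and commutators with `x²` and `y²`. -/
def spanOp (l k : ℕ) : ℂ × EvenFun × EvenFun →+ EvenFun :=
  (unitOp l k).comp (AddMonoidHom.fst _ _) +
    ((commOp (evenMon 2 0) l k).comp ((AddMonoidHom.fst _ _).comp (AddMonoidHom.snd _ _)) +
      (commOp (evenMon 0 2) l k).comp ((AddMonoidHom.snd _ _).comp (AddMonoidHom.snd _ _)))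

theorem spanOp_zero_zero : spanOp 0 0 = 0 := by
  have h : unitOp 0 0 = 0 := if_neg (by simp)
  rw [spanOp, commOp, commOp, boundaryOp_zero_zero, h]
  simp only [AddMonoidHom.zero_comp, add_zero]

theorem spanOp_zero_one_surjective : Function.Surjective (spanOp 0 1) := by
  intro f
  obtain ⟨a, g, h⟩ := exists_eq_add_dx_add_dy f
  refine ⟨(f.1 0, a, g), Subtype.ext <| funext fun p => ?_⟩
  change f.1 0 + ((boundaryOp 0 1 (inFst (evenMon 2 0) * inSnd a)).1 p +
    (boundaryOp 0 1 (inFst (evenMon 0 2) * inSnd g)).1 p) = _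
  rw [boundaryOp_zero_one_apply, boundaryOp_zero_one_apply, evenMon_coe (by decide),
    evenMon_coe (by decide), dx_monFun, dy_monFun, dx_monFun, dy_monFun, h p]
  simp only [monFun]
  push_cast
  ring

theorem exists_seriesMap₂_spanOp_eq (A : LaurentSeries (LaurentSeries (ℂ × EvenFun × EvenFun))) :
    ∃ (c : LaurentSeries (LaurentSeries ℂ)) (a g : Undeformed), seriesMap₂ spanOp A =
      seriesMap₂ unitOp c + (seriesMap₂ (commOp (evenMon 2 0)) a +
        seriesMap₂ (commOp (evenMon 0 2)) g) := by
  refine ⟨coeffMap (coeffMap (AddMonoidHom.fst _ _)) A,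
    coeffMap (coeffMap ((AddMonoidHom.fst _ _).comp (AddMonoidHom.snd _ _))) A,
    coeffMap (coeffMap ((AddMonoidHom.snd _ _).comp (AddMonoidHom.snd _ _))) A, ?_⟩
  rw [← AddMonoidHom.comp_apply, seriesMap₂_comp_coeffMap, ← AddMonoidHom.comp_apply,
    seriesMap₂_comp_coeffMap, ← AddMonoidHom.comp_apply, seriesMap₂_comp_coeffMap,
    ← AddMonoidHom.add_apply, ← AddMonoidHom.add_apply, ← seriesMap₂_add, ← seriesMap₂_add]
  rfl

/-- Modulo multiples of the unit, every element is a sum of a commutator with `x²` and a commutator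
with `y²`. -/
theorem exists_eq_smul_one_add (b : Dunkl) : ∃ (c : K) (a g : Dunkl),
    b = c • 1 + ((emb (evenMon 2 0) ⋆ a - a ⋆ emb (evenMon 2 0)) +
      (emb (evenMon 0 2) ⋆ g - g ⋆ emb (evenMon 0 2))) := by
  obtain ⟨A, hA⟩ := seriesMap₂_surjective_of_one spanOp_zero_zero spanOp_zero_one_surjective b
  obtain ⟨c, a, g, h⟩ := exists_seriesMap₂_spanOp_eq A
  refine ⟨(hbar₁ * (show K from c)), a, g, ?_⟩
  rw [← seriesMap₂_commOp (evenMon 2 0) a, ← seriesMap₂_commOp (evenMon 0 2) g]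
  refine (hA.symm.trans h).trans ?_
  exact congrArg (fun u : Dunkl => u + (show Dunkl from
    (seriesMap₂ (commOp (evenMon 2 0)) a + seriesMap₂ (commOp (evenMon 0 2)) g : Undeformed)))
    (seriesMap₂_unitOp c)

theorem eq_dunklTrace {ψ : Dunkl →ₗ[K] K} (hψ : IsTrace ψ) (h1 : ψ 1 = 1) : ψ = dunklTrace := by
  ext b
  obtain ⟨c, a, g, rfl⟩ := exists_eq_smul_one_add b
  simp only [map_add, map_sub, map_smul, hψ _ a, hψ _ g, isTrace_dunklTrace _ a,
    isTrace_dunklTrace _ g, h1, dunklTrace_one, sub_self]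

/-! ### Normal orderings -/

/-- The polynomial that represents `zᵖ z̄^q e`. -/
def normalMon (p q : ℕ) : MvPolynomial (Fin 2) K := rep (zElt ^ p * zbarElt ^ q) (mon 0 0)

theorem normalMon_mem_homogeneous (p q : ℕ) : normalMon p q ∈ homogeneous (p + q) :=
  rep_z_pow_mul_zbar_pow_mem_homogeneous p q

/-- The coefficient of `ħ₂ⁿ ħ₁ᵐ xⁱ yʲ` in the contribution of `zᵖ z̄^q` to the normal ordering. -/
def normalTerm (f : EvenFun) (n m : ℤ) (i j : ℕ) (pq : ℕ × ℕ) : ℂ :=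
  (const (taylorZ f.1 pq.1 pq.2) * (normalMon pq.1 pq.2).coeff (expo i j)).coeff n m

theorem normalTerm_ne_zero {f : EvenFun} {n m : ℤ} {i j : ℕ} {pq : ℕ × ℕ}
    (h : normalTerm f n m i j pq ≠ 0) : 0 ≤ n ∧ 0 ≤ m ∧ 2 * m + i + j = (pq.1 + pq.2 : ℕ) ∧
      taylorZ f.1 pq.1 pq.2 ≠ 0 := by
  rw [normalTerm, K.coeff_const_mul] at h
  have h1 := coeff_ne_zero_of_mem_homogeneous (normalMon_mem_homogeneous pq.1 pq.2)
    (right_ne_zero_of_mul h)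
  exact ⟨h1.1, h1.2.1, by exact_mod_cast h1.2.2, left_ne_zero_of_mul h⟩

theorem support_normalTerm_subset (f : EvenFun) {n m : ℤ} {i j w : ℕ}
    (hw : 0 ≤ m → 2 * m + i + j = w) : Function.support (normalTerm f n m i j) ⊆
      (Finset.HasAntidiagonal.antidiagonal w : Finset (ℕ × ℕ)) := by
  intro pq hpq
  obtain ⟨-, h1, h2, -⟩ := normalTerm_ne_zero hpq
  rw [Finset.mem_coe, Finset.HasAntidiagonal.mem_antidiagonal]
  have := hw h1
  omega

theorem finite_support_normalTerm (f : EvenFun) (n m : ℤ) (i j : ℕ) :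
    (Function.support (normalTerm f n m i j)).Finite :=
  (Finset.finite_toSet _).subset
    (support_normalTerm_subset f (w := (2 * m + i + j).toNat) fun h => by omega)

theorem exists_isNormalOrdering (f : EvenFun) : ∃ a : Dunkl, IsNormalOrdering f a := by
  have h1 : ∀ n m : ℤ, ∃ g : EvenFun, ∀ i j,
      taylor g.1 i j = ∑ᶠ pq, normalTerm f n m i j pq := fun n m => by
    refine exists_evenFun_taylor_eq (fun i j => ∑ᶠ pq, normalTerm f n m i j pq) fun i j hij => ?_
    refine (finsum_congr fun pq => ?_).trans finsum_zero
    by_contra h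
    obtain ⟨-, -, h2, h3⟩ := normalTerm_ne_zero h
    refine h3 (taylorZ_eq_zero_of_odd f ?_)
    rw [Nat.odd_iff] at hij ⊢
    omega
  choose g hg using h1
  have hneg : ∀ {n m : ℤ}, ¬(0 ≤ n ∧ 0 ≤ m) → ∀ i j, ∑ᶠ pq, normalTerm f n m i j pq = 0 :=
    fun {n m} h i j => (finsum_congr fun pq => by
      by_contra hc
      have := normalTerm_ne_zero hc
      exact h ⟨this.1, this.2.1⟩).trans finsum_zero
  let c : ℤ → ℤ → EvenFun := fun n m => if 0 ≤ n ∧ 0 ≤ m then g n m else 0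
  have hc : ∀ n, ∀ m < 0, c n m = 0 := fun n m hm => if_neg (by omega)
  let a : Dunkl := laurentOf (fun n => laurentOf (c n) 0 (hc n)) 0 fun n hn =>
    HahnSeries.ext (funext fun m => if_neg (by omega))
  have ha : ∀ n m, a.coeff n m = c n m := fun n m => rfl
  refine ⟨a, normalMon, fun p q => ordered_rep_one_mul_e _, fun i j n m =>
    ⟨finite_support_normalTerm f n m i j, ?_⟩⟩
  change ∑ᶠ pq, normalTerm f n m i j pq = _
  rw [ha]
  simp only [c]
  split_ifs with h
  · exact (hg n m i j).symm
  · rw [hneg h]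
    exact (taylor_zero i j).symm

/-- The polynomials in the definition of a normal ordering are unique, by the
Poincaré–Birkhoff–Witt property. -/
theorem IsNormalOrdering.taylor_eq {f : EvenFun} {a : Dunkl} (h : IsNormalOrdering f a) (i j : ℕ)
    (n m : ℤ) : taylor (a.coeff n m).1 i j = ∑ᶠ pq, normalTerm f n m i j pq := by
  obtain ⟨N, hN, hNa⟩ := h
  have hN' : N = normalMon := by
    ext1 p
    ext1 q
    exact eq_rep_of_ordered_mul_e_eq (hN p q)
  subst hN'
  exact (hNa i j n m).2.symm

/-- The part of the normal ordering of `f` that enters the coefficients of `ħ₁ᴹ` in the trace. -/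
def normalPart (f : EvenFun) (M : ℕ) : MvPolynomial (Fin 2) K :=
  ∑ pq ∈ Finset.HasAntidiagonal.antidiagonal (2 * M),
    const (taylorZ f.1 pq.1 pq.2) • normalMon pq.1 pq.2

theorem coeff_normalPart (f : EvenFun) (M i j : ℕ) (n m : ℤ) :
    ((normalPart f M).coeff (expo i j)).coeff n m =
      ∑ pq ∈ Finset.HasAntidiagonal.antidiagonal (2 * M), normalTerm f n m i j pq := by
  rw [normalPart, MvPolynomial.coeff_sum, K.coeff_sum]
  refine Finset.sum_congr rfl fun pq _ => ?_
  rw [MvPolynomial.coeff_smul]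
  rfl

theorem polyTrace_normalPart (f : EvenFun) (M : ℕ) : polyTrace (normalPart f M) =
    const (taylorZ f.1 M M) * ((const Complex.I * hbar₁) ^ M * ∏ l ∈ Finset.Icc 1 M, factor l) := by
  rw [normalPart, map_sum, Finset.sum_eq_single (M, M)]
  · rw [map_smul, normalMon, ← sraTrace_apply, sraTrace_z_pow_mul_zbar_pow, smul_eq_mul]
  · intro pq hpq hne
    have h := Finset.HasAntidiagonal.mem_antidiagonal.1 hpq
    rw [map_smul, normalMon, ← sraTrace_apply, sraTrace_z_pow_mul_zbar_pow_of_ne, smul_zero]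
    · rw [h]
      exact even_two_mul M
    · intro hc
      exact hne (Prod.ext (by omega) (by omega))
  · intro h
    exact absurd (Finset.HasAntidiagonal.mem_antidiagonal.2 (two_mul M).symm) h

theorem IsNormalOrdering.coeff_dunklTrace {f : EvenFun} {a : Dunkl} (h : IsNormalOrdering f a)
    (n m : ℤ) : (dunklTrace a).coeff n m = (polyTrace (normalPart f m.toNat)).coeff n m := by
  refine coeff_dunklTrace_eq fun l k => ?_
  rw [h.taylor_eq, coeff_normalPart]
  exact finsum_eq_sum_of_support_subset _ (support_normalTerm_subset f fun hm => by omega)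

theorem floor_succ_div_two (l : ℕ) : ⌊((l : ℝ) + 1) / 2⌋ = (((l + 1) / 2 : ℕ) : ℤ) := by
  have h := Nat.floor_div_eq_div (K := ℝ) (l + 1) 2
  rw [← h, ← Int.natCast_floor_eq_floor (by positivity)]
  push_cast
  rfl

theorem traceTerm_eq (f : EvenFun) (k : ℕ) : traceTerm f k = polyTrace (normalPart f k) := by
  have h1 : const ((dz^[k] (dzbar^[k] f.1)) 0) = (k.factorial : K) ^ 2 * const (taylorZ f.1 k k) := by
    have hk : (k.factorial : ℂ) ≠ 0 := by exact_mod_cast k.factorial_ne_zero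
    rw [← const_natCast, ← const_pow, ← const_mul, taylorZ]
    congr 1
    field_simp
  have hk : (k.factorial : K) ≠ 0 := by exact_mod_cast k.factorial_ne_zero
  rw [polyTrace_normalPart, traceTerm, h1]
  simp only [floor_succ_div_two, Int.cast_natCast]
  change _ / _ * (∏ l ∈ Finset.Icc 1 k, factor l) * _ = _
  field_simp

theorem prod_factor_eq (k : ℕ) : ∏ l ∈ Finset.Icc 1 k, factor l =
    evalHbar₂ (∏ l ∈ Finset.Icc 1 k, factorPoly l) := by
  rw [map_prod]
  exact Finset.prod_congr rfl fun l _ => (evalHbar₂_factorPoly l).symm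

/-- The `k`-th term of the trace formula is concentrated in degree `k` in `ħ₁`. -/
theorem coeff_traceTerm_of_ne (f : EvenFun) {k : ℕ} {m : ℤ} (h : m ≠ k) (n : ℤ) :
    (traceTerm f k).coeff n m = 0 := by
  have h1 : const (taylorZ f.1 k k) * ((const Complex.I * hbar₁) ^ k *
      ∏ l ∈ Finset.Icc 1 k, factor l) = const (taylorZ f.1 k k * Complex.I ^ k) *
        (hbar₁ ^ k * evalHbar₂ (∏ l ∈ Finset.Icc 1 k, factorPoly l) * 1) := by
    rw [prod_factor_eq, const_mul, const_pow, mul_pow]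
    ring
  rw [traceTerm_eq, polyTrace_normalPart, h1, K.coeff_const_mul,
    coeff_mul_evalHbar₂ (Nat.lt_succ_self _)]
  refine mul_eq_zero_of_right _ (Finset.sum_eq_zero fun l _ => ?_)
  rw [← const_one, K.coeff_const, if_neg (by omega), mul_zero]

theorem IsNormalOrdering.hasFormalSum {f : EvenFun} {a : Dunkl} (h : IsNormalOrdering f a) :
    HasFormalSum (traceTerm f) (dunklTrace a) := by
  intro n m
  have h1 : ∀ k : ℕ, k ≠ m.toNat → (traceTerm f k).coeff n m = 0 := fun k hk =>
    coeff_traceTerm_of_ne f (by omega) n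
  refine ⟨(Set.finite_singleton m.toNat).subset fun k hk => by_contra fun hc => hk (h1 k hc), ?_⟩
  rw [finsum_eq_single _ _ h1, traceTerm_eq, h.coeff_dunklTrace]

end DunklWeyl

end

open DunklWeyl in
theorem theorem2p3 :
    -- the star product on smooth functions extends the product of the spherical subalgebra `e 𝓡 e`
    (∀ (a b : Dunkl) (f g : MvPolynomial (Fin 2) K), IsPolynomial a f → IsPolynomial b g →
      ∃ h : MvPolynomial (Fin 2) K, IsPolynomial (a ⋆ b) h ∧
        (ordered f * e) * (ordered g * e) = ordered h * e) ∧
    HH₀.mk 1 ≠ 0 ∧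
    ∃ φ : Dunkl →ₗ[K] K,
      IsTrace φ ∧ φ 1 = 1 ∧
      (∀ ψ : Dunkl →ₗ[K] K, IsTrace ψ → ψ 1 = 1 → ψ = φ) ∧
      ∀ f : EvenFun,
        (∃ a : Dunkl, IsNormalOrdering f a) ∧
        ∀ a : Dunkl, IsNormalOrdering f a → HasFormalSum (traceTerm f) (φ a) := by
  refine ⟨fun a b f g ha hb => ⟨rep (ordered f) g, ha.star hb, ?_⟩, mk_one_ne_zero, dunklTrace,
    isTrace_dunklTrace, dunklTrace_one, fun ψ hψ h1 => eq_dunklTrace hψ h1,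
    fun f => ⟨exists_isNormalOrdering f, fun a ha => ha.hasFormalSum⟩⟩
  rw [ordered_rep_mul_e, mul_assoc, hb.e_mul]
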